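/- Setting. A string $u=u_0\cdots u_{m-1}$ with $m\ge 1$ over the alphabet $\{0,\dots,\sigma-1\}$ is read circularly. The context of the occurrence $u_i$ is the infinite string $u_{i+1}u_{i+2}\cdots$ (indices modulo $m$). The eBWT of a finite nonempty collection (with multiplicities) of such strings is the sequence of all characters of the strings, sorted lexicographically by their contexts; ties do not matter, since occurrences with equal contexts carry equal characters. For a single string it is the BWT. The RLBWT of a collection is the list of the maximal runs (character, length) of its eBWT. Let $S_1,\dots,S_k$ be $k\ge 1$ such collections, $n$ the total number of characters in them, and $R$ the total number of runs in their $k$ RLBWTs. Their combined RLBWT is the RLBWT of the union $S_1\cup\dots\cup S_k$ (with multiplicities). Sort the occurrences of characters in all the collections by context, and label each of them by the collection it comes from. Let $L\in\mathbb N\cup\{\infty\}$ be the sum, over all pairs of consecutive occurrences with different labels (block boundaries), of the length of the longest common prefix of their two contexts; this length is $\infty$ if the contexts are equal. Machine. A unit-cost word RAM with $w$-bit words, a constant number of registers, a memory of a given number of words (which initially holds the input), and a write-only output stream that does not count towards the memory. Theorem. For every constant $k\ge 1$ there are a program and constants $C,c$ such that the following holds for all $\sigma$, all $S_1,\dots,S_k$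 as above, and every word size $w\ge C(\lfloor\log_2 (n+\sigma)\rfloor+1)$. Given the RLBWTs of $S_1,\dots,S_k$ (the $k$ numbers of runs, followed by the runs), the program, run with a memory of $C\cdot R$ words including the input, halts and has output exactly the combined RLBWT of $S_1,\dots,S_k$; if $L<\infty$, it does so within $$C\,(L+\sigma+R)\,(\lfloor\log_2 n\rfloor+1)^c$$ steps, that is, in $\tilde O(L+\sigma+R)$ time and $O(R)$ space. -/

import Mathlib

namespace RLBWT

/-! ### Circular strings, contexts and the extended Burrows-Wheeler Transform

Characters are natural numbers (the alphabet of size `σ` is `{0, …, σ - 1}` with its usual order).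
A string is a `List ℕ`, read circularly, and a collection of strings is a `List (List ℕ)`. -/

/-- An occurrence of a character: the character itself, together with its context, which is the
infinite string that starts immediately after the character and wraps around circularly. -/
structure Occ where
  char : ℕ
  ctx : ℕ → ℕ

/-- The occurrence of the `i`-th character in the (nonempty) circular string `u`. -/
def occAt (u : List ℕ) (i : ℕ) : Occ where
  char := u.getD i 0
  ctx := fun t => u.getD ((i + 1 + t) % u.length) 0

/-- All the occurrences of characters in a collection of circular strings. -/
def occs (S : List (List ℕ)) : List Occ :=
  S.flatMap fun u => (List.range u.length).map (occAt u)

open Classical in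
/-- The occurrences of characters, sorted lexicographically by their contexts. -/
noncomputable def sortedOccs (S : List (List ℕ)) : List Occ :=
  (occs S).insertionSort fun a b => toLex a.ctx ≤ toLex b.ctx

/-- The extended Burrows-Wheeler Transform of a collection of circular strings: its characters,
in the lexicographic order of their contexts. (Occurrences with equal contexts have equal
characters, so ties do not matter. For a collection of one string this is the ordinary
Burrows-Wheeler Transform, since the context of a character is the rotation that ends in it.) -/
noncomputable def eBWT (S : List (List ℕ)) : List ℕ :=
  (sortedOccs S).map Occ.char

/-- Run-length encoding: the list of the maximal runs `(character, length)`. -/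
def rle : List ℕ → List (ℕ × ℕ)
  | [] => []
  | a :: l =>
    match rle l with
    | [] => [(a, 1)]
    | (b, m) :: r => if a = b then (a, m + 1) :: r else (a, 1) :: (b, m) :: r

/-- The run-length compressed BWT or eBWT of a collection of circular strings. -/
noncomputable def rlbwt (S : List (List ℕ)) : List (ℕ × ℕ) :=
  rle (eBWT S)

/-! ### Merging `k` collections -/

/-- The union (with multiplicities) of `k` collections. -/
def union {k : ℕ} (S : Fin k → List (List ℕ)) : List (List ℕ) :=
  (List.finRange k).flatMap S

open Classical in
/-- The occurrences of characters in all of the `k` collections, each tagged with the index of the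
collection that it comes from, sorted lexicographically by context. -/
noncomputable def mergedOccs {k : ℕ} (S : Fin k → List (List ℕ)) : List (Fin k × Occ) :=
  ((List.finRange k).flatMap fun j => (occs (S j)).map fun o => (j, o)).insertionSort
    fun a b => toLex a.2.ctx ≤ toLex b.2.ctx

/-- The length of the longest common prefix of two infinite strings (`⊤` if they are equal). -/
noncomputable def lcp (x y : ℕ → ℕ) : ℕ∞ :=
  ⨅ (t : ℕ) (_ : x t ≠ y t), (t : ℕ∞)

/-- The parameter `L`: the sum of the LCP values of the neighbouring contexts at the boundaries, in
the combined eBWT, between blocks of characters from the same original collection. -/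
noncomputable def boundaryLCPSum {k : ℕ} (S : Fin k → List (List ℕ)) : ℕ∞ :=
  (((mergedOccs S).zip (mergedOccs S).tail).map fun p =>
    if p.1.1 = p.2.1 then 0 else lcp p.1.2.ctx p.2.2.ctx).sum

/-- The parameter `R`: the total number of runs in the `k` original RLBWTs. -/
noncomputable def totalRuns {k : ℕ} (S : Fin k → List (List ℕ)) : ℕ :=
  ∑ j, (rlbwt (S j)).length

/-- The total number of characters in the `k` collections. -/
def totalLength {k : ℕ} (S : Fin k → List (List ℕ)) : ℕ :=
  ∑ j, ((S j).map List.length).sum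

/-! ### The word RAM

The machine has words of `w` bits, a memory of `M` words, a fixed finite set of registers (those
that occur in the program) and a write-only output stream. Programs are structured, and every
arithmetic operation, comparison, memory access, assignment, branch and output takes unit time. -/

/-- The binary operations of the machine. -/
inductive Op
  | add | sub | mul | div | lt | eq

/-- The values of the operations, before reduction to `w` bits: subtraction is truncated at `0`,
division rounds down (and `a / 0 = 0`), and comparisons return `1` or `0`. -/
def Op.apply : Op → ℕ → ℕ → ℕ
  | .add, a, b => a + b
  | .sub, a, b => a - b
  | .mul, a, b => a * b
  | .div, a, b => a / b
  | .lt, a, b => if a < b then 1 else 0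
  | .eq, a, b => if a = b then 1 else 0

/-- Expressions: constants, registers, binary operations, and the contents of a memory cell. -/
inductive Expr
  | lit (v : ℕ)
  | reg (x : ℕ)
  | op (o : Op) (a b : Expr)
  | load (a : Expr)

/-- Programs. `put a e` stores the value of `e` in the memory cell with address `a`, and `emit e`
appends the value of `e` to the output stream; a condition is true if it is nonzero. -/
inductive Prog
  | skip
  | assign (x : ℕ) (e : Expr)
  | put (a e : Expr)
  | emit (e : Expr)
  | seq (p q : Prog)
  | ite (e : Expr) (p q : Prog)
  | loop (e : Expr) (p : Prog)

/-- The state of the machine. -/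
structure State where
  regs : ℕ → ℕ
  mem : ℕ → ℕ
  out : List ℕ

/-- The value of an expression with `w`-bit arithmetic, or `none` if its evaluation accesses an
address outside of the memory of `M` words. -/
def Expr.eval (w M : ℕ) (s : State) : Expr → Option ℕ
  | .lit v => some (v % 2 ^ w)
  | .reg x => some (s.regs x)
  | .op o a b =>
    match a.eval w M s, b.eval w M s with
    | some u, some v => some (o.apply u v % 2 ^ w)
    | _, _ => none
  | .load a =>
    match a.eval w M s with
    | some i => if i < M then some (s.mem i) else none
    | none => none

/-- The time to evaluate an expression: its number of nodes. -/
def Expr.cost : Expr → ℕ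
  | .lit _ => 1
  | .reg _ => 1
  | .op _ a b => a.cost + b.cost + 1
  | .load a => a.cost + 1

/-- `Run w M p s t s'`: on the machine with `w`-bit words and `M` words of memory, the program `p`
started in the state `s` halts in the state `s'` after exactly `t` steps. (A computation that
accesses an address outside of the memory gets stuck, so it does not halt in this sense.) -/
inductive Run (w M : ℕ) : Prog → State → ℕ → State → Prop
  | skip (s : State) : Run w M .skip s 1 s
  | assign {s : State} {x : ℕ} {e : Expr} {v : ℕ} (he : e.eval w M s = some v) :
      Run w M (.assign x e) s (e.cost + 1) { s with regs := Function.update s.regs x v }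
  | put {s : State} {a e : Expr} {i v : ℕ} (ha : a.eval w M s = some i) (hi : i < M)
      (he : e.eval w M s = some v) :
      Run w M (.put a e) s (a.cost + e.cost + 1) { s with mem := Function.update s.mem i v }
  | emit {s : State} {e : Expr} {v : ℕ} (he : e.eval w M s = some v) :
      Run w M (.emit e) s (e.cost + 1) { s with out := s.out ++ [v] }
  | seq {p q : Prog} {s s₁ s₂ : State} {t₁ t₂ : ℕ} (hp : Run w M p s t₁ s₁)
      (hq : Run w M q s₁ t₂ s₂) : Run w M (.seq p q) s (t₁ + t₂) s₂
  | ite_true {e : Expr} {p q : Prog} {s s' : State} {v t : ℕ} (he : e.eval w M s = some v)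
      (hv : v ≠ 0) (hp : Run w M p s t s') : Run w M (.ite e p q) s (e.cost + 1 + t) s'
  | ite_false {e : Expr} {p q : Prog} {s s' : State} {t : ℕ} (he : e.eval w M s = some 0)
      (hq : Run w M q s t s') : Run w M (.ite e p q) s (e.cost + 1 + t) s'
  | loop_true {e : Expr} {p : Prog} {s s₁ s₂ : State} {v t₁ t₂ : ℕ}
      (he : e.eval w M s = some v) (hv : v ≠ 0) (hp : Run w M p s t₁ s₁)
      (hl : Run w M (.loop e p) s₁ t₂ s₂) : Run w M (.loop e p) s (e.cost + 1 + t₁ + t₂) s₂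
  | loop_false {e : Expr} {p : Prog} {s : State} (he : e.eval w M s = some 0) :
      Run w M (.loop e p) s (e.cost + 1) s

/-- The initial state on a given input: the input is written at the beginning of the memory, all
other words are `0`, and the output is empty. -/
def initState (w : ℕ) (input : List ℕ) : State where
  regs := fun _ => 0
  mem := fun a => input.getD a 0 % 2 ^ w
  out := []

/-- A run-length encoded string as a sequence of words: character, length, character, length, … -/
def encodeRuns (B : List (ℕ × ℕ)) : List ℕ :=
  B.flatMap fun r => [r.1, r.2]

/-- The input for `k` RLBWTs as a sequence of words: the `k` numbers of runs, followed by the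
encodings of the `k` RLBWTs. -/
noncomputable def encodeInput {k : ℕ} (S : Fin k → List (List ℕ)) : List ℕ :=
  (List.finRange k).map (fun j => (rlbwt (S j)).length) ++
    (List.finRange k).flatMap fun j => encodeRuns (rlbwt (S j))

end RLBWT

namespace RLBWT

/-! ### A program logic for the word RAM -/

/-! The program interleaves the sorted occurrences of the collections block by block, a block being
a maximal stretch of the merged order with one label. For every collection it stores the next unread
position and the rank of that position in the merged order (`Model.head`). If `N` occurrences have
been output, the collection whose head has rank `N` owns the current block, and the smallest rank of
another head is the end of the block; up to there whole pieces of runs are copied. Ranks are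
computed for the initial heads and whenever a block ends. The rank of an occurrence is the sum over
the collections of the number of smaller occurrences, and each of these numbers is found by binary
search (`rankProg_spec`).

A search compares contexts character by character. A stable sort of the runs by character yields the
first characters of the sorted contexts, and equal offsets in a run before and after sorting belong
to a context and its tail (`Model.first_last`). So one step along a context is a binary search among
the runs (`psiProg_spec`), and a comparison takes as many steps as the common prefix is long, plus a
constant (`cmpProg_spec`). Contexts are periodic, and two of them that agree on `n * n` characters
are equal; capping the comparisons there makes the program halt also if `L` is infinite, with ties
decided by collection number.

For the time, let a block begin at `t`. In the sorted order the common prefix of the context of `t`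
with one from another collection is at most the one across the boundary before or after the block
(`common_le_reach`). Each boundary serves at most two blocks, so these bounds add up to at most `2 *
L` (`sum_reach_le`). There are at most `L + σ` blocks, because at a boundary with empty common
prefix the first character of the context increases (`card_starts_le`). Every piece that is output
begins at the beginning of a block or of a run. Radix sort of the runs costs about `R * log (k *
σ)`, which is at most `2 * R * log R + σ + R` up to a constant factor (`mul_clog_mul_le`).

The program is verified against an abstract `Model` with the laws `Model.Valid` (`mainProg_spec`);
`valid_stringModel` derives these laws for collections of strings, and `mainTime_le` collects the
costs. -/

/-- The state after an assignment to a register. -/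
def State.set (s : State) (x v : ℕ) : State := { s with regs := Function.update s.regs x v }

/-- The state after a write to the memory. -/
def State.store (s : State) (i v : ℕ) : State := { s with mem := Function.update s.mem i v }

/-- The state after an output. -/
def State.write (s : State) (v : ℕ) : State := { s with out := s.out ++ [v] }

section StateLemmas
variable (s : State) (x y v : ℕ)

@[simp] theorem State.set_regs : (s.set x v).regs y = if y = x then v else s.regs y := by
  simp [State.set, Function.update_apply]
@[simp] theorem State.set_mem : (s.set x v).mem = s.mem := rfl
@[simp] theorem State.set_out : (s.set x v).out = s.out := rfl
@[simp] theorem State.store_regs : (s.store x v).regs = s.regs := rfl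
@[simp] theorem State.store_mem : (s.store x v).mem y = if y = x then v else s.mem y := by
  simp [State.store, Function.update_apply]
@[simp] theorem State.store_out : (s.store x v).out = s.out := rfl
@[simp] theorem State.write_regs : (s.write v).regs = s.regs := rfl
@[simp] theorem State.write_mem : (s.write v).mem = s.mem := rfl
@[simp] theorem State.write_out : (s.write v).out = s.out ++ [v] := rfl

end StateLemmas

/-- No reduction to `w` bits takes place in the operation. -/
def Op.ok (w : ℕ) : Op → ℕ → ℕ → Prop
  | .add, a, b => a + b < 2 ^ w
  | .sub, a, _ => a < 2 ^ w
  | .mul, a, b => a * b < 2 ^ w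
  | .div, a, _ => a < 2 ^ w
  | .lt, _, _ => True
  | .eq, _, _ => True

theorem Op.apply_lt {w : ℕ} (hw : 0 < w) {o : Op} {a b : ℕ} (h : o.ok w a b) :
    o.apply a b < 2 ^ w := by
  have h1 : 1 < 2 ^ w := Nat.one_lt_two_pow hw.ne'
  cases o <;> simp only [Op.ok, Op.apply] at *
  · exact h
  · omega
  · exact h
  · exact lt_of_le_of_lt (Nat.div_le_self _ _) h
  · split_ifs <;> omega
  · split_ifs <;> omega

/-- The value of an expression over the natural numbers. -/
def Expr.val (s : State) : Expr → ℕ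
  | .lit v => v
  | .reg x => s.regs x
  | .op o a b => o.apply (a.val s) (b.val s)
  | .load a => s.mem (a.val s)

/-- An expression evaluates without overflow and without illegal memory accesses. -/
def Expr.ok (w M : ℕ) (s : State) : Expr → Prop
  | .lit v => v < 2 ^ w
  | .reg _ => True
  | .op o a b => a.ok w M s ∧ b.ok w M s ∧ o.ok w (a.val s) (b.val s)
  | .load a => a.ok w M s ∧ a.val s < M

/-- Without overflow every reduction modulo `2 ^ w` is the identity, so all later reasoning takes
place in `ℕ`. The word size must be positive since comparisons return `1`. -/
theorem Expr.eval_eq {w M : ℕ} (hw : 0 < w) {s : State} :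
    ∀ {e : Expr}, e.ok w M s → e.eval w M s = some (e.val s)
  | .lit v, h => by simp only [Expr.eval, Expr.val]; rw [Nat.mod_eq_of_lt h]
  | .reg x, _ => rfl
  | .op o a b, h => by
    simp only [Expr.eval, Expr.val, Expr.eval_eq hw h.1, Expr.eval_eq hw h.2.1]
    rw [Nat.mod_eq_of_lt (Op.apply_lt hw h.2.2)]
  | .load a, h => by
    simp only [Expr.eval, Expr.val, Expr.eval_eq hw h.1, if_pos h.2]

/-- The program halts within `T` steps, in a state that satisfies `Q`. -/
def Ex (w M : ℕ) (p : Prog) (s : State) (T : ℕ) (Q : State → Prop) : Prop :=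
  ∃ t s', Run w M p s t s' ∧ t ≤ T ∧ Q s'

variable {w M : ℕ}

theorem Ex.mono {p : Prog} {s : State} {T T' : ℕ} {Q Q' : State → Prop} (h : Ex w M p s T Q)
    (hT : T ≤ T') (hQ : ∀ s', Q s' → Q' s') : Ex w M p s T' Q' := by
  obtain ⟨t, s', h1, h2, h3⟩ := h
  exact ⟨t, s', h1, h2.trans hT, hQ _ h3⟩

theorem Ex.seq {p q : Prog} {s : State} {T₁ T₂ : ℕ} {Q : State → Prop}
    (h : Ex w M p s T₁ fun s₁ => Ex w M q s₁ T₂ Q) : Ex w M (.seq p q) s (T₁ + T₂) Q := by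
  obtain ⟨t, s', h1, h2, t', s'', h3, h4, h5⟩ := h
  exact ⟨_, _, .seq h1 h3, add_le_add h2 h4, h5⟩

/-- Sequential composition with a separate specification of the first program. -/
theorem Ex.seq_of {p q : Prog} {s : State} {T₁ T₂ T : ℕ} {Q₁ Q : State → Prop}
    (h₁ : Ex w M p s T₁ Q₁) (h₂ : ∀ s₁, Q₁ s₁ → Ex w M q s₁ T₂ Q) (hT : T₁ + T₂ ≤ T) :
    Ex w M (.seq p q) s T Q :=
  (Ex.seq (h₁.mono le_rfl h₂)).mono hT fun _ => id

theorem Ex.ite (hw : 0 < w) {e : Expr} {p q : Prog} {s : State} {T : ℕ} {Q : State → Prop}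
    (he : e.ok w M s) (hp : e.val s ≠ 0 → Ex w M p s T Q) (hq : e.val s = 0 → Ex w M q s T Q) :
    Ex w M (.ite e p q) s (e.cost + 1 + T) Q := by
  by_cases hv : e.val s = 0
  · obtain ⟨t, s', h1, h2, h3⟩ := hq hv
    exact ⟨_, _, .ite_false (hv ▸ Expr.eval_eq hw he) h1, by omega, h3⟩
  · obtain ⟨t, s', h1, h2, h3⟩ := hp hv
    exact ⟨_, _, .ite_true (Expr.eval_eq hw he) hv h1, by omega, h3⟩

/-- The loop rule, with an indexed invariant and a potential function on the indices. -/
theorem Ex.loop (hw : 0 < w) {α : Type*} (I : α → State → Prop) (φ : α → ℕ) {e : Expr} {p : Prog}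
    {Q : State → Prop}
    (step : ∀ a s, I a s → e.ok w M s ∧
      (e.val s ≠ 0 → ∃ T, Ex w M p s T fun s' => ∃ a', I a' s' ∧ T + (e.cost + 1) + φ a' ≤ φ a) ∧
      (e.val s = 0 → Q s))
    (a : α) (s : State) (h : I a s) : Ex w M (.loop e p) s (φ a + (e.cost + 1)) Q := by
  -- The guard has positive cost, so the potential drops strictly in every iteration; this gives
  -- termination and the time bound at once.
  induction hm : φ a using Nat.strong_induction_on generalizing a s with
  | _ m ih =>
    subst hm
    obtain ⟨he, h1, h0⟩ := step a s h
    by_cases hv : e.val s = 0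
    · exact ⟨_, _, .loop_false (hv ▸ Expr.eval_eq hw he), by omega, h0 hv⟩
    · obtain ⟨T, t, s', hr, ht, a', hI, hφ⟩ := h1 hv
      obtain ⟨t', s'', hr', ht', hQ⟩ := ih (φ a') (by omega) a' s' hI rfl
      exact ⟨_, _, .loop_true (Expr.eval_eq hw he) hv hr hr', by omega, hQ⟩

/-- The rule for loops in which an index runs from `i` to `b`. -/
theorem Ex.for_loop (hw : 0 < w) (I : ℕ → State → Prop) (b T : ℕ) {e : Expr} {p : Prog}
    (he : ∀ i s, I i s → i ≤ b → e.ok w M s ∧ (e.val s ≠ 0 ↔ i < b))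
    (step : ∀ i s, I i s → i < b → Ex w M p s T (I (i + 1)))
    (i : ℕ) (s : State) (hi : i ≤ b) (h : I i s) :
    Ex w M (.loop e p) s ((b - i) * (T + (e.cost + 1)) + (e.cost + 1)) (I b) := by
  refine Ex.loop hw (fun i s => I i s ∧ i ≤ b) (fun i => (b - i) * (T + (e.cost + 1))) ?_ i s
    ⟨h, hi⟩
  rintro i s ⟨h, hi⟩
  obtain ⟨h1, h2⟩ := he i s h hi
  refine ⟨h1, fun hv => ⟨T, (step i s h (h2.1 hv)).mono le_rfl fun s' hs' => ⟨i + 1,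
    ⟨hs', h2.1 hv⟩, ?_⟩⟩, fun hv => ?_⟩
  · have := h2.1 hv
    obtain ⟨d, rfl⟩ : ∃ d, b = i + 1 + d := ⟨b - (i + 1), by omega⟩
    rw [show i + 1 + d - (i + 1) = d by omega, show i + 1 + d - i = d + 1 by omega]
    ring_nf
    exact le_rfl
  · have : ¬ i < b := fun hh => h2.2 hh hv
    rwa [show b = i by omega]

/-- The weakest precondition of a program without loops (with respect to overflow-free,
in-bounds executions). -/
def Prog.wp (w M : ℕ) : Prog → (State → Prop) → State → Prop
  | .skip, Q, s => Q s
  | .assign x e, Q, s => e.ok w M s ∧ Q (s.set x (e.val s))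
  | .put a e, Q, s =>
    a.ok w M s ∧ a.val s < M ∧ e.ok w M s ∧ Q (s.store (a.val s) (e.val s))
  | .emit e, Q, s => e.ok w M s ∧ Q (s.write (e.val s))
  | .seq p q, Q, s => p.wp w M (q.wp w M Q) s
  | .ite e p q, Q, s =>
    e.ok w M s ∧ (e.val s ≠ 0 → p.wp w M Q s) ∧ (e.val s = 0 → q.wp w M Q s)
  | .loop _ _, _, _ => False

/-- An upper bound for the running time of a program without loops. -/
def Prog.time : Prog → ℕ
  | .skip => 1
  | .assign _ e => e.cost + 1
  | .put a e => a.cost + e.cost + 1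
  | .emit e => e.cost + 1
  | .seq p q => p.time + q.time
  | .ite e p q => e.cost + 1 + (p.time + q.time)
  | .loop _ _ => 0

/-- `Prog.time` charges both branches of a conditional, so it does not depend on the state and
`simp` evaluates it. -/
theorem Ex.of_wp (hw : 0 < w) {p : Prog} {s : State} {Q : State → Prop} {T : ℕ}
    (hT : p.time ≤ T) (h : p.wp w M Q s) : Ex w M p s T Q := by
  suffices H : Ex w M p s p.time Q from H.mono hT fun _ => id
  clear hT
  induction p generalizing s Q with
  | skip => exact ⟨_, _, .skip s, le_rfl, h⟩
  | assign x e => exact ⟨_, _, .assign (Expr.eval_eq hw h.1), le_rfl, h.2⟩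
  | put a e =>
    exact ⟨_, _, .put (Expr.eval_eq hw h.1) h.2.1 (Expr.eval_eq hw h.2.2.1), le_rfl, h.2.2.2⟩
  | emit e => exact ⟨_, _, .emit (Expr.eval_eq hw h.1), le_rfl, h.2⟩
  | seq p q ihp ihq => exact Ex.seq ((ihp h).mono le_rfl fun s' hs' => ihq hs')
  | ite e p q ihp ihq =>
    exact Ex.ite hw h.1 (fun hv => (ihp (h.2.1 hv)).mono (Nat.le_add_right _ _) fun _ => id)
      (fun hv => (ihq (h.2.2 hv)).mono (Nat.le_add_left _ _) fun _ => id)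
  | loop e p => exact h.elim

/-! ### The abstract merging problem -/

/-- The strict lexicographic order of infinite strings. -/
def LexLt (x y : ℕ → ℕ) : Prop := ∃ m, (∀ i < m, x i = y i) ∧ x m < y m

/-- The combinatorial data of the merging problem. The runs of all the collections are numbered
consecutively, and so are all the positions: `ch` and `ln` are the characters and the lengths of
the runs, `col` is the collection of a run, `X p` is the context of the position `p`, and `lab t`
is the collection from which the `t`-th occurrence in the merged order comes, and `out t` its
character. -/
structure Model where
  k : ℕ
  n : ℕ
  R : ℕ
  σ : ℕ
  cnt : ℕ → ℕ
  ch : ℕ → ℕ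
  ln : ℕ → ℕ
  col : ℕ → ℕ
  X : ℕ → ℕ → ℕ
  lab : ℕ → ℕ
  out : ℕ → ℕ

namespace Model

variable (m : Model)

/-- The first run of a collection. -/
def off (j : ℕ) : ℕ := ∑ i ∈ Finset.range j, m.cnt i

/-- The first position of a run. -/
def start (r : ℕ) : ℕ := ∑ i ∈ Finset.range r, m.ln i

/-- The first position of a collection. -/
def ns (j : ℕ) : ℕ := m.start (m.off j)

/-- The number of occurrences from the collection `a` among the first `t` merged ones. -/
def before (a t : ℕ) : ℕ := ((Finset.range t).filter fun i => m.lab i = a).card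

/-- The position of the `t`-th occurrence in the merged order. -/
def pos (t : ℕ) : ℕ := m.ns (m.lab t) + m.before (m.lab t) t

/-- The order of the occurrences: by context, then by collection. -/
def Less (p a q b : ℕ) : Prop := LexLt (m.X p) (m.X q) ∨ (m.X p = m.X q ∧ a ≤ b)

/-- The order of the runs: by collection, then by character, then by position. -/
def RunLt (r r' : ℕ) : Prop :=
  m.col r < m.col r' ∨ m.col r = m.col r' ∧ (m.ch r < m.ch r' ∨ m.ch r = m.ch r' ∧ r < r')

/-- `A` enumerates the runs in their order. -/
def Sorts (A : ℕ → ℕ) : Prop :=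
  (∀ x < m.R, A x < m.R) ∧ ∀ x y, x < y → y < m.R → m.RunLt (A x) (A y)

/-- The first position, in the sorted order of the runs, of the `x`-th run. -/
def fst (A : ℕ → ℕ) (x : ℕ) : ℕ := ∑ i ∈ Finset.range x, m.ln (A i)

/-- The laws of the combinatorial data. -/
structure Valid : Prop where
  k_pos : 0 < m.k
  cnt_pos : ∀ j < m.k, 0 < m.cnt j
  off_k : m.off m.k = m.R
  start_R : m.start m.R = m.n
  ln_pos : ∀ r < m.R, 0 < m.ln r
  ch_lt : ∀ r < m.R, m.ch r < m.σ
  col_eq : ∀ j r, m.off j ≤ r → r < m.off (j + 1) → j < m.k → m.col r = j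
  fst_R : ∀ A, m.Sorts A → m.fst A m.R = m.n
  -- The forward walk: the context at offset `d` of a sorted run starts with the character of this
  -- run and continues as the context at offset `d` of the same run in its original place.
  fl : ∀ A, m.Sorts A → ∀ x < m.R, ∀ d < m.ln (A x),
    m.X (m.fst A x + d) 0 = m.ch (A x) ∧
      ∀ t, m.X (m.fst A x + d) (t + 1) = m.X (m.start (A x) + d) t
  X_lt : ∀ p < m.n, m.X p 0 < m.σ
  lab_lt : ∀ t < m.n, m.lab t < m.k
  before_n : ∀ j < m.k, m.ns j + m.before j m.n = m.ns (j + 1)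
  mono : ∀ t t', t < t' → t' < m.n → m.Less (m.pos t) (m.lab t) (m.pos t') (m.lab t')
  out_eq : ∀ t < m.n, ∀ r < m.R, m.start r ≤ m.pos t → m.pos t < m.start (r + 1) → m.out t = m.ch r
  -- Justifies the cap `n * n` on the length of a comparison.
  per : ∀ p < m.n, ∀ q < m.n, (∀ t < m.n * m.n, m.X p t = m.X q t) → m.X p = m.X q

/-- The machine is large enough for the problem. -/
structure Fits (w M : ℕ) : Prop where
  mem_le : 5 * m.k + 1 + 6 * m.R ≤ M
  M_lt : M < 2 ^ w
  -- The factor leaves room for sums that are formed before a subtraction or a halving.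
  n_lt : 4 * m.n < 2 ^ w
  nn_lt : m.n * m.n < 2 ^ w
  -- Keys are below `k * σ`; the radix sort also needs the next power of two.
  key_lt : 4 * (m.k * m.σ) < 2 ^ w

end Model

theorem Finset.sum_range_le_of_le {f : ℕ → ℕ} {a b : ℕ} (h : a ≤ b) :
    ∑ i ∈ Finset.range a, f i ≤ ∑ i ∈ Finset.range b, f i :=
  Finset.sum_le_sum_of_subset (Finset.range_subset_range.2 h)

namespace Model.Valid

variable {m : Model} (hv : m.Valid)
include hv

theorem k_le_R : m.k ≤ m.R := by
  rw [← hv.off_k, off]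
  calc m.k = ∑ i ∈ Finset.range m.k, 1 := by simp
    _ ≤ _ := Finset.sum_le_sum fun i hi => hv.cnt_pos i (Finset.mem_range.1 hi)

theorem R_le_n : m.R ≤ m.n := by
  rw [← hv.start_R, start]
  calc m.R = ∑ i ∈ Finset.range m.R, 1 := by simp
    _ ≤ _ := Finset.sum_le_sum fun i hi => hv.ln_pos i (Finset.mem_range.1 hi)

theorem start_le {r : ℕ} (hr : r ≤ m.R) : m.start r ≤ m.n := by
  rw [← hv.start_R]; exact Finset.sum_range_le_of_le hr

theorem fst_le {A : ℕ → ℕ} (hA : m.Sorts A) {x : ℕ} (hx : x ≤ m.R) : m.fst A x ≤ m.n := by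
  rw [← hv.fst_R A hA]; exact Finset.sum_range_le_of_le hx

theorem off_le {j : ℕ} (hj : j ≤ m.k) : m.off j ≤ m.R := by
  rw [← hv.off_k]; exact Finset.sum_range_le_of_le hj

theorem ns_le {j : ℕ} (hj : j ≤ m.k) : m.ns j ≤ m.n := hv.start_le (hv.off_le hj)

end Model.Valid

/-! ### Programs -/

infixl:65 "+ᵉ" => Expr.op Op.add
infixl:65 "-ᵉ" => Expr.op Op.sub
infixl:70 "*ᵉ" => Expr.op Op.mul
infixl:70 "/ᵉ" => Expr.op Op.div
infix:50 "<ᵉ" => Expr.op Op.lt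
infix:50 "=ᵉ" => Expr.op Op.eq
infixr:30 "⨾" => Prog.seq
infix:40 "≔" => Prog.assign

/-- The address `c + d * R + x`, where register `0` contains `R`. -/
def Expr.arr (c d : ℕ) (x : Expr) : Expr := .lit c +ᵉ .lit d *ᵉ .reg 0 +ᵉ x

@[simp] theorem Expr.arr_val (s : State) (c d : ℕ) (x : Expr) :
    (Expr.arr c d x).val s = c + d * s.regs 0 + x.val s := rfl

@[simp] theorem Expr.arr_cost (c d : ℕ) (x : Expr) : (Expr.arr c d x).cost = x.cost + 6 := by
  simp only [Expr.arr, Expr.cost]; omega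

@[simp] theorem Expr.arr_ok (w M : ℕ) (s : State) (c d : ℕ) (x : Expr) :
    (Expr.arr c d x).ok w M s ↔
      d < 2 ^ w ∧ x.ok w M s ∧ c + d * s.regs 0 + x.val s < 2 ^ w := by
  simp only [Expr.arr, Expr.ok, Op.ok, Expr.val, Op.apply]
  constructor
  · tauto
  · rintro ⟨h1, h2, h3⟩
    refine ⟨⟨by omega, ⟨h1, trivial, by omega⟩, by omega⟩, h2, h3⟩

/-- The registers below `b`, the memory and the output are the same in both states. -/
structure Same (b : ℕ) (s s' : State) : Prop where
  regs : ∀ x < b, s'.regs x = s.regs x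
  mem : s'.mem = s.mem
  out : s'.out = s.out

theorem Same.refl (b : ℕ) (s : State) : Same b s s := ⟨fun _ _ => rfl, rfl, rfl⟩

theorem Same.trans {b b' : ℕ} {s s' s'' : State} (h : Same b s s') (h' : Same b' s' s'')
    (hb : b ≤ b') : Same b s s'' :=
  ⟨fun x hx => (h'.regs x (by omega)).trans (h.regs x hx), h'.mem.trans h.mem,
    h'.out.trans h.out⟩

theorem Same.set {b : ℕ} {s s' : State} (h : Same b s s') {x : ℕ} (hx : b ≤ x) (v : ℕ) :
    Same b s (s'.set x v) :=
  ⟨fun y hy => by rw [State.set_regs, if_neg (by omega)]; exact h.regs y hy, h.mem, h.out⟩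

/-- The tables that the merging phase works with are in the memory. -/
structure Ready (m : Model) (A : ℕ → ℕ) (s : State) : Prop where
  reg0 : s.regs 0 = m.R
  reg1 : s.regs 1 = m.n
  ch : ∀ r < m.R, s.mem (m.k + 2 * r) = m.ch r
  ln : ∀ r < m.R, s.mem (m.k + 1 + 2 * r) = m.ln r
  perm : ∀ x < m.R, s.mem (m.k + 2 * m.R + x) = A x
  fst : ∀ x < m.R, s.mem (m.k + 3 * m.R + x) = m.fst A x
  start : ∀ r < m.R, s.mem (m.k + 4 * m.R + r) = m.start r
  ns : ∀ j ≤ m.k, s.mem (m.k + 6 * m.R + j) = m.ns j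

theorem Ready.same {m : Model} {A : ℕ → ℕ} {s s' : State} {b : ℕ} (h : Ready m A s)
    (hs : Same b s s') (hb : 2 ≤ b) : Ready m A s' := by
  obtain ⟨h1, h2, h3, h4, h5, h6, h7, h8⟩ := h
  have := hs.mem
  constructor
  · rw [hs.regs 0 (by omega), h1]
  · rw [hs.regs 1 (by omega), h2]
  all_goals rw [this]; assumption

/-- The longer half of an interval of length `d` has length `(d + 1) / 2`, so one round of a binary
search pays with one unit of `Nat.clog`. -/
theorem clog_half {d : ℕ} (hd : 2 ≤ d) : Nat.clog 2 ((d + 1) / 2) + 1 = Nat.clog 2 d := by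
  rw [Nat.clog_of_two_le one_lt_two hd]; rfl

theorem clog_le_log_add_one (n : ℕ) : Nat.clog 2 n ≤ Nat.log 2 n + 1 :=
  Nat.clog_le_of_le_pow (Nat.lt_pow_succ_log_self one_lt_two n).le

/-- One step of the forward walk from the position in register 50: register 51 receives the first
character of the context and register 50 the position of this character. -/
def psiProg (k : ℕ) : Prog :=
  (52 ≔ .lit 0 ⨾ 53 ≔ .reg 0) ⨾
  .loop (.reg 52 +ᵉ .lit 1 <ᵉ .reg 53)
    (54 ≔ (.reg 52 +ᵉ .reg 53) /ᵉ .lit 2 ⨾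
      .ite (.reg 50 <ᵉ .load (.arr k 3 (.reg 54))) (53 ≔ .reg 54) (52 ≔ .reg 54)) ⨾
  51 ≔ .load (.arr k 2 (.reg 52)) ⨾
  50 ≔ .load (.arr k 4 (.reg 51)) +ᵉ .reg 50 -ᵉ .load (.arr k 3 (.reg 52)) ⨾
  51 ≔ .load (.lit k +ᵉ .lit 2 *ᵉ .reg 51)

attribute [simp] Prog.wp Expr.ok Expr.val Op.ok Op.apply

/-- The sorted run `x` with `fst A x ≤ p < fst A (x + 1)` is unique; its character is the first one
of the context of `p`, and by the law `fl` the offset of `p` in it leads to the position of the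
tail. -/
theorem psiProg_spec {w M : ℕ} (hw : 0 < w) {m : Model} (hv : m.Valid) (hf : m.Fits w M)
    {A : ℕ → ℕ} (hA : m.Sorts A) {s : State} (hs : Ready m A s) (hp : s.regs 50 < m.n) :
    Ex w M (psiProg m.k) s (60 * Nat.clog 2 m.R + 60) fun s' => Same 50 s s' ∧
      s'.regs 50 < m.n ∧ s'.regs 51 = m.X (s.regs 50) 0 ∧
      ∀ t, m.X (s'.regs 50) t = m.X (s.regs 50) (t + 1) := by
  obtain ⟨hf1, hf2, hf3, hf4, hf5⟩ := hf
  have hR := hv.R_le_n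
  have hk := hv.k_le_R
  have hk0 := hv.k_pos
  obtain ⟨p, hpd⟩ : ∃ p, s.regs 50 = p := ⟨_, rfl⟩
  rw [hpd] at hp ⊢
  refine Ex.seq_of (T₁ := 4) (T₂ := 60 * Nat.clog 2 m.R + 50) (Q₁ := fun s' => Same 50 s s' ∧
    s'.regs 50 = p ∧ s'.regs 52 = 0 ∧ s'.regs 53 = m.R) ?_ ?_ (by omega)
  · refine Ex.of_wp hw (by simp [Prog.time, Expr.cost]) ?_
    simp [hs.reg0, hpd]
    exact ((Same.refl 50 s).set (by norm_num) _).set (by norm_num) _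
  rintro s₁ ⟨hs1, h50, h52, h53⟩
  refine Ex.seq_of (T₁ := 60 * Nat.clog 2 m.R + 6) (T₂ := 44) (Q₁ := fun s' => Same 50 s s' ∧
    s'.regs 50 = p ∧ ∃ x, s'.regs 52 = x ∧ x < m.R ∧ m.fst A x ≤ p ∧ p < m.fst A (x + 1))
    ?_ ?_ (by omega)
  -- The index is the search interval `[lo, hi)`, and its potential is the logarithm of its length.
  · refine (Ex.loop hw (α := ℕ × ℕ) (fun a s' => Same 50 s s' ∧ s'.regs 50 = p ∧
      s'.regs 52 = a.1 ∧ s'.regs 53 = a.2 ∧ a.1 < a.2 ∧ a.2 ≤ m.R ∧ m.fst A a.1 ≤ p ∧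
      p < m.fst A a.2) (fun a => 60 * Nat.clog 2 (a.2 - a.1)) ?_ (0, m.R) s₁ ⟨hs1, h50, h52,
        h53, by simp; omega, le_rfl, by simp [Model.fst], by rw [hv.fst_R A hA]; exact hp⟩).mono
      (by simp [Expr.cost]) fun _ => id
    rintro ⟨lo, hi⟩ s' ⟨h1, h2, h3, h4, h5, h6, h7, h8⟩
    simp only at h3 h4 h5 h6 h7 h8
    have hs' := hs.same h1 (by norm_num)
    refine ⟨by simp [h3]; omega, fun hc => ?_, fun hc => ?_⟩
    · simp [h3, h4] at hc
      refine ⟨40, Ex.of_wp hw (by simp [Prog.time, Expr.cost]) ?_⟩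
      have hmid : (lo + hi) / 2 < m.R := by omega
      have hcl := clog_half (d := hi - lo) (by omega)
      simp [h2, h3, h4, hs'.reg0, hs'.fst _ hmid, -Prod.exists]
      refine ⟨by omega, by omega, ?_, ?_⟩
      · intro hlt
        refine ⟨(lo, (lo + hi) / 2), ⟨(h1.set (by norm_num) _).set (by norm_num) _,
          ?_⟩, ?_⟩
        · dsimp only; omega
        · have : Nat.clog 2 ((lo + hi) / 2 - lo) ≤ Nat.clog 2 ((hi - lo + 1) / 2) :=
            Nat.clog_mono_right 2 (by omega)
          simp only [Expr.cost]; omega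
      · intro hlt
        refine ⟨((lo + hi) / 2, hi), ⟨(h1.set (by norm_num) _).set (by norm_num) _,
          ?_⟩, ?_⟩
        · dsimp only; omega
        · have : Nat.clog 2 (hi - (lo + hi) / 2) ≤ Nat.clog 2 ((hi - lo + 1) / 2) :=
            Nat.clog_mono_right 2 (by omega)
          simp only [Expr.cost]; omega
    · simp [h3, h4] at hc
      obtain rfl : hi = lo + 1 := by omega
      exact ⟨h1, h2, lo, h3, by omega, h7, h8⟩
  rintro s₂ ⟨h1, h2, x, hx, h3, h4, h5⟩
  have hs' := hs.same h1 (by norm_num)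
  have hAx := hA.1 x h3
  have hd : p - m.fst A x < m.ln (A x) := by
    have : m.fst A (x + 1) = m.fst A x + m.ln (A x) := Finset.sum_range_succ _ _
    omega
  have hfl := hv.fl A hA x h3 _ hd
  rw [show m.fst A x + (p - m.fst A x) = p by omega] at hfl
  have hstart : m.start (A x + 1) = m.start (A x) + m.ln (A x) := Finset.sum_range_succ _ _
  have hstart' := hv.start_le (r := A x + 1) (by omega)
  refine Ex.of_wp hw (by simp [Prog.time, Expr.cost]) ?_
  simp [h2, hx, hs'.reg0, hs'.fst x h3, hs'.perm x h3, hs'.start _ hAx, hs'.ch _ hAx]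
  refine ⟨by omega, by omega, by omega,
    ((h1.set (by norm_num) _).set (by norm_num) _).set (by norm_num) _, by omega,
    hfl.1.symm, fun t => ?_⟩
  rw [hfl.2, show m.start (A x) + p - m.fst A x = m.start (A x) + (p - m.fst A x) by omega]

/-! ### Bounded common prefixes and the comparison of two contexts. -/

/-- The length of the longest common prefix, but at most `D`. -/
def agree (D : ℕ) (x y : ℕ → ℕ) : ℕ := Nat.findGreatest (fun a => ∀ t < a, x t = y t) D

theorem agree_le (D : ℕ) (x y : ℕ → ℕ) : agree D x y ≤ D := Nat.findGreatest_le D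

theorem eq_of_lt_agree {D : ℕ} {x y : ℕ → ℕ} {t : ℕ} (h : t < agree D x y) : x t = y t :=
  (Nat.findGreatest_spec (P := fun a => ∀ t < a, x t = y t) (Nat.zero_le D) (by simp)) t h

theorem le_agree {D a : ℕ} {x y : ℕ → ℕ} (ha : a ≤ D) (h : ∀ t < a, x t = y t) :
    a ≤ agree D x y := Nat.le_findGreatest ha h

theorem agree_comm (D : ℕ) (x y : ℕ → ℕ) : agree D x y = agree D y x :=
  le_antisymm (le_agree (agree_le _ _ _) fun _ ht => (eq_of_lt_agree ht).symm)
    (le_agree (agree_le _ _ _) fun _ ht => (eq_of_lt_agree ht).symm)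

theorem LexLt.irrefl {x : ℕ → ℕ} (h : LexLt x x) : False := by
  obtain ⟨m, _, h⟩ := h; exact lt_irrefl _ h

theorem LexLt.trans {x y z : ℕ → ℕ} (h : LexLt x y) (h' : LexLt y z) : LexLt x z := by
  obtain ⟨m, h1, h2⟩ := h
  obtain ⟨m', h3, h4⟩ := h'
  rcases lt_trichotomy m m' with hm | rfl | hm
  · exact ⟨m, fun i hi => (h1 i hi).trans (h3 i (by omega)), by rwa [← h3 m hm]⟩
  · exact ⟨m, fun i hi => (h1 i hi).trans (h3 i hi), h2.trans h4⟩
  · exact ⟨m', fun i hi => (h1 i (by omega)).trans (h3 i hi), by rwa [h1 m' hm]⟩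

theorem LexLt.asymm {x y : ℕ → ℕ} (h : LexLt x y) (h' : LexLt y x) : False :=
  (h.trans h').irrefl

/-- The comparison of the contexts of the positions in registers 32 (of the collection in register
23) and 21 (of the collection in register 20). -/
def cmpProg (k : ℕ) : Prog :=
  (40 ≔ .reg 32 ⨾ 41 ≔ .reg 21 ⨾ 42 ≔ .reg 1 *ᵉ .reg 1 ⨾ 43 ≔ (.reg 23 <ᵉ .reg 20)) ⨾
  .loop (.reg 42)
    (50 ≔ .reg 40 ⨾ psiProg k ⨾ (44 ≔ .reg 51 ⨾ 40 ≔ .reg 50 ⨾ 50 ≔ .reg 41) ⨾ psiProg k ⨾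
      41 ≔ .reg 50 ⨾
      .ite (.reg 44 =ᵉ .reg 51) (42 ≔ .reg 42 -ᵉ .lit 1)
        (43 ≔ (.reg 44 <ᵉ .reg 51) ⨾ 42 ≔ .lit 0))

/-- The time for one step of a comparison. -/
def Model.stepTime (m : Model) : ℕ := 120 * Nat.clog 2 m.R + 200

/-- Register 43 starts with the verdict for equal contexts, which depends on the collection numbers
only, and is overwritten at a mismatch. The matching characters and the mismatch take `agree + 1`
rounds; the setup is covered by one more `stepTime`. -/
theorem cmpProg_spec {w M : ℕ} (hw : 0 < w) {m : Model} (hv : m.Valid) (hf : m.Fits w M)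
    {A : ℕ → ℕ} (hA : m.Sorts A) {s : State} (hs : Ready m A s) {x y a b : ℕ}
    (hx : s.regs 32 = x) (hy : s.regs 21 = y) (ha : s.regs 23 = a) (hb : s.regs 20 = b)
    (hxn : x < m.n) (hyn : y < m.n) (hab : a ≠ b) :
    Ex w M (cmpProg m.k) s ((agree (m.n * m.n) (m.X x) (m.X y) + 2) * m.stepTime) fun s' =>
      Same 40 s s' ∧ (s'.regs 43 ≠ 0 ↔ m.Less x a y b) := by
  obtain ⟨hf1, hf2, hf3, hf4, hf5⟩ := id hf
  have hR := hv.R_le_n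
  have hk := hv.k_le_R
  have hk0 := hv.k_pos
  set D := m.n * m.n with hD
  set g := agree D (m.X x) (m.X y) with hg
  refine Ex.seq_of (T₁ := 20) (T₂ := (g + 1) * m.stepTime + 2) (Q₁ := fun s' => Same 40 s s' ∧
    s'.regs 40 = x ∧ s'.regs 41 = y ∧ s'.regs 42 = D ∧ s'.regs 43 = if a < b then 1 else 0)
    ?_ ?_ (by simp only [Model.stepTime]; ring_nf; omega)
  · refine Ex.of_wp hw (by simp [Prog.time, Expr.cost]) ?_
    simp [hs.reg1, hx, hy, ha, hb, ← hD]
    exact ⟨hf4, (((Same.refl 40 s).set (by norm_num) _).set (by norm_num) _).set (by norm_num) _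
      |>.set (by norm_num) _⟩
  rintro s₁ ⟨h1, h40, h41, h42, h43⟩
  -- The index `some t` means that `t` characters have agreed so far, and `none` that a mismatch has
  -- been found and the counter cleared.
  refine (Ex.loop hw (α := Option ℕ) (fun o s' => Same 40 s s' ∧
      match o with
      | none => s'.regs 42 = 0 ∧ (s'.regs 43 ≠ 0 ↔ m.Less x a y b)
      | some t => s'.regs 40 < m.n ∧ s'.regs 41 < m.n ∧ s'.regs 42 = D - t ∧ t ≤ D ∧
          (s'.regs 43 = if a < b then 1 else 0) ∧ (∀ i < t, m.X x i = m.X y i) ∧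
          (∀ i, m.X (s'.regs 40) i = m.X x (t + i)) ∧ (∀ i, m.X (s'.regs 41) i = m.X y (t + i)))
    (fun o => match o with
      | none => 0
      | some t => (g - t + 1) * m.stepTime) ?_ (some 0) s₁
    ⟨h1, by rwa [h40], by rwa [h41], by simpa using h42, by simp, h43, by simp, by simp [h40],
      by simp [h41]⟩).mono (by simp [Expr.cost]) fun _ => id
  rintro (_ | t) s' ⟨h1, h2⟩
  · simp only at h2
    exact ⟨by simp, by simp [h2.1], fun _ => ⟨h1, h2.2⟩⟩
  obtain ⟨h40, h41, h42, htD, h43, hpre, hX, hY⟩ := h2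
  have hs' := hs.same h1 (by norm_num)
  refine ⟨by simp, fun hc => ?_, fun hc => ?_⟩
  · simp [h42] at hc
    refine ⟨120 * Nat.clog 2 m.R + 198, ?_⟩
    refine Ex.seq_of (T₁ := 2) (T₂ := 120 * Nat.clog 2 m.R + 196) (Q₁ := fun s'' => s'' = s'.set 50 (s'.regs 40))
      ?_ ?_ (by omega)
    · exact Ex.of_wp hw (by simp [Prog.time, Expr.cost]) (by simp)
    rintro _ rfl
    refine Ex.seq_of (T₂ := 60 * Nat.clog 2 m.R + 136)
      (psiProg_spec hw hv hf hA (hs'.same ((Same.refl 40 _).set (by norm_num) _) (by norm_num))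
        (by simpa using h40)) ?_ (by omega)
    rintro s₂ ⟨k1, k2, k3, k4⟩
    simp only [State.set_regs, reduceIte] at k3 k4
    have q40 := k1.regs 40 (by norm_num)
    have q41 := k1.regs 41 (by norm_num)
    have q42 := k1.regs 42 (by norm_num)
    have q43 := k1.regs 43 (by norm_num)
    simp at q40 q41 q42 q43
    have k5 : Same 40 s s₂ := (h1.set (x := 50) (by norm_num) (s'.regs 40)).trans k1 (by norm_num)
    refine Ex.seq_of (T₁ := 6) (T₂ := 60 * Nat.clog 2 m.R + 130) (Q₁ := fun s'' =>
      s'' = ((s₂.set 44 (s₂.regs 51)).set 40 (s₂.regs 50)).set 50 (s₂.regs 41)) ?_ ?_ (by omega)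
    · exact Ex.of_wp hw (by simp [Prog.time, Expr.cost]) (by simp)
    rintro _ rfl
    have k6 : Same 40 s (((s₂.set 44 (s₂.regs 51)).set 40 (s₂.regs 50)).set 50 (s₂.regs 41)) :=
      ((k5.set (by norm_num) _).set (by norm_num) _).set (by norm_num) _
    refine Ex.seq_of (T₂ := 70)
      (psiProg_spec hw hv hf hA (hs.same k6 (by norm_num)) (by simpa [q41] using h41)) ?_ (by omega)
    rintro s₃ ⟨l1, l2, l3, l4⟩
    simp only [State.set_regs, reduceIte] at l3 l4
    have r40 := l1.regs 40 (by norm_num)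
    have r44 := l1.regs 44 (by norm_num)
    have r42 := l1.regs 42 (by norm_num)
    have r43 := l1.regs 43 (by norm_num)
    simp at r40 r44 r42 r43
    have l5 : Same 40 s s₃ := k6.trans l1 (by norm_num)
    rw [hX] at k3
    rw [q41, hY] at l3
    refine Ex.of_wp hw (by simp [Prog.time, Expr.cost]) ?_
    have hDw : D < 2 ^ w := hf4
    simp only [Prog.wp, Expr.ok, Expr.val, Op.ok, Op.apply, State.set_regs, reduceIte,
      Nat.reduceEqDiff, r44, k3, l3, r42, q42, h42, true_and, and_true]
    refine ⟨fun heq => ⟨⟨by omega, by omega⟩, some (t + 1), ⟨(l5.set (by norm_num) _).set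
      (by norm_num) _, ?_⟩, ?_⟩, fun hne => ⟨by omega, none, ⟨((l5.set (by norm_num) _).set
        (by norm_num) _).set (by norm_num) _, ?_⟩, ?_⟩⟩
    · have heq : m.X x t = m.X y t := by simpa using heq
      refine ⟨by omega, l2, by omega, by omega, by omega, fun i hi => ?_, fun i => ?_, fun i => ?_⟩
      · rcases Nat.lt_succ_iff_lt_or_eq.1 hi with h | rfl
        · exact hpre i h
        · exact heq
      · rw [r40, k4, hX]; congr 1; omega
      · rw [l4, q41, hY]; congr 1; omega
    · have heq : m.X x t = m.X y t := by simpa using heq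
      have : t + 1 ≤ g := le_agree (by omega) fun i hi => by
        rcases Nat.lt_succ_iff_lt_or_eq.1 hi with h | rfl
        · exact hpre i h
        · exact heq
      obtain ⟨e, he⟩ : ∃ e, g = t + 1 + e := ⟨g - (t + 1), by omega⟩
      dsimp only
      rw [he, show t + 1 + e - (t + 1) = e by omega, show t + 1 + e - t = e + 1 by omega]
      simp only [Expr.cost, Model.stepTime]
      ring_nf; omega
    · have hne : m.X x t ≠ m.X y t := by simpa using hne
      simp only [Model.Less]
      constructor
      · intro h
        have : m.X x t < m.X y t := by by_contra hcon; simp [hcon] at h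
        exact Or.inl ⟨t, hpre, this⟩
      · intro h
        have hlt : m.X x t < m.X y t := by
          rcases h with ⟨t', h1, h2⟩ | ⟨h1, _⟩
          · rcases lt_trichotomy t t' with h | rfl | h
            · exact absurd (h1 t h) hne
            · exact h2
            · exact absurd (hpre t' h) h2.ne
          · exact absurd (congrFun h1 t) hne
        simp [hlt]
    · have : 1 * m.stepTime ≤ (g - t + 1) * m.stepTime := Nat.mul_le_mul_right _ (by omega)
      simp only [Expr.cost, Model.stepTime] at *
      omega
  · simp [h42] at hc
    -- The counter has run out without a mismatch: the contexts agree on `n * n` characters, hence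
    -- everywhere.
    obtain rfl : t = D := by omega
    have heq := hv.per x hxn y hyn hpre
    refine ⟨h1, ?_⟩
    rw [h43]
    simp only [Model.Less, heq, true_and]
    constructor
    · intro h
      have : a < b := by by_contra hcon; simp [hcon] at h
      exact Or.inr this.le
    · rintro (h | h)
      · exact h.irrefl.elim
      · simp; omega

/-! ### The merged order -/

namespace Model

variable (m : Model)

theorem before_succ (a t : ℕ) :
    m.before a (t + 1) = m.before a t + if m.lab t = a then 1 else 0 := by
  unfold before
  rw [Finset.range_add_one, Finset.filter_insert]
  split_ifs with h
  · rw [Finset.card_insert_of_notMem (by simp)]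
  · rfl

theorem before_mono (a : ℕ) {t t' : ℕ} (h : t ≤ t') : m.before a t ≤ m.before a t' :=
  Finset.card_le_card (Finset.filter_subset_filter _ (Finset.range_subset_range.2 h))

theorem before_lt {t t' : ℕ} (h : t < t') : m.before (m.lab t) t < m.before (m.lab t) t' := by
  have h1 := m.before_succ (m.lab t) t
  have h2 := m.before_mono (m.lab t) (show t + 1 ≤ t' from h)
  simp at h1; omega

theorem exists_of_lt_before {a d T : ℕ} (h : d < m.before a T) :
    ∃ t < T, m.lab t = a ∧ m.before a t = d := by
  induction T with
  | zero => simp [before] at h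
  | succ T ih =>
    by_cases hd : d < m.before a T
    · obtain ⟨t, h1, h2⟩ := ih hd
      exact ⟨t, by omega, h2⟩
    · rw [before_succ] at h
      split_ifs at h with hl
      · exact ⟨T, by omega, hl, by omega⟩
      · omega

theorem before_eq_of_forall {a t t' : ℕ} (h : t ≤ t') (hne : ∀ i, t ≤ i → i < t' → m.lab i ≠ a) :
    m.before a t' = m.before a t := by
  induction t', h using Nat.le_induction with
  | base => rfl
  | succ t' h ih =>
    rw [before_succ, if_neg (hne t' h (by omega)), add_zero]
    exact ih fun i h1 h2 => hne i h1 (by omega)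

theorem before_eq_add {a t d : ℕ} (heq : ∀ i, t ≤ i → i < t + d → m.lab i = a) :
    m.before a (t + d) = m.before a t + d := by
  induction d with
  | zero => rfl
  | succ d ih =>
    rw [← add_assoc, before_succ, if_pos (heq _ (by omega) (by omega)),
      ih fun i h1 h2 => heq i h1 (by omega)]
    rfl

theorem exists_head (a N : ℕ) : ∃ t, N ≤ t ∧ (m.n ≤ t ∨ m.lab t = a) :=
  ⟨max N m.n, le_max_left _ _, Or.inl (le_max_right _ _)⟩

/-- The first index from `N` on of an occurrence from the collection `a` (or `n`). -/
def head (a N : ℕ) : ℕ := Nat.find (m.exists_head a N)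

theorem exists_next (N : ℕ) : ∃ t, N < t ∧ (m.n ≤ t ∨ m.lab t ≠ m.lab N) :=
  ⟨max (N + 1) m.n, by simp, Or.inl (le_max_right _ _)⟩

/-- The index at which the block of occurrences that contains `N` ends. -/
def next (N : ℕ) : ℕ := Nat.find (m.exists_next N)

variable {m}

theorem le_head (a N : ℕ) : N ≤ m.head a N := (Nat.find_spec (m.exists_head a N)).1

theorem head_le {a N t : ℕ} (h : N ≤ t) (ht : m.n ≤ t ∨ m.lab t = a) : m.head a N ≤ t :=
  Nat.find_min' _ ⟨h, ht⟩

theorem head_le_n {a N : ℕ} (h : N ≤ m.n) : m.head a N ≤ m.n := head_le h (Or.inl le_rfl)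

theorem lab_head {a N : ℕ} (h : m.head a N < m.n) : m.lab (m.head a N) = a :=
  (Nat.find_spec (m.exists_head a N)).2.resolve_left (by exact not_le.2 h)

theorem lab_ne_of_lt_head {a N t : ℕ} (h : N ≤ t) (ht : t < m.head a N) : m.lab t ≠ a :=
  fun hl => absurd (head_le h (Or.inr hl)) (by omega)

theorem head_self {N : ℕ} : m.head (m.lab N) N = N :=
  le_antisymm (head_le le_rfl (Or.inr rfl)) (le_head _ _)

/-- This keeps the stored ranks of the other collections valid while a block is output. -/
theorem head_eq {a N N' : ℕ} (h : N ≤ N') (h' : N' ≤ m.head a N) : m.head a N' = m.head a N := by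
  refine le_antisymm ?_ ?_
  · exact head_le h' (Nat.find_spec (m.exists_head a N)).2
  · exact head_le (h.trans (le_head _ _)) (Nat.find_spec (m.exists_head a N')).2

theorem before_head (a N : ℕ) : m.before a (m.head a N) = m.before a N :=
  m.before_eq_of_forall (le_head _ _) fun _ h1 h2 => lab_ne_of_lt_head h1 h2

theorem lt_next (N : ℕ) : N < m.next N := (Nat.find_spec (m.exists_next N)).1

theorem next_le {N t : ℕ} (h : N < t) (ht : m.n ≤ t ∨ m.lab t ≠ m.lab N) : m.next N ≤ t :=
  Nat.find_min' _ ⟨h, ht⟩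

theorem next_le_n {N : ℕ} (h : N < m.n) : m.next N ≤ m.n := next_le h (Or.inl le_rfl)

theorem lab_next {N : ℕ} (h : m.next N < m.n) : m.lab (m.next N) ≠ m.lab N :=
  (Nat.find_spec (m.exists_next N)).2.resolve_left (by exact not_le.2 h)

theorem lab_eq_of_lt_next {N t : ℕ} (h : N ≤ t) (ht : t < m.next N) : m.lab t = m.lab N := by
  rcases h.eq_or_lt with rfl | h
  · rfl
  · by_contra hl
    exact absurd (next_le h (Or.inr hl)) (by omega)

theorem next_le_head {a N : ℕ} (hN : N < m.n) (ha : a ≠ m.lab N) : m.next N ≤ m.head a N := by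
  have h1 := le_head (m := m) a N
  by_cases h : m.head a N < m.n
  · have h2 := lab_head h
    refine next_le (lt_of_le_of_ne h1 fun hh => ha ?_) (Or.inr (h2.trans_ne ha))
    rw [← h2, ← hh]
  · exact (next_le_n hN).trans (by omega)

/-- A block that ends before `n` ends at the head of another collection; so its end is the minimum
of the other heads. -/
theorem exists_head_eq_next {N : ℕ} (h : m.next N < m.n) :
    m.lab (m.next N) ≠ m.lab N ∧ m.head (m.lab (m.next N)) N = m.next N := by
  refine ⟨lab_next h, le_antisymm (head_le (lt_next N).le (Or.inr rfl)) ?_⟩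
  by_contra hh
  exact lab_next h ((lab_head (by omega)).symm.trans
    (lab_eq_of_lt_next (le_head _ _) (not_le.1 hh)))

namespace Valid

variable (hv : m.Valid)
include hv

/-- Reduces the rank of an occurrence to counts inside the single collections. -/
theorem sum_before {t : ℕ} (ht : t ≤ m.n) : ∑ a ∈ Finset.range m.k, m.before a t = t := by
  induction t with
  | zero => simp [before]
  | succ t ih =>
    simp only [before_succ, Finset.sum_add_distrib, ih (by omega)]
    rw [Finset.sum_ite_eq, if_pos (Finset.mem_range.2 (hv.lab_lt t (by omega)))]

theorem ns_add_before_le {a t : ℕ} (ha : a < m.k) (ht : t ≤ m.n) :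
    m.ns a + m.before a t ≤ m.ns (a + 1) := by
  rw [← hv.before_n a ha]
  exact Nat.add_le_add_left (m.before_mono a ht) _

theorem pos_lt_ns {t : ℕ} (ht : t < m.n) : m.pos t < m.ns (m.lab t + 1) := by
  have h1 := m.before_lt ht
  have h2 := hv.before_n _ (hv.lab_lt t ht)
  unfold pos; omega

theorem pos_lt {t : ℕ} (ht : t < m.n) : m.pos t < m.n :=
  (hv.pos_lt_ns ht).trans_le (hv.ns_le (hv.lab_lt t ht))

theorem exists_pos {a x : ℕ} (ha : a < m.k) (h1 : m.ns a ≤ x) (h2 : x < m.ns (a + 1)) :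
    ∃ t < m.n, m.lab t = a ∧ m.pos t = x := by
  have h3 := hv.before_n a ha
  obtain ⟨t, ht, hl, hb⟩ := m.exists_of_lt_before (show x - m.ns a < m.before a m.n by omega)
  refine ⟨t, ht, hl, ?_⟩
  rw [pos, hl, hb]; omega

omit hv in
theorem ns_mono {a b : ℕ} (h : a ≤ b) : m.ns a ≤ m.ns b :=
  Finset.sum_range_le_of_le (Finset.sum_range_le_of_le h)

theorem pos_inj {t t' : ℕ} (ht : t < m.n) (ht' : t' < m.n) (h : m.pos t = m.pos t') : t = t' := by
  have key : ∀ {t t' : ℕ}, t < m.n → t' < m.n → m.pos t = m.pos t' → m.lab t ≤ m.lab t' := by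
    intro t t' ht ht' h
    by_contra hlt
    have h1 := hv.pos_lt_ns ht'
    have h2 := ns_mono (m := m) (show m.lab t' + 1 ≤ m.lab t by omega)
    have h3 : m.ns (m.lab t) ≤ m.pos t := Nat.le_add_right _ _
    omega
  have hl := le_antisymm (key ht ht' h) (key ht' ht h.symm)
  rcases lt_trichotomy t t' with hlt | rfl | hlt
  · have := m.before_lt hlt
    simp only [pos, hl] at h this; omega
  · rfl
  · have := m.before_lt hlt
    simp only [pos, hl] at h this; omega

/-- Along one collection, being smaller than the `t`-th merged occurrence is a monotone predicate
with an explicit threshold, as a binary search requires. As the labels differ, equal contexts cause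
no ambiguity. -/
theorem less_iff {t a x : ℕ} (ht : t < m.n) (ha : a < m.k) (hne : a ≠ m.lab t)
    (h1 : m.ns a ≤ x) (h2 : x < m.ns (a + 1)) :
    m.Less x a (m.pos t) (m.lab t) ↔ x < m.ns a + m.before a t := by
  obtain ⟨t', ht', rfl, rfl⟩ := hv.exists_pos ha h1 h2
  rcases lt_trichotomy t' t with hlt | rfl | hlt
  · exact ⟨fun _ => Nat.add_lt_add_left (m.before_lt hlt) _, fun _ => hv.mono _ _ hlt ht⟩
  · exact absurd rfl hne
  · refine ⟨fun h => ?_, fun h => ?_⟩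
    · exfalso
      rcases hv.mono _ _ hlt ht' with h3 | ⟨h3, h4⟩ <;> rcases h with h5 | ⟨h5, h6⟩
      · exact h3.asymm h5
      · rw [h5] at h3; exact h3.irrefl
      · rw [h3] at h5; exact h5.irrefl
      · omega
    · have := m.before_mono (m.lab t') hlt.le
      unfold pos at h; omega

end Valid

/-! ### The cost of ranking the first element of a block -/

variable (m)

/-- The (bounded) length of the common prefix of the contexts of two merged occurrences. -/
def common (t t' : ℕ) : ℕ := agree (m.n * m.n) (m.X (m.pos t)) (m.X (m.pos t'))

/-- The weight of the block boundary after `t`. -/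
def weight (t : ℕ) : ℕ := if m.lab t = m.lab (t + 1) then 0 else m.common t (t + 1)

/-- A block of occurrences begins at `t`. -/
def IsStart (t : ℕ) : Prop := t = 0 ∨ m.lab (t - 1) ≠ m.lab t

instance : DecidablePred m.IsStart := fun _ => inferInstanceAs (Decidable (_ ∨ _))

/-- A bound for the common prefixes of an element with those from other collections, if a block
begins at the element. -/
def reach (t : ℕ) : ℕ :=
  (if t = 0 then 0 else m.weight (t - 1)) + if m.next t < m.n then m.weight (m.next t - 1) else 0

variable {m}

/-- If the middle string left the common prefix of the outer two, the deviation would put it above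
both or below both. -/
theorem Less.sandwich {p a q b r c : ℕ} (h : m.Less p a q b) (h' : m.Less q b r c) {e : ℕ}
    (hpr : ∀ i < e, m.X p i = m.X r i) :
    (∀ i < e, m.X p i = m.X q i) ∧ ∀ i < e, m.X q i = m.X r i := by
  rcases h with ⟨i1, h1, h2⟩ | ⟨h1, _⟩
  · rcases h' with ⟨i2, h3, h4⟩ | ⟨h3, _⟩
    · have hi1 : e ≤ i1 := by
        by_contra hlt
        have h5 := hpr i1 (by omega)
        rcases lt_trichotomy i1 i2 with h | rfl | h
        · have := h3 i1 h; omega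
        · omega
        · have h6 := hpr i2 (by omega)
          have := h1 i2 h; omega
      refine ⟨fun i hi => h1 i (by omega), fun i hi => ?_⟩
      rw [← h1 i (by omega), hpr i hi]
    · exact ⟨fun i hi => by rw [h3]; exact hpr i hi, fun i hi => by rw [h3]⟩
  · exact ⟨fun i hi => by rw [h1], fun i hi => by rw [← h1]; exact hpr i hi⟩

namespace Valid

variable (hv : m.Valid)
include hv

/-- Two applications of the sandwich replace the outer pair by any neighbouring pair between them.
-/
theorem common_le {t₁ t t₃ : ℕ} (h1 : t₁ ≤ t) (h2 : t < t₃) (h3 : t₃ < m.n) :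
    m.common t₁ t₃ ≤ m.common t (t + 1) := by
  have key1 : m.common t₁ t₃ ≤ m.common t t₃ := by
    rcases h1.eq_or_lt with rfl | h1
    · exact le_rfl
    · exact le_agree (agree_le _ _ _) ((hv.mono _ _ h1 (h2.trans h3)).sandwich (hv.mono _ _ h2 h3) fun _ hi => eq_of_lt_agree hi).2
  refine key1.trans ?_
  rcases (show t + 1 ≤ t₃ from h2).eq_or_lt with h | h
  · rw [h]
  · exact le_agree (agree_le _ _ _) ((hv.mono _ _ (Nat.lt_succ_self t) (h.trans h3)).sandwich
      (hv.mono _ _ h h3) fun _ hi => eq_of_lt_agree hi).1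

/-- The two occurrences are separated by a boundary of the block that begins at `t`: the one just
before `t` if `t' < t`, and the one just before `next t` otherwise. Now `common_le` applies. -/
theorem common_le_reach {t t' : ℕ} (ht : t < m.n) (ht' : t' < m.n) (hs : m.IsStart t)
    (hne : m.lab t' ≠ m.lab t) : m.common t' t ≤ m.reach t := by
  unfold reach
  rcases lt_trichotomy t' t with hlt | rfl | hlt
  · rw [if_neg (by omega)]
    have h1 := hv.common_le (t₁ := t') (t := t - 1) (t₃ := t) (by omega) (by omega) ht
    have h2 : t - 1 + 1 = t := by omega
    rw [weight, h2, if_neg (hs.resolve_left (by omega))]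
    rw [h2] at h1
    omega
  · exact absurd rfl hne
  · have hn : m.next t ≤ t' := next_le hlt (Or.inr hne)
    have hn' := lt_next (m := m) t
    rw [if_pos (show m.next t < m.n by omega)]
    have h1 := hv.common_le (t₁ := t) (t := m.next t - 1) (t₃ := t') (by omega) (by omega) ht'
    have h2 : m.next t - 1 + 1 = m.next t := by omega
    have h4 : m.weight (m.next t - 1) = m.common (m.next t - 1) (m.next t) := by
      rw [weight, h2, if_neg]
      rw [lab_eq_of_lt_next (N := t) (t := m.next t - 1) (by omega) (by omega)]
      exact (lab_next (N := t) (by omega)).symm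
    rw [h4, common, agree_comm]
    rw [h2] at h1
    exact h1.trans (Nat.le_add_left _ _)

omit hv in
theorem next_le_of_isStart {t t' : ℕ} (h : t < t') (ht' : m.IsStart t') :
    m.next t ≤ t' := by
  by_cases hl : m.lab t' = m.lab t
  · have h1 := ht'.resolve_left (by omega)
    by_contra hcon
    exact h1 ((lab_eq_of_lt_next (N := t) (by omega) (by omega)).trans hl.symm)
  · exact next_le h (Or.inr hl)

omit hv in
-- A boundary begins one block and ends one block, hence is counted at most twice. For the ends this
-- is the injectivity of `t ↦ next t - 1` on the beginnings of blocks.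
theorem sum_reach_le : ∑ t ∈ (Finset.range m.n).filter m.IsStart, m.reach t ≤
    2 * ∑ t ∈ Finset.range (m.n - 1), m.weight t := by
  unfold reach
  rw [Finset.sum_add_distrib, two_mul]
  refine Nat.add_le_add ?_ ?_
  · refine (Finset.sum_le_sum_of_subset (Finset.filter_subset _ _)).trans ?_
    rcases m.n with _ | n
    · simp
    · rw [Finset.sum_range_succ']
      simp
  · rw [← Finset.sum_filter]
    rw [← Finset.sum_image (f := m.weight) (g := fun t => m.next t - 1)]
    · refine Finset.sum_le_sum_of_subset fun x hx => ?_
      simp only [Finset.mem_image, Finset.mem_filter, Finset.mem_range] at hx ⊢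
      obtain ⟨t, ⟨_, ht⟩, rfl⟩ := hx
      have := lt_next (m := m) t
      omega
    · intro t ht t' ht' heq
      simp only [Finset.coe_filter, Finset.mem_filter, Finset.mem_range, Set.mem_ofPred_eq]
        at ht ht' heq
      have h1 := lt_next (m := m) t
      have h2 := lt_next (m := m) t'
      rcases lt_trichotomy t t' with h | h | h
      · have := next_le_of_isStart h ht'.1.2; omega
      · exact h
      · have := next_le_of_isStart h ht.1.2; omega

/-- A boundary with a nonempty common prefix pays by its weight. At any other one the first
character of the context increases, and this character never decreases in the sorted order, so its
current value pays for all of these. -/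
theorem card_boundaries_le {T : ℕ} (hT : T < m.n) :
    ((Finset.range T).filter fun t => m.lab t ≠ m.lab (t + 1)).card ≤
      ∑ t ∈ Finset.range T, m.weight t + m.X (m.pos T) 0 := by
  induction T with
  | zero => simp
  | succ T ih =>
    specialize ih (by omega)
    have hle : m.X (m.pos T) 0 ≤ m.X (m.pos (T + 1)) 0 := by
      rcases hv.mono T (T + 1) (Nat.lt_succ_self T) hT with ⟨i, h1, h2⟩ | ⟨h1, _⟩
      · rcases Nat.eq_zero_or_pos i with rfl | hi
        · exact h2.le
        · exact (h1 0 hi).le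
      · rw [h1]
    rw [Finset.range_add_one, Finset.filter_insert, Finset.sum_insert (by simp)]
    split_ifs with hl
    · rw [Finset.card_insert_of_notMem (by simp)]
      have hw : m.weight T = m.common T (T + 1) := if_neg hl
      by_cases h0 : m.X (m.pos T) 0 = m.X (m.pos (T + 1)) 0
      · have : 1 ≤ m.common T (T + 1) := le_agree (Nat.mul_pos (by omega) (by omega))
          fun t ht => by rw [Nat.lt_one_iff.1 ht]; exact h0
        omega
      · omega
    · omega

/-- The first characters are below `σ`; the unit that remains pays for the block at `0`. -/
theorem card_starts_le : ((Finset.range m.n).filter m.IsStart).card ≤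
    ∑ t ∈ Finset.range (m.n - 1), m.weight t + m.σ := by
  rcases Nat.eq_zero_or_pos m.n with h0 | h0
  · simp [h0]
  have h1 := hv.card_boundaries_le (T := m.n - 1) (by omega)
  have h2 := hv.X_lt _ (hv.pos_lt (t := m.n - 1) (by omega))
  have h3 : (Finset.range m.n).filter m.IsStart ⊆ insert 0 (((Finset.range (m.n - 1)).filter
      fun t => m.lab t ≠ m.lab (t + 1)).image (· + 1)) := by
    intro t ht
    simp only [Finset.mem_filter, Finset.mem_range, Finset.mem_insert, Finset.mem_image] at ht ⊢
    rcases Nat.eq_zero_or_pos t with h | h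
    · exact Or.inl h
    · refine Or.inr ⟨t - 1, ⟨by omega, ?_⟩, by omega⟩
      rw [show t - 1 + 1 = t by omega]
      exact ht.2.resolve_left (by omega)
  have h4 := (Finset.card_le_card h3).trans (Finset.card_insert_le _ _)
  have h5 := Finset.card_image_le (s := (Finset.range (m.n - 1)).filter
      fun t => m.lab t ≠ m.lab (t + 1)) (f := (· + 1))
  omega

end Valid

end Model

/-! ### Ranking an occurrence -/

/-- The binary search in the collection in register 23 for the context of the position in register
21 (of the collection in register 20), with the result in register 30. -/
def searchProg (k : ℕ) : Prog :=
  (30 ≔ .load (.arr k 6 (.reg 23)) ⨾ 31 ≔ .load (.arr k 6 (.reg 23 +ᵉ .lit 1))) ⨾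
  .loop (.reg 30 <ᵉ .reg 31)
    (32 ≔ (.reg 30 +ᵉ .reg 31) /ᵉ .lit 2 ⨾ cmpProg k ⨾
      .ite (.reg 43) (30 ≔ .reg 32 +ᵉ .lit 1) (31 ≔ .reg 32))

/-- The time for a binary search, if `G` bounds the common prefixes. -/
def Model.searchTime (m : Model) (G : ℕ) : ℕ :=
  Nat.clog 2 (m.n + 1) * ((G + 2) * m.stepTime + 30) + 40

/-- The threshold `q` stays between the bounds `lo` and `hi`, both included, so `hi - lo + 1`
candidates remain; hence the logarithm of `n + 1`. -/
theorem searchProg_spec {w M : ℕ} (hw : 0 < w) {m : Model} (hv : m.Valid) (hf : m.Fits w M)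
    {A : ℕ → ℕ} (hA : m.Sorts A) {s : State} (hs : Ready m A s) {y a b q G : ℕ}
    (hy : s.regs 21 = y) (ha : s.regs 23 = a) (hb : s.regs 20 = b) (hyn : y < m.n) (hab : a ≠ b)
    (hak : a < m.k) (hq1 : m.ns a ≤ q) (hq2 : q ≤ m.ns (a + 1))
    (hq : ∀ x, m.ns a ≤ x → x < m.ns (a + 1) → (m.Less x a y b ↔ x < q))
    (hG : ∀ x, m.ns a ≤ x → x < m.ns (a + 1) → agree (m.n * m.n) (m.X x) (m.X y) ≤ G) :
    Ex w M (searchProg m.k) s (m.searchTime G) fun s' => Same 30 s s' ∧ s'.regs 30 = q := by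
  obtain ⟨hf1, hf2, hf3, hf4, hf5⟩ := id hf
  have hR := hv.R_le_n
  have hk := hv.k_le_R
  have hns := hv.ns_le (j := a + 1) (by omega)
  refine Ex.seq_of (T₁ := 30) (T₂ := Nat.clog 2 (m.n + 1) * ((G + 2) * m.stepTime + 30) + 4)
    (Q₁ := fun s' => Same 30 s s' ∧ s'.regs 30 = m.ns a ∧ s'.regs 31 = m.ns (a + 1))
    ?_ ?_ (by simp only [Model.searchTime]; omega)
  · refine Ex.of_wp hw (by simp [Prog.time, Expr.cost]) ?_
    simp [hs.reg0, ha, hs.ns a hak.le, hs.ns (a + 1) hak]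
    exact ⟨by omega, by omega, ((Same.refl 30 s).set (by norm_num) _).set (by norm_num) _⟩
  rintro s₁ ⟨h1, h30, h31⟩
  refine (Ex.loop hw (α := ℕ × ℕ) (fun c s' => Same 30 s s' ∧ s'.regs 30 = c.1 ∧
      s'.regs 31 = c.2 ∧ m.ns a ≤ c.1 ∧ c.1 ≤ q ∧ q ≤ c.2 ∧ c.2 ≤ m.ns (a + 1))
    (fun c => Nat.clog 2 (c.2 - c.1 + 1) * ((G + 2) * m.stepTime + 30)) ?_
    (m.ns a, m.ns (a + 1)) s₁ ⟨h1, h30, h31, le_rfl, hq1, hq2, le_rfl⟩).mono ?_ fun _ => id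
  · rintro ⟨lo, hi⟩ s' ⟨h1, h2, h3, h4, h5, h6, h7⟩
    simp only at h2 h3 h4 h5 h6 h7
    have hs' := hs.same h1 (by norm_num)
    refine ⟨by simp, fun hc => ?_, fun hc => ?_⟩
    · simp [h2, h3] at hc
      refine ⟨(G + 2) * m.stepTime + 25, ?_⟩
      obtain ⟨mid, hmid⟩ : ∃ mid, (lo + hi) / 2 = mid := ⟨_, rfl⟩
      refine Ex.seq_of (T₁ := 6) (T₂ := (G + 2) * m.stepTime + 10)
        (Q₁ := fun s'' => s'' = s'.set 32 mid) ?_ ?_ (by omega)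
      · refine Ex.of_wp hw (by simp [Prog.time, Expr.cost]) ?_
        simp [h2, h3, hmid]; omega
      rintro _ rfl
      have k1 : Same 30 s (s'.set 32 mid) := h1.set (by norm_num) _
      have hmid1 : m.ns a ≤ mid := by omega
      have hmid2 : mid < m.ns (a + 1) := by omega
      have hT := Nat.mul_le_mul_right m.stepTime (Nat.add_le_add_right (hG mid hmid1 hmid2) 2)
      refine Ex.seq_of (T₂ := 10) (cmpProg_spec hw hv hf hA (hs.same k1 (by norm_num)) (x := mid)
        (by simp) (by simp [h1.regs, hy]) (by simp [h1.regs, ha]) (by simp [h1.regs, hb])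
        (by omega) hyn hab) ?_ (by omega)
      rintro s₂ ⟨l1, l2⟩
      have r30 := l1.regs 30 (by norm_num)
      have r31 := l1.regs 31 (by norm_num)
      have r32 := l1.regs 32 (by norm_num)
      simp [h2, h3] at r30 r31 r32
      have k2 := k1.trans l1 (by norm_num)
      rw [hq mid hmid1 hmid2] at l2
      have hcl := clog_half (d := hi - lo + 1) (by omega)
      generalize (G + 2) * m.stepTime = E at *
      refine Ex.of_wp hw (by simp [Prog.time, Expr.cost]) ?_
      simp [r30, r31, r32, -Prod.exists]
      refine ⟨fun h0 => ⟨by omega, (mid + 1, hi), ⟨k2.set (by norm_num) _, ?_⟩, ?_⟩,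
        fun h0 => ⟨(lo, mid), ⟨k2.set (by norm_num) _, ?_⟩, ?_⟩⟩
      · have := l2.1 h0
        dsimp only; omega
      · have : Nat.clog 2 (hi - (mid + 1) + 1) ≤ Nat.clog 2 ((hi - lo + 1 + 1) / 2) :=
          Nat.clog_mono_right 2 (by omega)
        have := Nat.mul_le_mul_right (E + 30) this
        rw [← hcl, Nat.add_mul]
        simp only [Expr.cost]; omega
      · have : ¬ mid < q := fun h => l2.2 h h0
        dsimp only; omega
      · have : Nat.clog 2 (mid - lo + 1) ≤ Nat.clog 2 ((hi - lo + 1 + 1) / 2) :=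
          Nat.clog_mono_right 2 (by omega)
        have := Nat.mul_le_mul_right (E + 30) this
        rw [← hcl, Nat.add_mul]
        simp only [Expr.cost]; omega
    · simp [h2, h3] at hc
      exact ⟨h1, by omega⟩
  · have : Nat.clog 2 (m.ns (a + 1) - m.ns a + 1) ≤ Nat.clog 2 (m.n + 1) :=
      Nat.clog_mono_right 2 (by omega)
    have := Nat.mul_le_mul_right ((G + 2) * m.stepTime + 30) this
    simp only [Expr.cost]; omega

/-- The rank in the merged order (register 22) of the current element of the collection in
register 20. -/
def rankProg (k : ℕ) : Prog :=
  21 ≔ .load (.arr (2 * k + 1) 6 (.reg 20)) ⨾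
  .ite (.reg 21 =ᵉ .load (.arr k 6 (.reg 20 +ᵉ .lit 1))) (22 ≔ .reg 1)
    ((22 ≔ .reg 21 -ᵉ .load (.arr k 6 (.reg 20)) ⨾ 23 ≔ .lit 0) ⨾
      .loop (.reg 23 <ᵉ .lit k)
        (.ite (.reg 23 =ᵉ .reg 20) .skip
            (searchProg k ⨾ 22 ≔ .reg 22 +ᵉ .reg 30 -ᵉ .load (.arr k 6 (.reg 23))) ⨾
          23 ≔ .reg 23 +ᵉ .lit 1))

/-- The time for a rank computation, if `G` bounds the common prefixes. -/
def Model.rankTime (m : Model) (G : ℕ) : ℕ := m.k * (m.searchTime G + 50) + 100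

/-- The own collection contributes its offset `pos t - ns (lab t)`, and each other one the threshold
of `less_iff` minus its first position; the sum is `t` by `sum_before`. All comparisons are bounded
by `reach t` because a block begins at `t`. -/
theorem rankProg_spec {w M : ℕ} (hw : 0 < w) {m : Model} (hv : m.Valid) (hf : m.Fits w M)
    {A : ℕ → ℕ} (hA : m.Sorts A) {s : State} (hs : Ready m A s) {t : ℕ} (ht : t < m.n)
    (hst : m.IsStart t) (h20 : s.regs 20 = m.lab t)
    (hP : s.mem (2 * m.k + 1 + 6 * m.R + m.lab t) = m.pos t) :
    Ex w M (rankProg m.k) s (m.rankTime (m.reach t)) fun s' => Same 20 s s' ∧ s'.regs 22 = t := by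
  obtain ⟨hf1, hf2, hf3, hf4, hf5⟩ := id hf
  have hR := hv.R_le_n
  have hk := hv.k_le_R
  have hlab := hv.lab_lt t ht
  have hpos := hv.pos_lt ht
  have hpos' := hv.pos_lt_ns ht
  set G := m.reach t
  refine Ex.seq_of (T₁ := 10) (T₂ := m.k * (m.searchTime G + 50) + 90)
    (Q₁ := fun s' => s' = s.set 21 (m.pos t)) ?_ ?_ (by simp only [Model.rankTime]; omega)
  · refine Ex.of_wp hw (by simp [Prog.time, Expr.cost]) ?_
    simp [hs.reg0, h20, hP]; omega
  rintro _ rfl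
  have hs0 : Same 20 s (s.set 21 (m.pos t)) := (Same.refl 20 s).set (by norm_num) _
  refine (Ex.ite hw (T := m.k * (m.searchTime G + 50) + 70) ?_ ?_ ?_).mono
    (by simp only [Expr.cost, Expr.arr_cost]; omega) fun _ => id
  · simp [hs.reg0, h20]; omega
  · intro h
    simp [hs.reg0, h20, hs.ns (m.lab t + 1) (by omega)] at h
    omega
  intro _
  refine Ex.seq_of (T₁ := 14) (T₂ := m.k * (m.searchTime G + 50) + 4)
    (Q₁ := fun s' => Same 20 s s' ∧ s'.regs 20 = m.lab t ∧ s'.regs 21 = m.pos t ∧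
      s'.regs 22 = m.before (m.lab t) t ∧ s'.regs 23 = 0) ?_ ?_ (by omega)
  · refine Ex.of_wp hw (by simp [Prog.time, Expr.cost]) ?_
    simp [hs.reg0, h20, hs.ns (m.lab t) (by omega)]
    exact ⟨by omega, (hs0.set (by norm_num) _).set (by norm_num) _, by simp [Model.pos]⟩
  rintro s₁ ⟨h1, k20, k21, k22, k23⟩
  refine (Ex.for_loop hw (fun a s' => Same 20 s s' ∧ s'.regs 20 = m.lab t ∧
    s'.regs 21 = m.pos t ∧ s'.regs 23 = a ∧ s'.regs 22 = m.before (m.lab t) t +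
      ∑ c ∈ Finset.range a, if c = m.lab t then 0 else m.before c t)
    m.k (m.searchTime G + 46) ?_ ?_ 0 s₁ (Nat.zero_le _) ⟨h1, k20, k21, k23, by simp [k22]⟩).mono
    (by simp only [Expr.cost]; rw [Nat.sub_zero]) ?_
  · rintro a s' ⟨h1, l20, l21, l23, l22⟩ ha
    simp [l23]; omega
  · rintro a s' ⟨h1, l20, l21, l23, l22⟩ ha
    have hs' := hs.same h1 (by norm_num)
    refine Ex.seq_of (T₁ := m.searchTime G + 34) (T₂ := 4) (Q₁ := fun s'' => Same 20 s s'' ∧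
      s''.regs 20 = m.lab t ∧ s''.regs 21 = m.pos t ∧ s''.regs 23 = a ∧
      s''.regs 22 = m.before (m.lab t) t +
        ∑ c ∈ Finset.range (a + 1), if c = m.lab t then 0 else m.before c t) ?_ ?_ (by omega)
    · refine (Ex.ite hw (T := m.searchTime G + 30) (by simp) (fun hc => ?_) fun hc => ?_).mono
        (by simp only [Expr.cost]; omega) fun _ => id
      · simp [l23, l20] at hc
        refine Ex.of_wp hw (by simp [Prog.time]) ?_
        simp only [Prog.wp]
        refine ⟨h1, l20, l21, l23, ?_⟩
        rw [l22, Finset.sum_range_succ, if_pos hc, add_zero]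
      · simp [l23, l20] at hc
        have hle := hv.ns_add_before_le ha ht.le
        refine Ex.seq_of (T₂ := 14) (searchProg_spec hw hv hf hA hs' (q := m.ns a + m.before a t)
          (G := G) l21 l23 l20 hpos hc ha (Nat.le_add_right _ _) hle
          (fun x hx1 hx2 => hv.less_iff ht ha hc hx1 hx2) ?_) ?_ (by omega)
        · intro x hx1 hx2
          obtain ⟨t', ht', hl, rfl⟩ := hv.exists_pos ha hx1 hx2
          exact hv.common_le_reach ht ht' hst (by rwa [hl])
        rintro s₂ ⟨g1, g2⟩
        have r20 := g1.regs 20 (by norm_num)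
        have r21 := g1.regs 21 (by norm_num)
        have r22 := g1.regs 22 (by norm_num)
        have r23 := g1.regs 23 (by norm_num)
        rw [l20] at r20
        rw [l21] at r21
        rw [l23] at r23
        have hs2 := hs'.same g1 (by norm_num)
        have hsum : s₂.regs 22 + m.before a t = m.before (m.lab t) t +
            ∑ c ∈ Finset.range (a + 1), if c = m.lab t then 0 else m.before c t := by
          rw [r22, l22, Finset.sum_range_succ, if_neg hc, add_assoc]
        -- Needed only against overflow: with a search result of at most `n`, the intermediate sum
        -- is below `4 * n`.
        have hbound : m.before (m.lab t) t +
            ∑ c ∈ Finset.range (a + 1), (if c = m.lab t then 0 else m.before c t) ≤ 2 * m.n := by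
          have h2 : ∑ c ∈ Finset.range (a + 1), (if c = m.lab t then 0 else m.before c t) ≤
              ∑ c ∈ Finset.range m.k, m.before c t :=
            (Finset.sum_le_sum fun c _ => by split_ifs <;> omega).trans
              (Finset.sum_range_le_of_le ha)
          rw [hv.sum_before ht.le] at h2
          unfold Model.pos at hpos; omega
        have hns := hv.ns_le (j := a) ha.le
        refine Ex.of_wp hw (by simp [Prog.time, Expr.cost]) ?_
        simp [hs2.reg0, r23, g2, hs2.ns a ha.le, r20, r21]
        exact ⟨by omega, (h1.trans g1 (by norm_num)).set (by norm_num) _, by omega⟩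
    rintro s₂ ⟨g1, g2, g3, g4, g5⟩
    refine Ex.of_wp hw (by simp [Prog.time, Expr.cost]) ?_
    simp [g2, g3, g4, g5]
    exact ⟨by omega, g1.set (by norm_num) _⟩
  · rintro s' ⟨h1, _, _, _, h2⟩
    refine ⟨h1, ?_⟩
    rw [h2]
    have h3 := hv.sum_before ht.le
    have h4 : ∀ c ∈ Finset.range m.k, m.before c t =
        (if c = m.lab t then m.before (m.lab t) t else 0) +
          if c = m.lab t then 0 else m.before c t := by
      intro c _
      split_ifs with h
      · rw [h, add_zero]
      · rw [zero_add]
    rw [Finset.sum_congr rfl h4, Finset.sum_add_distrib, Finset.sum_ite_eq',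
      if_pos (Finset.mem_range.2 hlab)] at h3
    exact h3

/-- An exhausted collection receives the rank `n`, the default value of `Model.head`, and so is
never selected while `N < n`. -/
theorem rankProg_spec_end {w M : ℕ} (hw : 0 < w) {m : Model} (hv : m.Valid) (hf : m.Fits w M)
    {A : ℕ → ℕ} {s : State} (hs : Ready m A s) {i : ℕ} (hi : i < m.k) (h20 : s.regs 20 = i)
    (hP : s.mem (2 * m.k + 1 + 6 * m.R + i) = m.ns (i + 1)) :
    Ex w M (rankProg m.k) s 100 fun s' => Same 20 s s' ∧ s'.regs 22 = m.n := by
  obtain ⟨hf1, hf2, hf3, hf4, hf5⟩ := id hf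
  have hR := hv.R_le_n
  have hk := hv.k_le_R
  refine Ex.seq_of (T₁ := 10) (T₂ := 80)
    (Q₁ := fun s' => s' = s.set 21 (m.ns (i + 1))) ?_ ?_ (by omega)
  · refine Ex.of_wp hw (by simp [Prog.time, Expr.cost]) ?_
    simp [hs.reg0, h20, hP]; omega
  rintro _ rfl
  refine (Ex.ite hw (T := 50) ?_ ?_ ?_).mono
    (by simp only [Expr.cost, Expr.arr_cost]; omega) fun _ => id
  · simp [hs.reg0, h20]; omega
  · intro _
    refine Ex.of_wp hw (by simp [Prog.time, Expr.cost]) ?_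
    simp [hs.reg1]
    exact ((Same.refl 20 s).set (by norm_num) _).set (by norm_num) _
  · intro h
    simp [hs.reg0, h20, hs.ns (i + 1) (by omega)] at h

/-! ### Run-length encoding from left to right -/

/-- The effect of appending a character on a run-length encoding. -/
def pushRun : List (ℕ × ℕ) → ℕ → List (ℕ × ℕ)
  | [], c => [(c, 1)]
  | [(b, l)], c => if b = c then [(b, l + 1)] else [(b, l), (c, 1)]
  | x :: y :: r, c => x :: pushRun (y :: r) c

theorem sum_rle (l : List ℕ) : ((rle l).map Prod.snd).sum = l.length := by
  induction l with
  | nil => rfl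
  | cons a l ih =>
    rw [List.length_cons, ← ih, rle]
    rcases rle l with _ | ⟨⟨b, p⟩, r⟩
    · rfl
    · dsimp only
      split_ifs
      · simp; omega
      · simp; omega

/-- `rle` recurses on the head of the list, but the program extends the output at its end, where
only the last run can change. -/
theorem rle_concat (l : List ℕ) (c : ℕ) : rle (l ++ [c]) = pushRun (rle l) c := by
  induction l with
  | nil => rfl
  | cons a l ih =>
    rw [List.cons_append, rle, ih]
    conv_rhs => rw [rle]
    rcases rle l with _ | ⟨⟨b, p⟩, _ | ⟨y, r⟩⟩
    · simp only [pushRun]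
    · simp only [pushRun]
      split_ifs <;> simp_all [pushRun]
    · simp only [pushRun]
      split_ifs <;> simp_all [pushRun]

theorem pushRun_append (d : List (ℕ × ℕ)) (b p c : ℕ) :
    pushRun (d ++ [(b, p)]) c = d ++ if b = c then [(b, p + 1)] else [(b, p), (c, 1)] := by
  induction d with
  | nil => rfl
  | cons x d ih =>
    rcases d with _ | ⟨y, d⟩
    · rfl
    · simp only [List.cons_append, pushRun] at ih ⊢
      rw [ih]

theorem rle_append_replicate_same {l : List ℕ} {d : List (ℕ × ℕ)} {c p : ℕ}
    (h : rle l = d ++ [(c, p)]) (e : ℕ) : rle (l ++ List.replicate e c) = d ++ [(c, p + e)] := by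
  induction e with
  | zero => simpa using h
  | succ e ih =>
    rw [List.replicate_succ', ← List.append_assoc, rle_concat, ih, pushRun_append, if_pos rfl]
    rfl

theorem rle_replicate {c e : ℕ} (he : 0 < e) : rle (List.replicate e c) = [(c, e)] := by
  obtain ⟨e, rfl⟩ := Nat.exists_eq_succ_of_ne_zero he.ne'
  have := rle_append_replicate_same (l := [c]) (d := []) (c := c) (p := 1) rfl e
  rw [List.replicate_succ, ← List.singleton_append, this, Nat.add_comm]
  rfl

theorem rle_append_replicate_of_ne {l : List ℕ} {d : List (ℕ × ℕ)} {b p c e : ℕ}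
    (h : rle l = d ++ [(b, p)]) (hbc : b ≠ c) (he : 0 < e) :
    rle (l ++ List.replicate e c) = (d ++ [(b, p)]) ++ [(c, e)] := by
  obtain ⟨e, rfl⟩ := Nat.exists_eq_succ_of_ne_zero he.ne'
  have h1 : rle (l ++ [c]) = (d ++ [(b, p)]) ++ [(c, 1)] := by
    rw [rle_concat, h, pushRun_append, if_neg hbc]; simp
  have := rle_append_replicate_same h1 e
  rw [List.replicate_succ, ← List.singleton_append, ← List.append_assoc, this, Nat.add_comm]

theorem encodeRuns_append (B B' : List (ℕ × ℕ)) :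
    encodeRuns (B ++ B') = encodeRuns B ++ encodeRuns B' := List.flatMap_append

/-! ### The merging phase -/

/-- The cells from `2 * k + 1 + 6 * R` on are the mutable part of the merging phase (positions,
ranks, current runs); all fixed tables lie below. -/
theorem Ready.congr {m : Model} {A : ℕ → ℕ} {s s' : State} (h : Ready m A s)
    (h0 : s'.regs 0 = s.regs 0) (h1 : s'.regs 1 = s.regs 1)
    (hm : ∀ a < 2 * m.k + 1 + 6 * m.R, s'.mem a = s.mem a) : Ready m A s' := by
  obtain ⟨g1, g2, g3, g4, g5, g6, g7, g8⟩ := h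
  refine ⟨h0.trans g1, h1.trans g2, ?_, ?_, ?_, ?_, ?_, ?_⟩ <;>
    intro r hr <;> rw [hm _ (by omega)] <;> solve_by_elim

/-- The state of the merging phase after `N` occurrences, except for the ranks of the heads. -/
structure Merging (m : Model) (A : ℕ → ℕ) (N : ℕ) (s : State) : Prop where
  ready : Ready m A s
  reg10 : s.regs 10 = N
  pos : ∀ j < m.k, s.mem (2 * m.k + 1 + 6 * m.R + j) = m.ns j + m.before j N
  -- The current run of an exhausted collection is left unspecified.
  run : ∀ j < m.k, m.ns j + m.before j N < m.ns (j + 1) →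
    ∃ r, s.mem (4 * m.k + 1 + 6 * m.R + j) = r ∧ r < m.R ∧ m.start r ≤ m.ns j + m.before j N ∧
      m.ns j + m.before j N < m.start (r + 1)
  -- The last run is withheld in registers 15 and 16, since it may still grow; the length `0` marks
  -- that there is none yet.
  out : N = 0 ∧ s.regs 16 = 0 ∧ s.out = [] ∨ 0 < N ∧ ∃ d, s.out = encodeRuns d ∧
    rle ((List.range N).map m.out) = d ++ [(s.regs 15, s.regs 16)] ∧ 0 < s.regs 16

/-- The ranks of the heads of the collections after `N` occurrences are in the memory. -/
def Ranked (m : Model) (N : ℕ) (s : State) : Prop :=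
  ∀ j < m.k, s.mem (3 * m.k + 1 + 6 * m.R + j) = m.head j N

/-- The selection of the collection of the next block (register 11) and of the end of the block
(register 12). -/
def selectProg (k : ℕ) : Prog :=
  (12 ≔ .reg 1 ⨾ 17 ≔ .lit 0) ⨾
  .loop (.reg 17 <ᵉ .lit k)
    (18 ≔ .load (.arr (3 * k + 1) 6 (.reg 17)) ⨾
      .ite (.reg 18 =ᵉ .reg 10) (11 ≔ .reg 17)
        (.ite (.reg 18 <ᵉ .reg 12) (12 ≔ .reg 18) .skip) ⨾
      17 ≔ .reg 17 +ᵉ .lit 1)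

/-- The owner of the block is the only collection whose head is `N`, and `exists_head_eq_next`
identifies the minimum of the other heads (or `n`) as the end of the block. -/
theorem selectProg_spec {w M : ℕ} (hw : 0 < w) {m : Model} (hv : m.Valid) (hf : m.Fits w M)
    {s : State} {N : ℕ} (hN : N < m.n) (h0 : s.regs 0 = m.R) (h1 : s.regs 1 = m.n)
    (h10 : s.regs 10 = N) (hr : Ranked m N s) :
    Ex w M (selectProg m.k) s (m.k * 50 + 10) fun s' => s'.mem = s.mem ∧ s'.out = s.out ∧
      (∀ x, x ≠ 11 → x ≠ 12 → x ≠ 17 → x ≠ 18 → s'.regs x = s.regs x) ∧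
      s'.regs 11 = m.lab N ∧ s'.regs 12 = m.next N := by
  obtain ⟨hf1, hf2, hf3, hf4, hf5⟩ := id hf
  have hR := hv.R_le_n
  have hk := hv.k_le_R
  have hlab := hv.lab_lt N hN
  refine Ex.seq_of (T₁ := 4) (T₂ := m.k * 50 + 4) (Q₁ := fun s' =>
    s' = (s.set 12 m.n).set 17 0) ?_ ?_ (by omega)
  · exact Ex.of_wp hw (by simp [Prog.time, Expr.cost]) (by simp [h1])
  rintro _ rfl
  refine (Ex.for_loop hw (fun j s' => s'.mem = s.mem ∧ s'.out = s.out ∧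
      (∀ x, x ≠ 11 → x ≠ 12 → x ≠ 17 → x ≠ 18 → s'.regs x = s.regs x) ∧ s'.regs 17 = j ∧
      (m.lab N < j → s'.regs 11 = m.lab N) ∧ m.next N ≤ s'.regs 12 ∧ s'.regs 12 ≤ m.n ∧
      ∀ i < j, i ≠ m.lab N → s'.regs 12 ≤ m.head i N) m.k 46 ?_ ?_ 0 ((s.set 12 m.n).set 17 0)
      (Nat.zero_le _) ⟨rfl, rfl, fun x _ hx hx' _ => by simp [hx, hx'], by simp, by simp, by simpa using Model.next_le_n hN, by simp,
        by simp⟩).mono (by simp only [Expr.cost]; omega) ?_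
  · rintro j s' ⟨g1, g2, g3, g4, g5, g6⟩ hj
    simp [g4]; omega
  · rintro j s' ⟨g1, g2, g3, g4, g5, g6, g7, g8⟩ hj
    refine Ex.of_wp hw (by simp [Prog.time, Expr.cost]) ?_
    have r0 := g3 0 (by omega) (by omega) (by omega) (by omega)
    have r10 := g3 10 (by omega) (by omega) (by omega) (by omega)
    simp only [Prog.wp, Expr.ok, Expr.val, Op.ok, Op.apply, Expr.arr_ok, Expr.arr_val,
      State.set_regs, State.set_mem, State.set_out, reduceIte, Nat.reduceEqDiff, g1, g2, g4, r0, h0,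
      hr j hj, r10, h10, true_and]
    refine ⟨by omega, fun heq => ⟨by omega, ?_⟩, fun hne => ⟨fun hlt => ⟨by omega, ?_⟩,
      fun hge => ⟨by omega, ?_⟩⟩⟩
    · have heq : m.head j N = N := by by_contra h; simp [h] at heq
      have hl : m.lab N = j := by
        have := Model.lab_head (m := m) (a := j) (N := N) (by omega)
        rwa [heq] at this
      refine ⟨fun x x1 x2 x3 x4 => ?_, fun _ => hl.symm, g6, g7, fun i hi hine => ?_⟩
      · rw [if_neg x3, if_neg x1, if_neg x4, g3 x x1 x2 x3 x4]
      · exact g8 i (by omega) hine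
    · have hne : m.head j N ≠ N := by intro h; simp [h] at hne
      have hlt : m.head j N < s'.regs 12 := by by_contra h; simp [h] at hlt
      have hl : j ≠ m.lab N := fun h => hne (by rw [h, Model.head_self])
      refine ⟨fun x x1 x2 x3 x4 => ?_, fun hh => g5 (by omega), Model.next_le_head hN hl, by omega,
        fun i hi hine => ?_⟩
      · rw [if_neg x3, if_neg x2, if_neg x4, g3 x x1 x2 x3 x4]
      · rcases Nat.lt_succ_iff_lt_or_eq.1 hi with h | rfl
        · exact hlt.le.trans (g8 i h hine)
        · exact le_rfl
    · have hne : m.head j N ≠ N := by intro h; simp [h] at hne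
      have hge : s'.regs 12 ≤ m.head j N := by by_contra h; simp [not_le.1 h] at hge
      have hl : j ≠ m.lab N := fun h => hne (by rw [h, Model.head_self])
      refine ⟨fun x x1 x2 x3 x4 => ?_, fun hh => g5 (by omega), g6, g7, fun i hi hine => ?_⟩
      · rw [if_neg x3, if_neg x4, g3 x x1 x2 x3 x4]
      · rcases Nat.lt_succ_iff_lt_or_eq.1 hi with h | rfl
        · exact g8 i h hine
        · exact hge
  · rintro s' ⟨g1, g2, g3, g4, g5, g6, g7, g8⟩
    refine ⟨g1, g2, g3, g5 hlab, le_antisymm ?_ g6⟩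
    rcases (Model.next_le_n hN).lt_or_eq with h | h
    · obtain ⟨h2, h3⟩ := Model.exists_head_eq_next h
      have := g8 _ (hv.lab_lt _ h) h2
      omega
    · omega

/-- The output of the next piece of a run. -/
def pieceProg (k : ℕ) : Prog :=
  19 ≔ .load (.arr (4 * k + 1) 6 (.reg 11)) ⨾
  14 ≔ .load (.lit k +ᵉ .lit 2 *ᵉ .reg 19) ⨾
  13 ≔ .load (.arr k 4 (.reg 19)) +ᵉ .load (.lit (k + 1) +ᵉ .lit 2 *ᵉ .reg 19) -ᵉ
    .load (.arr (2 * k + 1) 6 (.reg 11)) ⨾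
  18 ≔ .reg 12 -ᵉ .reg 10 ⨾
  .ite (.reg 18 <ᵉ .reg 13) (13 ≔ .reg 18)
    (.put (.arr (4 * k + 1) 6 (.reg 11)) (.reg 19 +ᵉ .lit 1)) ⨾
  .put (.arr (2 * k + 1) 6 (.reg 11)) (.load (.arr (2 * k + 1) 6 (.reg 11)) +ᵉ .reg 13) ⨾
  10 ≔ .reg 10 +ᵉ .reg 13

/-- The addition of a piece of a run to the pending run of the output. -/
def pendProg : Prog :=
  .ite (.reg 14 =ᵉ .reg 15) (16 ≔ .reg 16 +ᵉ .reg 13)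
    (.ite (.reg 16) (.emit (.reg 15) ⨾ .emit (.reg 16)) .skip ⨾ 15 ≔ .reg 14 ⨾ 16 ≔ .reg 13)

namespace Model

variable {m : Model}

theorem before_add_of_le_next {N e : ℕ} (he : N + e ≤ m.next N) (j : ℕ) :
    m.before j (N + e) = m.before j N + if j = m.lab N then e else 0 := by
  split_ifs with h
  · subst h
    exact m.before_eq_add fun i h1 h2 => lab_eq_of_lt_next h1 (by omega)
  · exact m.before_eq_of_forall (by omega) fun i h1 h2 => by
      rw [lab_eq_of_lt_next h1 (by omega)]; exact fun hh => h hh.symm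

theorem pos_add_of_lt_next {N e : ℕ} (he : N + e < m.next N) : m.pos (N + e) = m.pos N + e := by
  rw [pos, lab_eq_of_lt_next (N := N) (by omega) he, before_add_of_le_next he.le, if_pos rfl, pos,
    add_assoc]

/-- Inside a block the merged occurrences have consecutive positions in one collection, so a stretch
that stays within one run is constant. -/
theorem Valid.map_out (hv : m.Valid) {N e r : ℕ} (hN : N < m.n) (he : N + e ≤ m.next N)
    (hr : r < m.R) (h1 : m.start r ≤ m.pos N) (h2 : m.pos N + e ≤ m.start (r + 1)) :
    (List.range (N + e)).map m.out = (List.range N).map m.out ++ List.replicate e (m.ch r) := by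
  rw [List.range_add, List.map_append, List.map_map]
  congr 1
  rw [List.eq_replicate_iff]
  refine ⟨by simp, fun b hb => ?_⟩
  simp only [List.mem_map, List.mem_range, Function.comp_apply] at hb
  obtain ⟨a, ha, rfl⟩ := hb
  have h3 := pos_add_of_lt_next (m := m) (N := N) (e := a) (by omega)
  have h4 := next_le_n hN
  exact hv.out_eq _ (by omega) r hr (by omega) (by omega)

end Model

/-- A piece of length `e` of the run `r` follows the first `N` occurrences. -/
structure Model.Piece (m : Model) (N e r : ℕ) : Prop where
  pos : 0 < e
  le : N + e ≤ m.next N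
  map_out : (List.range (N + e)).map m.out = (List.range N).map m.out ++ List.replicate e (m.ch r)
  -- Pieces end only at beginnings of blocks or of runs, which bounds their number.
  cut : N + e < m.n → m.IsStart (N + e) ∨ ∃ r < m.R, m.start r = m.pos (N + e)

theorem pieceProg_spec {w M : ℕ} (hw : 0 < w) {m : Model} (hv : m.Valid) (hf : m.Fits w M)
    {A : ℕ → ℕ} {s : State} {N : ℕ} (hN : N < m.n) (hs : Merging m A N s)
    (h11 : s.regs 11 = m.lab N) (h12 : s.regs 12 = m.next N) :
    ∃ e r, m.Piece N e r ∧ Ex w M (pieceProg m.k) s 130 fun s' => Ready m A s' ∧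
      s'.regs 10 = N + e ∧ s'.regs 11 = m.lab N ∧ s'.regs 12 = m.next N ∧ s'.regs 13 = e ∧
      s'.regs 14 = m.ch r ∧ s'.regs 15 = s.regs 15 ∧ s'.regs 16 = s.regs 16 ∧ s'.out = s.out ∧
      (∀ j < m.k, s'.mem (3 * m.k + 1 + 6 * m.R + j) = s.mem (3 * m.k + 1 + 6 * m.R + j)) ∧
      (∀ j < m.k, s'.mem (2 * m.k + 1 + 6 * m.R + j) = m.ns j + m.before j (N + e)) ∧
      (∀ j < m.k, m.ns j + m.before j (N + e) < m.ns (j + 1) →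
        ∃ r, s'.mem (4 * m.k + 1 + 6 * m.R + j) = r ∧ r < m.R ∧
          m.start r ≤ m.ns j + m.before j (N + e) ∧
          m.ns j + m.before j (N + e) < m.start (r + 1)) := by
  obtain ⟨hf1, hf2, hf3, hf4, hf5⟩ := id hf
  have hR := hv.R_le_n
  have hk := hv.k_le_R
  have hlab := hv.lab_lt N hN
  obtain ⟨i, hi⟩ : ∃ i, m.lab N = i := ⟨_, rfl⟩
  rw [hi] at h11 hlab
  obtain ⟨hready, h10, hpos, hrun, -⟩ := hs
  have hposN : m.ns i + m.before i N = m.pos N := by rw [Model.pos, hi]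
  have hlt := hv.pos_lt_ns hN
  rw [hi] at hlt
  obtain ⟨r, hr1, hr2, hr3, hr4⟩ := hrun i hlab (by rw [hposN]; exact hlt)
  rw [hposN] at hr3 hr4
  have hPi := hpos i hlab
  rw [hposN] at hPi
  have hrs : m.start (r + 1) = m.start r + m.ln r := Finset.sum_range_succ _ _
  have hst := hv.start_le (r := r + 1) hr2
  have hn1 := Model.lt_next (m := m) N
  have hn2 := Model.next_le_n hN
  have hpn := hv.pos_lt hN
  have hnsn := hv.ns_le (j := i + 1) hlab
  have hlast : m.start (r + 1) < m.n → r + 1 < m.R := by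
    intro h
    by_contra hcon
    have := Finset.sum_range_le_of_le (f := m.ln) (not_lt.1 hcon)
    have h2 := hv.start_R
    unfold Model.start at *
    omega
  obtain ⟨e, he⟩ : ∃ e, min (m.next N - N) (m.start r + m.ln r - m.pos N) = e := ⟨_, rfl⟩
  have hb := Model.before_add_of_le_next (m := m) (N := N) (e := e) (by omega)
  have hbi := hb i
  rw [if_pos hi.symm] at hbi
  have hpiece : m.Piece N e r := by
    refine ⟨by omega, by omega, hv.map_out hN (by omega) hr2 hr3 (by omega), fun hlt => ?_⟩
    by_cases hen : N + e = m.next N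
    · left; right
      rw [hen, Model.lab_eq_of_lt_next (N := N) (t := m.next N - 1) (by omega) (by omega)]
      exact (Model.lab_next (by omega)).symm
    · right
      have h1 := Model.pos_add_of_lt_next (m := m) (N := N) (e := e) (by omega)
      have h2 := hv.pos_lt hlt
      exact ⟨r + 1, hlast (by omega), by omega⟩
  refine ⟨e, r, hpiece, ?_⟩
  unfold pieceProg
  refine Ex.of_wp hw (by simp [Prog.time, Expr.cost]) ?_
  simp only [Prog.wp, Expr.ok, Expr.val, Op.ok, Op.apply, Expr.arr_ok, Expr.arr_val,
      State.set_regs, State.set_mem, State.set_out, State.store_regs, State.store_mem,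
      State.store_out, reduceIte, Nat.reduceEqDiff, hready.reg0, h11, hr1, hready.ch r hr2,
      hready.start r hr2, hready.ln r hr2, hPi, h12, h10, true_and, and_true, hi]
  refine ⟨by omega, by omega, by omega, by omega, fun hlt => ?_, fun hge => ?_⟩
  · have hlt : m.next N - N < m.start r + m.ln r - m.pos N := by
      by_contra h; simp [h] at hlt
    rw [show m.next N - N = e by omega]
    refine ⟨by omega, by omega, by omega, by omega, ?_, rfl, rfl, fun j hj => if_neg (by omega),
      fun j hj => ?_, fun j hj hj' => ?_⟩
    · refine hready.congr (by simp) (by simp) fun a ha => ?_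
      simp only [State.set_mem, State.store_mem]
      rw [if_neg (by omega)]
    · split_ifs with h
      · obtain rfl : j = i := by omega
        omega
      · rw [hpos j hj, hb, if_neg (by omega), add_zero]
    · rw [if_neg (by omega)]
      by_cases h : j = i
      · subst h
        exact ⟨r, hr1, hr2, by omega, by omega⟩
      · have hbj := hb j
        rw [if_neg (by omega), add_zero] at hbj
        rw [hbj] at hj' ⊢
        exact hrun j hj hj'
  · have hge : m.start r + m.ln r - m.pos N ≤ m.next N - N := by
      by_contra h; simp [not_le.1 h] at hge
    have e1 : 2 * m.k + 1 + 6 * m.R + i ≠ 4 * m.k + 1 + 6 * m.R + i := by omega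
    simp only [if_neg e1]
    rw [show m.start r + m.ln r - m.pos N = e by omega]
    refine ⟨by omega, by omega, by omega, by omega, by omega, by omega, by omega, ?_,
      rfl, rfl, fun j hj => ?_, fun j hj => ?_, fun j hj hj' => ?_⟩
    · refine hready.congr (by simp) (by simp) fun a ha => ?_
      simp only [State.set_mem, State.store_mem]
      rw [if_neg (by omega), if_neg (by omega)]
    · rw [if_neg (by omega), if_neg (by omega)]
    · split_ifs with h h'
      · obtain rfl : j = i := by omega
        omega
      · omega
      · rw [hpos j hj, hb, if_neg (by omega), add_zero]
    · rw [if_neg (by omega)]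
      by_cases h : j = i
      · subst h
        rw [if_pos rfl]
        have h1 := hlast (by omega)
        have h2 : m.start (r + 1 + 1) = m.start (r + 1) + m.ln (r + 1) := Finset.sum_range_succ _ _
        have h3 := hv.ln_pos _ h1
        exact ⟨r + 1, rfl, h1, by omega, by omega⟩
      · rw [if_neg (by omega)]
        have hbj := hb j
        rw [if_neg (by omega), add_zero] at hbj
        rw [hbj] at hj' ⊢
        exact hrun j hj hj'

theorem pendProg_spec {w M : ℕ} (hw : 0 < w) {m : Model} (hf : m.Fits w M)
    {A : ℕ → ℕ} {s d : State} {N e r : ℕ} (hs : Merging m A N d) (hp : m.Piece N e r)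
    (hN : N + e ≤ m.n) (h13 : s.regs 13 = e) (h14 : s.regs 14 = m.ch r)
    (h15 : s.regs 15 = d.regs 15) (h16 : s.regs 16 = d.regs 16) (ho : s.out = d.out) :
    Ex w M pendProg s 30 fun s' => s'.mem = s.mem ∧
      (∀ x, x ≠ 15 → x ≠ 16 → s'.regs x = s.regs x) ∧
      ∃ d, s'.out = encodeRuns d ∧
        rle ((List.range (N + e)).map m.out) = d ++ [(s'.regs 15, s'.regs 16)] ∧
        0 < s'.regs 16 := by
  obtain ⟨hf1, hf2, hf3, hf4, hf5⟩ := id hf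
  have he := hp.pos
  -- The pending run is part of the output so far, so its length cannot overflow when a piece is
  -- added.
  have hlen : d.regs 16 ≤ N := by
    rcases hs.out with ⟨_, h, _⟩ | ⟨_, l, _, h, _⟩
    · omega
    · have := sum_rle ((List.range N).map m.out)
      rw [h] at this
      simp at this
      omega
  unfold pendProg
  refine Ex.of_wp hw (by simp [Prog.time, Expr.cost]) ?_
  rw [hp.map_out]
  simp only [Prog.wp, Expr.ok, Expr.val, Op.ok, Op.apply, State.set_regs, State.set_mem,
    State.set_out, State.write_regs, State.write_mem, State.write_out, reduceIte,
    Nat.reduceEqDiff, h13, h14, h15, h16, ho, true_and, and_true]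
  rcases hs.out with ⟨rfl, h2, h3⟩ | ⟨h1, l, h2, h3, h4⟩
  · rw [h2, h3]
    have hr := rle_replicate (c := m.ch r) he
    refine ⟨fun h => ⟨by omega, fun x _ hx => by rw [if_neg hx], [], rfl, ?_, by omega⟩,
      fun h => ⟨fun h => absurd rfl h, fun _ => ⟨fun x hx hx' => by rw [if_neg hx', if_neg hx], [],
        rfl, ?_, by omega⟩⟩⟩
    · have h : m.ch r = d.regs 15 := by by_contra hc; simp [hc] at h
      simp [← h, hr]
    · simp [hr]
  · refine ⟨fun h => ⟨by omega, fun x _ hx => by rw [if_neg hx], l, h2, ?_, by omega⟩,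
      fun h => ⟨fun _ => ⟨fun x hx hx' => by rw [if_neg hx', if_neg hx],
        l ++ [(d.regs 15, d.regs 16)], ?_, ?_, he⟩, fun h0 => absurd h0 h4.ne'⟩⟩
    · have h : m.ch r = d.regs 15 := by by_contra hc; simp [hc] at h
      rw [h]
      exact rle_append_replicate_same h3 e
    · rw [encodeRuns_append, h2]; simp [encodeRuns]
    · have h : m.ch r ≠ d.regs 15 := by intro hc; simp [hc] at h
      exact rle_append_replicate_of_ne h3 h.symm he

/-- One iteration of the merging phase: the output of a piece of a run, and the computation of the
rank of the new head of the collection if the block ends. -/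
def stepProg (k : ℕ) : Prog :=
  selectProg k ⨾ pieceProg k ⨾ pendProg ⨾
  .ite (.reg 10 <ᵉ .reg 12) (.put (.arr (3 * k + 1) 6 (.reg 11)) (.reg 10))
    (20 ≔ .reg 11 ⨾ rankProg k ⨾ .put (.arr (3 * k + 1) 6 (.reg 11)) (.reg 22))

/-! ### Amortized accounting for the merging phase. -/

namespace Model

variable (m : Model)

open Classical in
/-- The number of pieces of runs that are output after the first `N` occurrences. -/
noncomputable def pieces (N : ℕ) : ℕ :=
  ((Finset.range m.n).filter fun t => N < t ∧ (m.IsStart t ∨ ∃ r < m.R, m.start r = m.pos t)).card +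
    if N < m.n then 1 else 0

/-- The beginnings of blocks whose ranks are computed after the first `N` occurrences. -/
def unranked (N : ℕ) : Finset ℕ :=
  (Finset.range m.n).filter fun t => m.IsStart t ∧ m.head (m.lab t) N < t

/-- The time for an iteration without a rank computation. -/
def baseTime : ℕ := 50 * m.k + 500

/-- The time for the computation of the rank of `t`. -/
def rankCost (t : ℕ) : ℕ := m.rankTime (m.reach t) + 50

/-- A bound for the remaining time after the first `N` occurrences. -/
noncomputable def potential (N : ℕ) : ℕ :=
  m.baseTime * m.pieces N + ∑ t ∈ m.unranked N, m.rankCost t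

variable {m}

/-- By `Piece.cut` the index `N + e` itself is counted for `N` but no longer for `N + e`. The extra
unit in `pieces` pays for the last piece, which reaches `n`. -/
theorem pieces_add_one_le {N e r : ℕ} (hN : N < m.n) (hp : m.Piece N e r) :
    m.pieces (N + e) + 1 ≤ m.pieces N := by
  classical
  have he := hp.pos
  unfold pieces
  rw [if_pos hN]
  split_ifs with h
  · refine Nat.add_le_add_right (Finset.card_lt_card ⟨fun t ht => ?_, fun hsub => ?_⟩) 1
    · simp only [Finset.mem_filter] at ht ⊢
      exact ⟨ht.1, by omega, ht.2.2⟩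
    · have := @hsub (N + e) (by
        simp only [Finset.mem_filter, Finset.mem_range]
        exact ⟨h, by omega, hp.cut h⟩)
      simp at this
  · rw [Finset.card_eq_zero.2]
    · omega
    · refine Finset.filter_eq_empty_iff.2 fun t ht => ?_
      rw [Finset.mem_range] at ht
      omega

theorem head_mono {a N N' : ℕ} (h : N ≤ N') : m.head a N ≤ m.head a N' :=
  head_le (h.trans (le_head _ _)) (Nat.find_spec (m.exists_head a N')).2

theorem unranked_subset {N N' : ℕ} (h : N ≤ N') : m.unranked N' ⊆ m.unranked N := by
  intro t ht
  simp only [unranked, Finset.mem_filter] at ht ⊢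
  exact ⟨ht.1, ht.2.1, (head_mono h).trans_lt ht.2.2⟩

/-- After a block has ended, the next occurrence with its label follows one with a different label.
So only beginnings of blocks have to be ranked, and `reach` applies to them. -/
theorem isStart_head_next {N : ℕ} (h : m.head (m.lab N) (m.next N) < m.n) :
    m.next N < m.head (m.lab N) (m.next N) ∧ m.IsStart (m.head (m.lab N) (m.next N)) := by
  have h1 := le_head (m := m) (m.lab N) (m.next N)
  have h2 := lab_head h
  have h3 : m.next N ≠ m.head (m.lab N) (m.next N) := fun heq =>
    lab_next (m := m) (N := N) (by omega) (heq ▸ h2)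
  refine ⟨by omega, Or.inr ?_⟩
  rw [h2]
  exact lab_ne_of_lt_head (N := m.next N) (by omega) (by omega)

/-- The new head leaves the set `unranked`, so each beginning of a block is paid for once. -/
theorem sum_unranked_next {N : ℕ} (h : m.head (m.lab N) (m.next N) < m.n) :
    m.rankCost (m.head (m.lab N) (m.next N)) + ∑ t ∈ m.unranked (m.next N), m.rankCost t ≤
      ∑ t ∈ m.unranked N, m.rankCost t := by
  obtain ⟨h1, h2⟩ := isStart_head_next h
  have h3 := lab_head h
  set t' := m.head (m.lab N) (m.next N) with ht'
  have h4 := lt_next (m := m) N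
  rw [← Finset.sum_insert (s := m.unranked (m.next N)) (a := t')]
  · refine Finset.sum_le_sum_of_subset (Finset.insert_subset ?_ (unranked_subset h4.le))
    simp only [unranked, Finset.mem_filter, Finset.mem_range]
    exact ⟨h, h2, by rw [h3, head_self]; omega⟩
  · simp only [unranked, Finset.mem_filter, not_and, not_lt]
    intro _ _
    rw [h3]

end Model

theorem Merging.same {m : Model} {A : ℕ → ℕ} {N : ℕ} {s s' : State} {b : ℕ} (h : Merging m A N s)
    (hs : Same b s s') (hb : 17 ≤ b) : Merging m A N s' where
  ready := h.ready.same hs (by omega)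
  reg10 := (hs.regs 10 (by omega)).trans h.reg10
  pos := by rw [hs.mem]; exact h.pos
  run := by rw [hs.mem]; exact h.run
  out := by rw [hs.regs 15 (by omega), hs.regs 16 (by omega), hs.out]; exact h.out

theorem Merging.store {m : Model} {A : ℕ → ℕ} {N : ℕ} {s : State} (h : Merging m A N s) {j : ℕ}
    (hj : j < m.k) (v : ℕ) : Merging m A N (s.store (3 * m.k + 1 + 6 * m.R + j) v) where
  ready := h.ready.congr rfl rfl fun a ha => by rw [State.store_mem, if_neg (by omega)]
  reg10 := h.reg10
  pos i hi := by rw [State.store_mem, if_neg (by omega)]; exact h.pos i hi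
  run i hi := by rw [State.store_mem, if_neg (by omega)]; exact h.run i hi
  out := h.out

/-- The computation and storage of the rank of the head of the collection in register `x`. -/
theorem rankStore_spec {w M : ℕ} (hw : 0 < w) {m : Model} (hv : m.Valid) (hf : m.Fits w M)
    {A : ℕ → ℕ} (hA : m.Sorts A) {s : State} {N j x : ℕ} (hs : Merging m A N s) (hx : x < 20)
    (hN : N ≤ m.n) (hj : j < m.k) (hxj : s.regs x = j)
    (hst : m.head j N < m.n → m.IsStart (m.head j N)) :
    Ex w M (20 ≔ .reg x ⨾ rankProg m.k ⨾ .put (.arr (3 * m.k + 1) 6 (.reg x)) (.reg 22)) s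
      ((if m.head j N < m.n then m.rankTime (m.reach (m.head j N)) else 100) + 20) fun s' =>
      Merging m A N s' ∧ (∀ y < 20, s'.regs y = s.regs y) ∧
      ∀ i < m.k, s'.mem (3 * m.k + 1 + 6 * m.R + i) =
        if i = j then m.head j N else s.mem (3 * m.k + 1 + 6 * m.R + i) := by
  obtain ⟨hf1, hf2, hf3, hf4, hf5⟩ := id hf
  refine Ex.seq_of (T₁ := 2) (T₂ :=
    (if m.head j N < m.n then m.rankTime (m.reach (m.head j N)) else 100) + 18)
    (Q₁ := fun s' => s' = s.set 20 j) ?_ ?_ (by omega)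
  · exact Ex.of_wp hw (by simp [Prog.time, Expr.cost]) (by simp [hxj])
  rintro _ rfl
  have k1 : Same 20 s (s.set 20 j) := (Same.refl 20 s).set le_rfl _
  have hs1 := hs.same k1 (by norm_num)
  refine Ex.seq_of (T₂ := 18) (Q₁ := fun s' => Same 20 s s' ∧ s'.regs 22 = m.head j N) ?_ ?_ le_rfl
  · split_ifs with h
    · have hl := Model.lab_head h
      refine (rankProg_spec hw hv hf hA hs1.ready h (hst h) (by simp [hl]) ?_).mono le_rfl
        fun s' hs' => ⟨k1.trans hs'.1 le_rfl, hs'.2⟩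
      rw [Model.pos, hl, Model.before_head]
      exact hs1.pos j hj
    · have hh : m.head j N = m.n := le_antisymm (Model.head_le_n hN) (by omega)
      refine (rankProg_spec_end hw hv hf hs1.ready hj (by simp) ?_).mono le_rfl
        fun s' hs' => ⟨k1.trans hs'.1 le_rfl, by rw [hs'.2, hh]⟩
      rw [hs1.pos j hj, ← Model.before_head, hh]
      exact hv.before_n j hj
  · rintro s' ⟨h1, h2⟩
    have hs2 := hs.same h1 (by norm_num)
    have hr := h1.regs x hx
    refine Ex.of_wp hw (by simp [Prog.time, Expr.cost]) ?_
    simp only [Prog.wp, Expr.ok, Expr.val, Expr.arr_ok, Expr.arr_val, hs2.ready.reg0, hr, hxj, h2,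
      true_and]
    refine ⟨by omega, by omega, hs2.store hj _, fun y hy => h1.regs y hy, fun i hi => ?_⟩
    rw [State.store_mem, h1.mem]
    by_cases hij : i = j
    · rw [if_pos (by omega), if_pos hij]
    · rw [if_neg (by omega), if_neg hij]

/-- If the piece ends inside the block, the new head of the owner is `N + e` and no search is
needed. If it ends the block, the search is paid for by `sum_unranked_next`. The heads of the other
collections do not change. The summand `4` is the cost of the guard of the surrounding loop. -/
theorem stepProg_spec {w M : ℕ} (hw : 0 < w) {m : Model} (hv : m.Valid) (hf : m.Fits w M)
    {A : ℕ → ℕ} (hA : m.Sorts A) {s : State} {N : ℕ} (hs : Merging m A N s) (hr : Ranked m N s)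
    (hN : N < m.n) : ∃ N' T, N' ≤ m.n ∧ T + 4 + m.potential N' ≤ m.potential N ∧
      Ex w M (stepProg m.k) s T fun s' => Merging m A N' s' ∧ Ranked m N' s' := by
  obtain ⟨hf1, hf2, hf3, hf4, hf5⟩ := id hf
  have hlab := hv.lab_lt N hN
  have hn1 := Model.lt_next (m := m) N
  have hn2 := Model.next_le_n hN
  obtain ⟨t₁, s₁, run₁, ht₁, q1, q2, q3, q11, q12⟩ :=
    selectProg_spec hw hv hf hN hs.ready.reg0 hs.ready.reg1 hs.reg10 hr
  have hs1 : Merging m A N s₁ := by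
    have r0 := q3 0 (by omega) (by omega) (by omega) (by omega)
    have r1 := q3 1 (by omega) (by omega) (by omega) (by omega)
    refine ⟨hs.ready.congr r0 r1 fun a _ => by rw [q1], ?_, by rw [q1]; exact hs.pos,
      by rw [q1]; exact hs.run, ?_⟩
    · rw [q3 10 (by omega) (by omega) (by omega) (by omega)]; exact hs.reg10
    · rw [q3 15 (by omega) (by omega) (by omega) (by omega),
        q3 16 (by omega) (by omega) (by omega) (by omega), q2]
      exact hs.out
  obtain ⟨e, r, hp, hpiece⟩ := pieceProg_spec hw hv hf hN hs1 q11 q12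
  have he := hp.pos
  have hle := hp.le
  have hpot := Model.pieces_add_one_le hN hp
  have hbase : ∀ {L L' T : ℕ}, T + L' ≤ m.baseTime + L →
      T + (m.baseTime * m.pieces (N + e) + L') ≤ m.baseTime * m.pieces N + L := by
    intro L L' T h
    have := Nat.mul_le_mul_left m.baseTime hpot
    rw [Nat.mul_add, mul_one] at this
    omega
  have hstart : m.head (m.lab N) (m.next N) < m.n → m.IsStart (m.head (m.lab N) (m.next N)) :=
    fun h => (Model.isStart_head_next h).2
  have key : ∀ T₄ : ℕ, (∀ s₃ : State, Merging m A (N + e) s₃ → s₃.regs 11 = m.lab N →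
      s₃.regs 12 = m.next N → (∀ j < m.k, s₃.mem (3 * m.k + 1 + 6 * m.R + j) = m.head j N) →
      Ex w M (.ite (.reg 10 <ᵉ .reg 12) (.put (.arr (3 * m.k + 1) 6 (.reg 11)) (.reg 10))
        (20 ≔ .reg 11 ⨾ rankProg m.k ⨾ .put (.arr (3 * m.k + 1) 6 (.reg 11)) (.reg 22))) s₃ T₄
        fun s' => Merging m A (N + e) s' ∧ Ranked m (N + e) s') →
      Ex w M (stepProg m.k) s (50 * m.k + 10 + (130 + (30 + T₄)))
        fun s' => Merging m A (N + e) s' ∧ Ranked m (N + e) s' := by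
    intro T₄ h4
    refine Ex.seq ⟨t₁, s₁, run₁, by omega, ?_⟩
    refine Ex.seq_of hpiece ?_ le_rfl
    rintro s₂ ⟨g1, g2, g3, g4, g5, g6, g7, g8, g9, g10, g11, g12⟩
    refine Ex.seq_of (pendProg_spec hw hf hs1 hp (by omega) g5 g6 g7 g8 g9) ?_ le_rfl
    rintro s₃ ⟨k1, k2, k3⟩
    refine h4 s₃ ⟨g1.congr (k2 0 (by omega) (by omega)) (k2 1 (by omega) (by omega))
        fun a _ => by rw [k1], ?_, by rw [k1]; exact g11, by rw [k1]; exact g12,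
        Or.inr ⟨by omega, k3⟩⟩ ?_ ?_ ?_
    · rw [k2 10 (by omega) (by omega), g2]
    · rw [k2 11 (by omega) (by omega), g3]
    · rw [k2 12 (by omega) (by omega), g4]
    · intro j hj
      rw [k1, g10 j hj, q1, hr j hj]
  have hother : ∀ j, j ≠ m.lab N → m.head j (N + e) = m.head j N := fun j hj =>
    Model.head_eq (by omega) (hle.trans (Model.next_le_head hN hj))
  by_cases hlt : N + e < m.next N
  · refine ⟨N + e, 50 * m.k + 10 + (130 + (30 + 30)), by omega, ?_, key 30 fun s₃ g1 g2 g3 g4 => ?_⟩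
    · have h1 := Finset.sum_le_sum_of_subset (f := m.rankCost)
        (Model.unranked_subset (m := m) (show N ≤ N + e by omega))
      unfold Model.potential
      refine hbase ?_
      unfold Model.baseTime
      omega
    · have hl : m.lab (N + e) = m.lab N := Model.lab_eq_of_lt_next (by omega) hlt
      refine (Ex.ite hw (T := 20) (by simp) (fun _ => Ex.of_wp hw (by simp [Prog.time, Expr.cost]) ?_)
        fun h => ?_).mono (by simp only [Expr.cost]; omega) fun _ => id
      swap
      · simp [g1.reg10, g3, hlt] at h
      simp only [Prog.wp, Expr.ok, Expr.val, Expr.arr_ok, Expr.arr_val, g1.reg10, g2,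
        g1.ready.reg0, true_and]
      refine ⟨by omega, by omega, g1.store hlab _, fun j hj => ?_⟩
      rw [State.store_mem]
      by_cases hj' : j = m.lab N
      · rw [if_pos (by omega), hj', ← hl, Model.head_self]
      · rw [if_neg (by omega), g4 j hj, hother j hj']
  · have hNe : N + e = m.next N := by omega
    refine ⟨N + e, 50 * m.k + 10 + (130 + (30 + (10 + ((if m.head (m.lab N) (N + e) < m.n then
      m.rankTime (m.reach (m.head (m.lab N) (N + e))) else 100) + 20)))), by omega, ?_,
      key _ fun s₃ g1 g2 g3 g4 => ?_⟩
    · unfold Model.potential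
      rw [show ∀ a b : ℕ, a + 4 + b = (a + 4) + b from fun _ _ => rfl]
      refine hbase ?_
      rw [hNe]
      split_ifs with h
      · have h1 := Model.sum_unranked_next h
        unfold Model.baseTime
        unfold Model.rankCost at *
        omega
      · have h1 := Finset.sum_le_sum_of_subset (f := m.rankCost)
          (Model.unranked_subset (m := m) hn1.le)
        unfold Model.baseTime
        omega
    · refine (Ex.ite hw (by simp) (fun h => ?_) fun _ =>
        rankStore_spec hw hv hf hA g1 (by norm_num) (by omega) hlab g2
          (by rw [hNe]; exact hstart)).mono (by simp only [Expr.cost]; omega) ?_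
      · simp [g1.reg10, g3, hNe] at h
      · rintro s' ⟨k1, _, k3⟩
        refine ⟨k1, fun j hj => ?_⟩
        rw [k3 j hj]
        split_ifs with h
        · rw [h]
        · rw [g4 j hj, hother j h]

/-- The merging phase. -/
def mergeProg (k : ℕ) : Prog :=
  (10 ≔ .lit 0 ⨾ 16 ≔ .lit 0 ⨾ 19 ≔ .lit 0) ⨾
  .loop (.reg 19 <ᵉ .lit k)
    ((20 ≔ .reg 19 ⨾ rankProg k ⨾ .put (.arr (3 * k + 1) 6 (.reg 19)) (.reg 22)) ⨾
      19 ≔ .reg 19 +ᵉ .lit 1) ⨾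
  .loop (.reg 10 <ᵉ .reg 1) (stepProg k) ⨾
  .emit (.reg 15) ⨾ .emit (.reg 16)

/-- The sum of the weights of the block boundaries. -/
def Model.totalWeight (m : Model) : ℕ := ∑ t ∈ Finset.range (m.n - 1), m.weight t

/-- The time for the merging phase. -/
noncomputable def Model.mergeTime (m : Model) : ℕ :=
  m.k * (m.rankTime (2 * m.totalWeight) + 140) + m.potential 0 + 100

/-- The initial heads do not belong to `unranked 0`; the ranking of each of them is charged with the
whole `2 * totalWeight`, which only costs a factor `k`. -/
theorem mergeProg_spec {w M : ℕ} (hw : 0 < w) {m : Model} (hv : m.Valid) (hf : m.Fits w M)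
    {A : ℕ → ℕ} (hA : m.Sorts A) {s : State} (hs : Ready m A s) (ho : s.out = [])
    (hpos : ∀ j < m.k, s.mem (2 * m.k + 1 + 6 * m.R + j) = m.ns j)
    (hrun : ∀ j < m.k, s.mem (4 * m.k + 1 + 6 * m.R + j) = m.off j) :
    Ex w M (mergeProg m.k) s m.mergeTime fun s' =>
      s'.out = encodeRuns (rle ((List.range m.n).map m.out)) := by
  obtain ⟨hf1, hf2, hf3, hf4, hf5⟩ := id hf
  have hR := hv.R_le_n
  have hk := hv.k_le_R
  have hk0 := hv.k_pos
  have hmem : ∀ j < m.k, m.ns j < m.ns (j + 1) ∧ m.off j < m.R ∧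
      m.ns j < m.start (m.off j + 1) := by
    intro j hj
    have h1 : m.off (j + 1) = m.off j + m.cnt j := Finset.sum_range_succ _ _
    have h2 := hv.cnt_pos j hj
    have h3 := hv.off_le (j := j + 1) hj
    have h4 : m.start (m.off j + 1) = m.start (m.off j) + m.ln (m.off j) :=
      Finset.sum_range_succ _ _
    have h5 := hv.ln_pos (m.off j) (by omega)
    have h6 : m.start (m.off j + 1) ≤ m.start (m.off (j + 1)) :=
      Finset.sum_range_le_of_le (by omega)
    unfold Model.ns
    omega
  refine Ex.seq_of (T₁ := 6) (T₂ := m.mergeTime - 6) (Q₁ := fun s' => s'.regs 10 = 0 ∧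
    s'.regs 19 = 0 ∧ s'.mem = s.mem ∧ Merging m A 0 s') ?_ ?_
    (by unfold Model.mergeTime; omega)
  · refine Ex.of_wp hw (by simp [Prog.time, Expr.cost]) ?_
    simp
    refine ⟨hs.congr (by simp) (by simp) (by simp), by simp, fun j hj => ?_, fun j hj _ => ?_,
      Or.inl ⟨rfl, by simp, by simpa using ho⟩⟩
    · simpa [Model.before] using hpos j hj
    · obtain ⟨h1, h2, h3⟩ := hmem j hj
      exact ⟨m.off j, by simpa using hrun j hj, h2, by simp [Model.before, Model.ns],
        by simpa [Model.before] using h3⟩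
  rintro s₁ ⟨h10, h19, hm1, hM1⟩
  have hstart0 : ∀ j, m.head j 0 < m.n → m.IsStart (m.head j 0) := by
    intro j hj
    by_cases h : m.head j 0 = 0
    · exact Or.inl h
    · right
      rw [Model.lab_head hj]
      exact Model.lab_ne_of_lt_head (N := 0) (by omega) (by omega)
  have hreach : ∀ j, m.head j 0 < m.n → m.reach (m.head j 0) ≤ 2 * m.totalWeight := by
    intro j hj
    refine le_trans ?_ Model.Valid.sum_reach_le
    exact Finset.single_le_sum (f := m.reach) (fun _ _ => Nat.zero_le _)
      (Finset.mem_filter.2 ⟨Finset.mem_range.2 hj, hstart0 j hj⟩)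
  have hrank_mono : ∀ {a b : ℕ}, a ≤ b → m.rankTime a ≤ m.rankTime b := by
    intro a b h
    unfold Model.rankTime Model.searchTime
    gcongr
  refine Ex.seq_of (T₁ := m.k * (m.rankTime (2 * m.totalWeight) + 136) + 4)
    (T₂ := m.potential 0 + 20) (Q₁ := fun s' => Merging m A 0 s' ∧ Ranked m 0 s') ?_ ?_
    (by unfold Model.mergeTime; ring_nf; omega)
  · refine (Ex.for_loop hw (fun j s' => Merging m A 0 s' ∧ s'.regs 19 = j ∧
      ∀ i < j, s'.mem (3 * m.k + 1 + 6 * m.R + i) = m.head i 0) m.k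
      (m.rankTime (2 * m.totalWeight) + 126) ?_ ?_ 0 s₁ (Nat.zero_le _)
      ⟨hM1, h19, by simp⟩).mono (by simp only [Expr.cost]; exact Nat.add_le_add (Nat.mul_le_mul (by omega) (by omega)) (by omega))
        fun s' hs' => ⟨hs'.1, hs'.2.2⟩
    · rintro j s' ⟨g1, g2, g3⟩ hj
      simp [g2]; omega
    · rintro j s' ⟨g1, g2, g3⟩ hj
      refine Ex.seq_of (T₂ := 4) (rankStore_spec hw hv hf hA g1 (by norm_num) (Nat.zero_le _) hj g2
        (hstart0 j)) ?_ ?_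
      · rintro s₂ ⟨k1, k2, k3⟩
        refine Ex.of_wp hw (by simp [Prog.time, Expr.cost]) ?_
        simp [k2 19, g2]
        refine ⟨by omega, k1.same ((Same.refl 17 _).set (by norm_num) _) le_rfl, fun i hi => ?_⟩
        rw [k3 i (by omega)]
        split_ifs with h
        · rw [h]
        · exact g3 i (by omega)
      · split_ifs with h
        · have := hrank_mono (hreach j h)
          omega
        · omega
  rintro s₂ ⟨hM2, hR2⟩
  refine Ex.seq_of (T₁ := m.potential 0 + 4) (T₂ := 4) (Q₁ := fun s' => Merging m A m.n s') ?_ ?_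
    (by omega)
  · refine (Ex.loop hw (α := ℕ) (fun N s' => N ≤ m.n ∧ Merging m A N s' ∧ Ranked m N s')
      m.potential ?_ 0 s₂ ⟨Nat.zero_le _, hM2, hR2⟩).mono (by simp only [Expr.cost]; omega)
      fun _ => id
    rintro N s' ⟨hN, g1, g2⟩
    refine ⟨by simp, fun hc => ?_, fun hc => ?_⟩
    · simp [g1.reg10, g1.ready.reg1] at hc
      obtain ⟨N', T, h1, h2, h3⟩ := stepProg_spec hw hv hf hA g1 g2 hc
      exact ⟨T, h3.mono le_rfl fun s'' h => ⟨N', ⟨h1, h⟩, by simp only [Expr.cost]; omega⟩⟩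
    · simp [g1.reg10, g1.ready.reg1] at hc
      obtain rfl : N = m.n := by omega
      exact g1
  · intro s₃ h3
    refine Ex.of_wp hw (by simp [Prog.time, Expr.cost]) ?_
    simp
    rcases h3.out with ⟨h, _⟩ | ⟨_, d, h4, h5, _⟩
    · omega
    · rw [h5, encodeRuns_append, h4]; simp [encodeRuns]

/-! ### The construction of the tables -/

/-- The input of the problem is in the memory. -/
structure Input (m : Model) (s : State) : Prop where
  cnt : ∀ j < m.k, s.mem j = m.cnt j
  ch : ∀ r < m.R, s.mem (m.k + 2 * r) = m.ch r
  ln : ∀ r < m.R, s.mem (m.k + 1 + 2 * r) = m.ln r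
  out : s.out = []

theorem Input.congr {m : Model} {s s' : State} (h : Input m s) (ho : s'.out = s.out)
    (hm : ∀ a < m.k + 2 * m.R, s'.mem a = s.mem a) : Input m s' := by
  obtain ⟨h1, h2, h3, h4⟩ := h
  refine ⟨?_, ?_, ?_, ho.trans h4⟩ <;> intro r hr <;> rw [hm _ (by omega)] <;> solve_by_elim

/-- The number of runs (register 0). -/
def countProg (k : ℕ) : Prog :=
  (0 ≔ .lit 0 ⨾ 3 ≔ .lit 0) ⨾
  .loop (.reg 3 <ᵉ .lit k) (0 ≔ .reg 0 +ᵉ .load (.reg 3) ⨾ 3 ≔ .reg 3 +ᵉ .lit 1)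

theorem countProg_spec {w M : ℕ} (hw : 0 < w) {m : Model} (hv : m.Valid) (hf : m.Fits w M)
    {s : State} (hs : Input m s) :
    Ex w M (countProg m.k) s (m.k * 20 + 10) fun s' => Input m s' ∧ s'.regs 0 = m.R := by
  obtain ⟨hf1, hf2, hf3, hf4, hf5⟩ := id hf
  have hk := hv.k_le_R
  refine Ex.seq_of (T₁ := 4) (T₂ := m.k * 20 + 4) (Q₁ := fun s' => s' = (s.set 0 0).set 3 0)
    ?_ ?_ (by omega)
  · exact Ex.of_wp hw (by simp [Prog.time, Expr.cost]) (by simp)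
  rintro _ rfl
  refine (Ex.for_loop hw (fun j s' => Input m s' ∧ s'.regs 0 = m.off j ∧ s'.regs 3 = j) m.k 16
    ?_ ?_ 0 ((s.set 0 0).set 3 0) (Nat.zero_le _)
    ⟨hs.congr rfl fun _ _ => rfl, by simp [Model.off], by simp⟩).mono
    (by simp only [Expr.cost]; omega) fun s' h => ⟨h.1, h.2.1.trans hv.off_k⟩
  · rintro j s' ⟨g1, g2, g3⟩ hj
    simp [g3]; omega
  · rintro j s' ⟨g1, g2, g3⟩ hj
    have h1 : m.off (j + 1) = m.off j + m.cnt j := Finset.sum_range_succ _ _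
    have h2 := hv.off_le (j := j + 1) hj
    refine Ex.of_wp hw (by simp [Prog.time, Expr.cost]) ?_
    simp [g2, g3, g1.cnt j hj, ← h1]
    exact ⟨by omega, by omega, g1.congr rfl fun _ _ => rfl⟩

/-- An upper bound for the characters (register 2). -/
def boundProg (k : ℕ) : Prog :=
  (2 ≔ .lit 0 ⨾ 3 ≔ .lit 0) ⨾
  .loop (.reg 3 <ᵉ .reg 0)
    (4 ≔ .load (.lit k +ᵉ .lit 2 *ᵉ .reg 3) ⨾
      .ite (.reg 4 <ᵉ .reg 2) .skip (2 ≔ .reg 4 +ᵉ .lit 1) ⨾ 3 ≔ .reg 3 +ᵉ .lit 1)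

theorem Model.Valid.sigma_le (m : Model) (hv : m.Valid) : m.σ ≤ m.k * m.σ :=
  Nat.le_mul_of_pos_left _ hv.k_pos

/-- The input does not contain `σ`, so a bound for the characters is read off the runs; as it is at
most `σ`, it does not increase the number of radix passes. -/
theorem boundProg_spec {w M : ℕ} (hw : 0 < w) {m : Model} (hv : m.Valid) (hf : m.Fits w M)
    {s : State} (hs : Input m s) (h0 : s.regs 0 = m.R) :
    Ex w M (boundProg m.k) s (m.R * 40 + 10) fun s' => Input m s' ∧ s'.regs 0 = m.R ∧
      s'.regs 2 ≤ m.σ ∧ ∀ r < m.R, m.ch r < s'.regs 2 := by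
  obtain ⟨hf1, hf2, hf3, hf4, hf5⟩ := id hf
  have hk := hv.k_le_R
  have hk0 := hv.k_pos
  have hσ := hv.sigma_le
  refine Ex.seq_of (T₁ := 4) (T₂ := m.R * 40 + 4) (Q₁ := fun s' => s' = (s.set 2 0).set 3 0)
    ?_ ?_ (by omega)
  · exact Ex.of_wp hw (by simp [Prog.time, Expr.cost]) (by simp)
  rintro _ rfl
  refine (Ex.for_loop hw (fun x s' => Input m s' ∧ s'.regs 0 = m.R ∧ s'.regs 3 = x ∧
    s'.regs 2 ≤ m.σ ∧ ∀ r < x, m.ch r < s'.regs 2) m.R 36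
    ?_ ?_ 0 ((s.set 2 0).set 3 0) (Nat.zero_le _)
    ⟨hs.congr rfl fun _ _ => rfl, by simpa using h0, by simp, by simp, by simp⟩).mono
    (by simp only [Expr.cost]; omega) fun s' h => ⟨h.1, h.2.1, h.2.2.2⟩
  · rintro x s' ⟨g1, g2, g3, g4, g5⟩ hx
    simp [g3, g2]
  · rintro x s' ⟨g1, g2, g3, g4, g5⟩ hx
    have h1 := hv.ch_lt x hx
    refine Ex.of_wp hw (by simp [Prog.time, Expr.cost]) ?_
    simp [g2, g3, g1.ch x hx]
    refine ⟨by omega, fun h => ⟨by omega, g1.congr rfl fun _ _ => rfl, g4, fun r hr => ?_⟩,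
      fun h => ⟨by omega, by omega, g1.congr rfl fun _ _ => rfl, by omega, fun r hr => ?_⟩⟩
    · rcases (show r ≤ x from hr).lt_or_eq with h' | rfl
      · exact g5 r h'
      · exact h
    · rcases (show r ≤ x from hr).lt_or_eq with h' | rfl
      · have := g5 r h'; omega
      · omega

/-- The positions of the runs and of the collections, and the keys by which the runs are sorted. -/
def tableProg (k : ℕ) : Prog :=
  (1 ≔ .lit 0 ⨾ 3 ≔ .lit 0 ⨾ 4 ≔ .lit 0 ⨾ 5 ≔ .lit 0) ⨾
  .loop (.reg 4 <ᵉ .lit k)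
    ((.put (.arr k 6 (.reg 4)) (.reg 1) ⨾ .put (.arr (2 * k + 1) 6 (.reg 4)) (.reg 1) ⨾
        .put (.arr (4 * k + 1) 6 (.reg 4)) (.reg 3) ⨾ 5 ≔ .reg 5 +ᵉ .load (.reg 4)) ⨾
      .loop (.reg 3 <ᵉ .reg 5)
        (.put (.arr k 4 (.reg 3)) (.reg 1) ⨾
          .put (.arr k 5 (.reg 3)) (.reg 4 *ᵉ .reg 2 +ᵉ .load (.lit k +ᵉ .lit 2 *ᵉ .reg 3)) ⨾
          .put (.arr k 2 (.reg 3)) (.reg 3) ⨾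
          1 ≔ .reg 1 +ᵉ .load (.lit (k + 1) +ᵉ .lit 2 *ᵉ .reg 3) ⨾ 3 ≔ .reg 3 +ᵉ .lit 1) ⨾
      4 ≔ .reg 4 +ᵉ .lit 1) ⨾
  .put (.arr k 6 (.lit k)) (.reg 1)

/-- The key by which a run is sorted, if `B` bounds the characters. -/
def Model.key (m : Model) (B r : ℕ) : ℕ := m.col r * B + m.ch r

/-- The tables for the first `r` runs and the first `j` collections are in the memory. -/
structure Tables (m : Model) (B r j : ℕ) (s : State) : Prop where
  input : Input m s
  reg0 : s.regs 0 = m.R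
  reg2 : s.regs 2 = B
  start : ∀ i < r, s.mem (m.k + 4 * m.R + i) = m.start i
  key : ∀ i < r, s.mem (m.k + 5 * m.R + i) = m.key B i
  perm : ∀ i < r, s.mem (m.k + 2 * m.R + i) = i
  ns : ∀ i < j, s.mem (m.k + 6 * m.R + i) = m.ns i
  -- The table of `ns` has `k + 1` entries, but this one and the next have only `k`.
  pos : ∀ i < min j m.k, s.mem (2 * m.k + 1 + 6 * m.R + i) = m.ns i
  run : ∀ i < min j m.k, s.mem (4 * m.k + 1 + 6 * m.R + i) = m.off i

theorem key_lt {m : Model} {B j c : ℕ} (hB : B ≤ m.σ) (hj : j < m.k) (hc : c < B) :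
    j * B + c < m.k * m.σ := by
  calc j * B + c < j * B + B := by omega
    _ = (j + 1) * B := by ring
    _ ≤ m.k * m.σ := Nat.mul_le_mul hj hB

theorem tableProg_spec {w M : ℕ} (hw : 0 < w) {m : Model} (hv : m.Valid) (hf : m.Fits w M)
    {s : State} {B : ℕ} (hs : Input m s) (h0 : s.regs 0 = m.R) (h2 : s.regs 2 = B) (hB : B ≤ m.σ)
    (hch : ∀ r < m.R, m.ch r < B) :
    Ex w M (tableProg m.k) s (m.k * 70 + m.R * 80 + 40) fun s' =>
      Tables m B m.R (m.k + 1) s' ∧ s'.regs 1 = m.n := by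
  obtain ⟨hf1, hf2, hf3, hf4, hf5⟩ := id hf
  have hk := hv.k_le_R
  have hk0 := hv.k_pos
  have hR := hv.R_le_n
  refine Ex.seq_of (T₁ := 8) (T₂ := m.k * 70 + m.R * 80 + 32)
    (Q₁ := fun s' => Tables m B 0 0 s' ∧ s'.regs 1 = 0 ∧ s'.regs 3 = 0 ∧ s'.regs 4 = 0 ∧
      s'.regs 5 = 0) ?_ ?_ (by omega)
  · refine Ex.of_wp hw (by simp [Prog.time, Expr.cost]) ?_
    simp
    exact ⟨hs.congr rfl fun _ _ => rfl, by simpa using h0, by simpa using h2, by simp, by simp,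
      by simp, by simp, by simp, by simp⟩
  rintro s₁ ⟨hT, h1, h3, h4, h5⟩
  refine Ex.seq_of (T₁ := m.k * 70 + m.R * 80 + 4) (T₂ := 16) (Q₁ := fun s' =>
    Tables m B m.R m.k s' ∧ s'.regs 1 = m.n) ?_ ?_ (by omega)
  -- The potential counts the remaining collections and the remaining runs, since the inner loops
  -- together visit each run once.
  · refine (Ex.loop hw (α := ℕ) (fun j s' => j ≤ m.k ∧ Tables m B (m.off j) j s' ∧
      s'.regs 1 = m.ns j ∧ s'.regs 3 = m.off j ∧ s'.regs 4 = j ∧ s'.regs 5 = m.off j)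
      (fun j => (m.k - j) * 70 + (m.R - m.off j) * 80) ?_ 0 s₁ ⟨Nat.zero_le _, by
        simpa [Model.off] using hT, by simpa [Model.ns, Model.off, Model.start] using h1,
        by simpa [Model.off] using h3, h4, by simpa [Model.off] using h5⟩).mono
      (by simp [Model.off, Expr.cost]) fun _ => id
    rintro j s' ⟨hj, hT, r1, r3, r4, r5⟩
    refine ⟨by simp; omega, fun hc => ?_, fun hc => ?_⟩
    · simp [r4] at hc
      have hoff : m.off (j + 1) = m.off j + m.cnt j := Finset.sum_range_succ _ _
      have hoffR := hv.off_le (j := j + 1) hc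
      have hns := hv.ns_le hj
      have hlen := hv.cnt_pos j hc
      refine ⟨m.cnt j * 80 + 60, ?_⟩
      refine Ex.seq_of (T₁ := 50) (T₂ := m.cnt j * 80 + 10) (Q₁ := fun s'' =>
        Tables m B (m.off j) (j + 1) s'' ∧ s''.regs 1 = m.ns j ∧ s''.regs 3 = m.off j ∧
        s''.regs 4 = j ∧ s''.regs 5 = m.off (j + 1)) ?_ ?_ (by omega)
      · refine Ex.of_wp hw (by simp [Prog.time, Expr.cost]) ?_
        simp only [Prog.wp, Expr.ok, Expr.val, Op.ok, Op.apply, Expr.arr_ok, Expr.arr_val,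
          State.set_regs, State.store_regs, State.store_mem, reduceIte,
          Nat.reduceEqDiff, r1, r3, r4, r5, hT.reg0, true_and]
        rw [if_neg (by omega), if_neg (by omega), if_neg (by omega), hT.input.cnt j hc]
        refine ⟨by omega, by omega, by omega, by omega, by omega, by omega, by omega, ?_, by omega⟩
        refine ⟨hT.input.congr (by simp) fun a ha => ?_, by simpa using hT.reg0,
          by simpa using hT.reg2, fun i hi => ?_, fun i hi => ?_, fun i hi => ?_, fun i hi => ?_,
          fun i hi => ?_, fun i hi => ?_⟩ <;> simp only [State.set_mem, State.store_mem]
        · rw [if_neg (by omega), if_neg (by omega), if_neg (by omega)]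
        · rw [if_neg (by omega), if_neg (by omega), if_neg (by omega), hT.start i hi]
        · rw [if_neg (by omega), if_neg (by omega), if_neg (by omega), hT.key i hi]
        · rw [if_neg (by omega), if_neg (by omega), if_neg (by omega), hT.perm i hi]
        · rw [if_neg (by omega), if_neg (by omega)]
          split_ifs with h
          · rw [show i = j by omega]
          · exact hT.ns i (by omega)
        · rw [if_neg (by omega)]
          split_ifs with h h'
          · rw [show i = j by omega]
          · omega
          · exact hT.pos i (by omega)
        · split_ifs with h h' h''
          · rw [show i = j by omega]
          · omega
          · omega
          · exact hT.run i (by omega)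
      rintro s₂ ⟨hT2, g1, g3, g4, g5⟩
      refine Ex.seq_of (T₁ := m.cnt j * 80 + 4) (T₂ := 4) (Q₁ := fun s'' =>
        Tables m B (m.off (j + 1)) (j + 1) s'' ∧ s''.regs 1 = m.ns (j + 1) ∧
        s''.regs 3 = m.off (j + 1) ∧ s''.regs 4 = j ∧ s''.regs 5 = m.off (j + 1)) ?_ ?_ (by omega)
      · refine (Ex.for_loop hw (fun r s'' => m.off j ≤ r ∧ Tables m B r (j + 1) s'' ∧
          s''.regs 1 = m.start r ∧ s''.regs 3 = r ∧ s''.regs 4 = j ∧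
          s''.regs 5 = m.off (j + 1)) (m.off (j + 1)) 76 ?_ ?_ (m.off j) s₂ (by omega)
          ⟨le_rfl, hT2, g1, g3, g4, g5⟩).mono (by simp only [Expr.cost]; omega)
          fun _ h => h.2
        · rintro r s'' ⟨f0, hT, f1, f3, f4, f5⟩ hr
          simp [f3, f5]
        · rintro r s'' ⟨f0, hT, f1, f3, f4, f5⟩ hr
          have hrR : r < m.R := by omega
          have hkey := key_lt hB hc (hch r hrR)
          have hcol := hv.col_eq j r f0 hr hc
          have hst : m.start (r + 1) = m.start r + m.ln r := Finset.sum_range_succ _ _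
          have hst' := hv.start_le (r := r + 1) hrR
          refine Ex.of_wp hw (by simp [Prog.time, Expr.cost]) ?_
          simp only [Prog.wp, Expr.ok, Expr.val, Op.ok, Op.apply, Expr.arr_ok, Expr.arr_val,
            State.set_regs, State.store_regs, State.store_mem, reduceIte,
            Nat.reduceEqDiff, f1, f3, f4, f5, hT.reg0, hT.reg2, true_and, and_true]
          rw [if_neg (by omega), if_neg (by omega), if_neg (by omega), if_neg (by omega),
            hT.input.ch r hrR, hT.input.ln r hrR]
          refine ⟨by omega, by omega, by omega, by omega, by omega, by omega, by omega, by omega,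
            by omega, by omega, ?_, hst.symm⟩
          refine ⟨hT.input.congr (by simp) fun a ha => ?_, by simpa using hT.reg0,
            by simpa using hT.reg2, fun i hi => ?_, fun i hi => ?_, fun i hi => ?_, fun i hi => ?_,
            fun i hi => ?_, fun i hi => ?_⟩ <;> simp only [State.set_mem, State.store_mem]
          · rw [if_neg (by omega), if_neg (by omega), if_neg (by omega)]
          · rw [if_neg (by omega), if_neg (by omega)]
            split_ifs with h
            · rw [show i = r by omega]
            · exact hT.start i (by omega)
          · rw [if_neg (by omega)]
            split_ifs with h h'
            · rw [show i = r by omega, Model.key, hcol]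
            · omega
            · exact hT.key i (by omega)
          · split_ifs with h h' h''
            · omega
            · omega
            · omega
            · exact hT.perm i (by omega)
          · rw [if_neg (by omega), if_neg (by omega), if_neg (by omega), hT.ns i hi]
          · rw [if_neg (by omega), if_neg (by omega), if_neg (by omega), hT.pos i hi]
          · rw [if_neg (by omega), if_neg (by omega), if_neg (by omega), hT.run i hi]
      rintro s₃ ⟨hT3, f1, f3, f4, f5⟩
      refine Ex.of_wp hw (by simp [Prog.time, Expr.cost]) ?_
      simp [f4]
      refine ⟨by omega, ⟨hc, ⟨hT3.input.congr rfl fun _ _ => rfl, by simpa using hT3.reg0,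
        by simpa using hT3.reg2, hT3.start, hT3.key, hT3.perm, hT3.ns, hT3.pos, hT3.run⟩, f1, f3,
        f5⟩, ?_⟩
      simp only [Expr.cost]; omega
    · simp [r4] at hc
      obtain rfl : j = m.k := by omega
      rw [hv.off_k] at hT
      refine ⟨hT, ?_⟩
      rw [r1, Model.ns, hv.off_k, hv.start_R]
  rintro s₂ ⟨hT, r1⟩
  refine Ex.of_wp hw (by simp [Prog.time, Expr.cost]) ?_
  simp only [Prog.wp, Expr.ok, Expr.val, Expr.arr_ok, Expr.arr_val, State.store_regs, r1, hT.reg0,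
    and_true]
  -- The final entry `ns k = n` closes the last collection.
  have hnsk : m.ns m.k = m.n := by rw [Model.ns, hv.off_k, hv.start_R]
  refine ⟨by omega, by omega, trivial, ⟨hT.input.congr (by simp) fun a ha => ?_, by simpa using hT.reg0,
    by simpa using hT.reg2, fun i hi => ?_, fun i hi => ?_, fun i hi => ?_, fun i hi => ?_,
    fun i hi => ?_, fun i hi => ?_⟩⟩ <;> simp only [State.store_mem]
  · rw [if_neg (by omega)]
  · rw [if_neg (by omega), hT.start i hi]
  · rw [if_neg (by omega), hT.key i hi]
  · rw [if_neg (by omega), hT.perm i hi]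
  · split_ifs with h
    · rw [show i = m.k by omega, hnsk]
    · exact hT.ns i (by omega)
  · rw [if_neg (by omega), hT.pos i (by omega)]
  · rw [if_neg (by omega), hT.run i (by omega)]

/-! ### Radix sort -/

/-- The list is stored in the memory from the address `a` on. -/
def Holds (s : State) (a : ℕ) (l : List ℕ) : Prop := ∀ i < l.length, s.mem (a + i) = l.getD i 0

/-- The states differ only in the registers from 3 on and in the memory for the permutation and
the buffer. -/
structure Frame (m : Model) (s s' : State) : Prop where
  regs : ∀ x < 3, s'.regs x = s.regs x
  mem : ∀ a, a < m.k + 2 * m.R ∨ m.k + 4 * m.R ≤ a → s'.mem a = s.mem a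
  out : s'.out = s.out

theorem Frame.refl (m : Model) (s : State) : Frame m s s :=
  ⟨fun _ _ => rfl, fun _ _ => rfl, rfl⟩

theorem Frame.trans {m : Model} {s s' s'' : State} (h : Frame m s s') (h' : Frame m s' s'') :
    Frame m s s'' :=
  ⟨fun x hx => (h'.regs x hx).trans (h.regs x hx), fun a ha => (h'.mem a ha).trans (h.mem a ha),
    h'.out.trans h.out⟩

theorem Frame.set {m : Model} {s s' : State} (h : Frame m s s') {x : ℕ} (hx : 3 ≤ x) (v : ℕ) :
    Frame m s (s'.set x v) :=
  ⟨fun y hy => by rw [State.set_regs, if_neg (by omega)]; exact h.regs y hy, h.mem, h.out⟩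

theorem Frame.store {m : Model} {s s' : State} (h : Frame m s s') {i : ℕ}
    (h1 : m.k + 2 * m.R ≤ i) (h2 : i < m.k + 4 * m.R) (v : ℕ) : Frame m s (s'.store i v) :=
  ⟨h.regs, fun a ha => by rw [State.store_mem, if_neg (by omega)]; exact h.mem a ha, h.out⟩

/-- The digit `b` of the key of a run. -/
def Model.digit (m : Model) (B b r : ℕ) : ℕ := m.key B r / 2 ^ b % 2

/-- The runs in the list have increasing keys, with respect to the last `b` digits. -/
def Model.SortedBy (m : Model) (B b : ℕ) (l : List ℕ) : Prop :=
  l.length = m.R ∧ (∀ v ∈ l, v < m.R) ∧ l.Pairwise fun u v =>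
    m.key B u % 2 ^ b < m.key B v % 2 ^ b ∨ (m.key B u % 2 ^ b = m.key B v % 2 ^ b ∧ u < v)

/-- The result of a pass of radix sort. -/
def Model.pass (m : Model) (B b : ℕ) (l : List ℕ) : List ℕ :=
  (l.filter fun r => m.digit B b r = 0) ++ l.filter fun r => m.digit B b r = 1

theorem Model.length_pass (m : Model) (B b : ℕ) (l : List ℕ) : (m.pass B b l).length = l.length := by
  rw [pass, List.length_append, List.length_eq_length_filter_add
    (fun r => decide (m.digit B b r = 0)) (l := l)]
  congr 2
  refine List.filter_congr fun r _ => ?_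
  have : m.digit B b r < 2 := Nat.mod_lt _ two_pos
  by_cases h : m.digit B b r = 0
  · simp [h]
  · simp [h]; omega

/-- The new digit is the most significant one considered so far, and filtering preserves the order
inside each of the two classes. -/
theorem Model.SortedBy.pass {m : Model} {B b : ℕ} {l : List ℕ} (h : m.SortedBy B b l) :
    m.SortedBy B (b + 1) (m.pass B b l) := by
  obtain ⟨h1, h2, h3⟩ := h
  have hmod : ∀ u, m.key B u % 2 ^ (b + 1) = m.key B u % 2 ^ b + 2 ^ b * m.digit B b u :=
    fun u => Nat.mod_pow_succ
  refine ⟨(m.length_pass B b l).trans h1, fun v hv => ?_, ?_⟩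
  · rcases List.mem_append.1 hv with h | h <;> exact h2 v (List.mem_filter.1 h).1
  · refine List.pairwise_append.2 ⟨?_, ?_, fun u hu v hv => ?_⟩
    · refine (h3.filter _).imp_of_mem fun {u v} hu hv huv => ?_
      have hu := of_decide_eq_true (List.mem_filter.1 hu).2
      have hv := of_decide_eq_true (List.mem_filter.1 hv).2
      rw [hmod, hmod, hu, hv]; omega
    · refine (h3.filter _).imp_of_mem fun {u v} hu hv huv => ?_
      have hu := of_decide_eq_true (List.mem_filter.1 hu).2
      have hv := of_decide_eq_true (List.mem_filter.1 hv).2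
      rw [hmod, hmod, hu, hv]; omega
    · have hu := of_decide_eq_true (List.mem_filter.1 hu).2
      have hv := of_decide_eq_true (List.mem_filter.1 hv).2
      have := Nat.mod_lt (m.key B u) (Nat.two_pow_pos b)
      rw [hmod, hmod, hu, hv]; omega

/-- Appends to the buffer (of the length in register 7) the runs with the digit `d`. -/
def distProg (k d : ℕ) : Prog :=
  3 ≔ .lit 0 ⨾
  .loop (.reg 3 <ᵉ .reg 0)
    (4 ≔ .load (.arr k 2 (.reg 3)) ⨾ 5 ≔ .load (.arr k 5 (.reg 4)) /ᵉ .reg 6 ⨾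
      .ite (.reg 5 -ᵉ .reg 5 /ᵉ .lit 2 *ᵉ .lit 2 =ᵉ .lit d)
        (.put (.arr k 3 (.reg 7)) (.reg 4) ⨾ 7 ≔ .reg 7 +ᵉ .lit 1) .skip ⨾
      3 ≔ .reg 3 +ᵉ .lit 1)

/-- `F` is the content of the buffer so far: it is empty for the digit `0` and holds the runs with
digit `0` for the digit `1`, so that two calls produce `Model.pass`. -/
theorem distProg_spec {w M : ℕ} (hw : 0 < w) {m : Model} (hv : m.Valid) (hf : m.Fits w M)
    {s : State} {B b d : ℕ} {l F : List ℕ} (hd : d < 2) (h0 : s.regs 0 = m.R)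
    (h6 : s.regs 6 = 2 ^ b) (h7 : s.regs 7 = F.length) (hl : l.length = m.R)
    (hlR : ∀ v ∈ l, v < m.R) (hA : Holds s (m.k + 2 * m.R) l) (hF : Holds s (m.k + 3 * m.R) F)
    (hkey : ∀ r < m.R, s.mem (m.k + 5 * m.R + r) = m.key B r)
    (hkey' : ∀ r < m.R, m.key B r < m.k * m.σ)
    (hlen : F.length + (l.filter fun r => m.digit B b r = d).length ≤ m.R) :
    Ex w M (distProg m.k d) s (m.R * 80 + 10) fun s' => Frame m s s' ∧ s'.regs 6 = 2 ^ b ∧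
      s'.regs 7 = (F ++ l.filter fun r => m.digit B b r = d).length ∧
      Holds s' (m.k + 2 * m.R) l ∧
      Holds s' (m.k + 3 * m.R) (F ++ l.filter fun r => m.digit B b r = d) := by
  obtain ⟨hf1, hf2, hf3, hf4, hf5⟩ := id hf
  have hk := hv.k_le_R
  have hk0 := hv.k_pos
  have hR := hv.R_le_n
  refine Ex.seq_of (T₁ := 2) (T₂ := m.R * 80 + 4) (Q₁ := fun s' => s' = s.set 3 0)
    ?_ ?_ (by omega)
  · exact Ex.of_wp hw (by simp [Prog.time, Expr.cost]) (by simp)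
  rintro _ rfl
  refine (Ex.for_loop hw (fun x s' => Frame m s s' ∧ s'.regs 6 = 2 ^ b ∧ s'.regs 3 = x ∧
      s'.regs 7 = (F ++ (l.take x).filter fun r => m.digit B b r = d).length ∧
      Holds s' (m.k + 2 * m.R) l ∧
      Holds s' (m.k + 3 * m.R) (F ++ (l.take x).filter fun r => m.digit B b r = d)) m.R 76
    ?_ ?_ 0 (s.set 3 0) (Nat.zero_le _)
    ⟨(Frame.refl m s).set le_rfl _, by simpa using h6, by simp, by simpa using h7, hA,
      by simpa [Holds] using hF⟩).mono
    (by simp only [Expr.cost]; omega) fun s' ⟨g1, g2, _, g4⟩ => ?_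
  · rintro x s' ⟨g1, g2, g3, g4⟩ hx
    simp [g3, g1.regs 0, h0]
  · rintro x s' ⟨g1, g6, g3, g7, gA, gF⟩ hx
    have hx' : x < l.length := by omega
    obtain ⟨v, hv'⟩ : ∃ v, l[x] = v := ⟨_, rfl⟩
    have hvR : v < m.R := hlR v (hv' ▸ List.getElem_mem hx')
    have hAx : s'.mem (m.k + 2 * m.R + x) = v := by
      rw [gA x hx', List.getD_eq_getElem _ _ hx', hv']
    have hK : s'.mem (m.k + 5 * m.R + v) = m.key B v := by
      rw [g1.mem _ (by omega), hkey v hvR]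
    have hk2 := hkey' v hvR
    have hdiv : m.key B v / 2 ^ b ≤ m.key B v := Nat.div_le_self _ _
    -- The machine has no remainder operation, so the parity is computed by division and
    -- subtraction.
    have hdig : m.key B v / 2 ^ b - m.key B v / 2 ^ b / 2 * 2 = m.digit B b v := by
      unfold Model.digit; omega
    have htake : l.take (x + 1) = l.take x ++ [v] := by rw [List.take_succ_eq_append_getElem hx', hv']
    have hle : F.length + ((l.take (x + 1)).filter fun r => m.digit B b r = d).length ≤ m.R :=
      (Nat.add_le_add_left (((List.take_sublist (x + 1) l).filter _).length_le) _).trans hlen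
    rw [htake] at hle ⊢
    rw [List.filter_append] at hle ⊢
    set F' := (l.take x).filter fun r => m.digit B b r = d with hF'
    rw [List.length_append] at g7
    refine Ex.of_wp hw (by simp [Prog.time, Expr.cost]) ?_
    simp only [Prog.wp, Expr.ok, Expr.val, Op.ok, Op.apply, Expr.arr_ok, Expr.arr_val,
      State.set_regs, State.set_mem, State.store_regs, reduceIte, Nat.reduceEqDiff, g3, g6, g7,
      g1.regs 0 (by norm_num), h0, hAx, hK, hdig, true_and, and_true]
    refine ⟨by omega, by omega, by omega, fun h => ?_, fun h => ⟨by omega,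
      (((g1.set (by norm_num) _).set (by norm_num) _).set (by norm_num) _), ?_⟩⟩
    · have h : m.digit B b v = d := by by_contra hc; simp [hc] at h
      rw [List.filter_singleton, decide_eq_true h, cond_true] at hle ⊢
      rw [List.length_append, List.length_singleton] at hle
      refine ⟨by omega, by omega, by omega, by omega, ((((g1.set (by norm_num) _).set
        (by norm_num) _).store (by omega) (by omega) _).set (by norm_num) _).set (by norm_num) _,
        ?_, fun i hi => ?_, fun i hi => ?_⟩
      · simp; omega
      · simp only [State.set_mem, State.store_mem]
        rw [if_neg (by omega), gA i hi]
      · simp only [State.set_mem, State.store_mem]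
        rw [← List.append_assoc, List.length_append, List.length_append, List.length_singleton] at hi
        rw [← List.append_assoc]
        by_cases hii : i < F.length + F'.length
        · have hii' : i < (F ++ F').length := by rwa [List.length_append]
          rw [if_neg (by omega), gF i hii', List.getD_append _ _ _ _ hii']
        · rw [if_pos (by omega), List.getD_append_right _ _ _ _ (by rw [List.length_append]; omega),
            List.length_append, show i - (F.length + F'.length) = 0 by omega]
          rfl
    · have h : m.digit B b v ≠ d := by intro hc; simp [hc] at h
      rw [List.filter_singleton, decide_eq_false h, cond_false, List.append_nil]
      exact ⟨by rw [List.length_append], gA, gF⟩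
  · rw [List.take_of_length_le hl.le] at g4
    exact ⟨g1, g2, g4⟩

/-- Copies the buffer back. -/
def copyProg (k : ℕ) : Prog :=
  3 ≔ .lit 0 ⨾
  .loop (.reg 3 <ᵉ .reg 0)
    (.put (.arr k 2 (.reg 3)) (.load (.arr k 3 (.reg 3))) ⨾ 3 ≔ .reg 3 +ᵉ .lit 1)

theorem copyProg_spec {w M : ℕ} (hw : 0 < w) {m : Model} (hv : m.Valid) (hf : m.Fits w M)
    {s : State} {l : List ℕ} (h0 : s.regs 0 = m.R) (hl : l.length = m.R)
    (hF : Holds s (m.k + 3 * m.R) l) :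
    Ex w M (copyProg m.k) s (m.R * 40 + 10) fun s' => Frame m s s' ∧ s'.regs 6 = s.regs 6 ∧
      Holds s' (m.k + 2 * m.R) l := by
  obtain ⟨hf1, hf2, hf3, hf4, hf5⟩ := id hf
  have hk := hv.k_le_R
  have hk0 := hv.k_pos
  refine Ex.seq_of (T₁ := 2) (T₂ := m.R * 40 + 4) (Q₁ := fun s' => s' = s.set 3 0)
    ?_ ?_ (by omega)
  · exact Ex.of_wp hw (by simp [Prog.time, Expr.cost]) (by simp)
  rintro _ rfl
  refine (Ex.for_loop hw (fun x s' => Frame m s s' ∧ s'.regs 6 = s.regs 6 ∧ s'.regs 3 = x ∧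
      Holds s' (m.k + 3 * m.R) l ∧ ∀ i < x, s'.mem (m.k + 2 * m.R + i) = l.getD i 0) m.R 36
    ?_ ?_ 0 (s.set 3 0) (Nat.zero_le _)
    ⟨(Frame.refl m s).set le_rfl _, by simp, by simp, hF, by simp⟩).mono
    (by simp only [Expr.cost]; omega) fun s' ⟨g1, g2, _, _, g5⟩ => ⟨g1, g2, fun i hi => g5 i (by omega)⟩
  · rintro x s' ⟨g1, g2, g3, g4⟩ hx
    simp [g3, g1.regs 0, h0]
  · rintro x s' ⟨g1, g6, g3, gF, gA⟩ hx
    refine Ex.of_wp hw (by simp [Prog.time, Expr.cost]) ?_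
    simp only [Prog.wp, Expr.ok, Expr.val, Op.ok, Op.apply, Expr.arr_ok, Expr.arr_val,
      State.set_regs, State.set_mem, State.store_regs, State.store_mem, reduceIte,
      Nat.reduceEqDiff, g3, g6, g1.regs 0 (by norm_num), h0, gF x (by omega), true_and]
    refine ⟨by omega, by omega, by omega, by omega, (g1.store (by omega) (by omega) _).set
      (by norm_num) _, fun i hi => ?_, fun i hi => ?_⟩
    · simp only [State.set_mem, State.store_mem]
      rw [if_neg (by omega), gF i hi]
    · split_ifs with h
      · rw [show i = x by omega]
      · exact gA i (by omega)

/-- Sorts the runs by their keys. -/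
def radixProg (k : ℕ) : Prog :=
  6 ≔ .lit 1 ⨾
  .loop (.reg 6 <ᵉ .lit k *ᵉ .reg 2)
    (7 ≔ .lit 0 ⨾ distProg k 0 ⨾ distProg k 1 ⨾ copyProg k ⨾ 6 ≔ .reg 6 *ᵉ .lit 2)

/-- Before any pass all keys are equal modulo `1` and the identity is sorted. When `2 ^ b` has
reached `k * B`, reduction modulo `2 ^ b` no longer changes a key. -/
theorem radixProg_spec {w M : ℕ} (hw : 0 < w) {m : Model} (hv : m.Valid) (hf : m.Fits w M)
    {s : State} {B : ℕ} (hB : B ≤ m.σ) (hch : ∀ r < m.R, m.key B r < m.k * B)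
    (hs : Tables m B m.R (m.k + 1) s) :
    Ex w M (radixProg m.k) s (Nat.clog 2 (m.k * m.σ) * (m.R * 200 + 60) + 20) fun s' =>
      Frame m s s' ∧ ∃ l, Holds s' (m.k + 2 * m.R) l ∧ l.length = m.R ∧ (∀ v ∈ l, v < m.R) ∧
        l.Pairwise fun u v => m.key B u < m.key B v ∨ (m.key B u = m.key B v ∧ u < v) := by
  obtain ⟨hf1, hf2, hf3, hf4, hf5⟩ := id hf
  have hk := hv.k_le_R
  have hk0 := hv.k_pos
  have hkB : m.k * B ≤ m.k * m.σ := Nat.mul_le_mul_left _ hB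
  have hclog : Nat.clog 2 (m.k * B) ≤ Nat.clog 2 (m.k * m.σ) := Nat.clog_mono_right 2 hkB
  refine Ex.seq_of (T₁ := 2) (T₂ := Nat.clog 2 (m.k * m.σ) * (m.R * 200 + 60) + 6)
    (Q₁ := fun s' => s' = s.set 6 1) ?_ ?_ (by omega)
  · exact Ex.of_wp hw (by simp [Prog.time, Expr.cost]) (by simp; omega)
  rintro _ rfl
  refine (Ex.loop hw (α := ℕ) (fun b s' => Frame m s s' ∧ s'.regs 6 = 2 ^ b ∧ ∃ l,
      Holds s' (m.k + 2 * m.R) l ∧ m.SortedBy B b l)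
    (fun b => (Nat.clog 2 (m.k * B) - b) * (m.R * 200 + 60)) ?_ 0 (s.set 6 1)
    ⟨(Frame.refl m s).set (by norm_num) _, by simp, List.range m.R, fun i hi => ?_, by simp,
      by simp, ?_⟩).mono ?_ fun _ => id
  · rintro b s' ⟨g1, g6, l, gA, gS⟩
    have r0 := (g1.regs 0 (by norm_num)).trans hs.reg0
    have r2 := (g1.regs 2 (by norm_num)).trans hs.reg2
    refine ⟨by simp [r2]; omega, fun hc => ?_, fun hc => ?_⟩
    · simp [g6, r2] at hc
      have hlt : b < Nat.clog 2 (m.k * B) := (Nat.lt_clog_iff_pow_lt one_lt_two).2 hc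
      refine ⟨m.R * 200 + 54, ?_⟩
      obtain ⟨hl, hlR, -⟩ := id gS
      have hkey : ∀ {s'' : State}, Frame m s s'' → ∀ r < m.R,
          s''.mem (m.k + 5 * m.R + r) = m.key B r := fun h r hr => by
        rw [h.mem _ (by omega), hs.key r hr]
      have hkey' : ∀ r < m.R, m.key B r < m.k * m.σ := fun r hr => (hch r hr).trans_le hkB
      have hlen := m.length_pass B b l
      rw [Model.pass, List.length_append, hl] at hlen
      refine Ex.seq_of (T₁ := 2) (T₂ := m.R * 200 + 50) (Q₁ := fun s'' => s'' = s'.set 7 0)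
        ?_ ?_ (by omega)
      · exact Ex.of_wp hw (by simp [Prog.time, Expr.cost]) (by simp)
      rintro _ rfl
      have f1 : Frame m s (s'.set 7 0) := g1.set (by norm_num) _
      refine Ex.seq_of (T₂ := m.R * 120 + 40) (distProg_spec (B := B) (b := b) (l := l) (F := []) hw
        hv hf two_pos (by simpa using r0) (by simpa using g6) (by simp) hl hlR gA
        (fun i hi => absurd hi (Nat.not_lt_zero _)) (hkey f1) hkey' (by simp; omega)) ?_ (by omega)
      rintro s₂ ⟨k1, k6, k7, kA, kF⟩
      have f2 := f1.trans k1
      rw [List.nil_append] at k7 kF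
      refine Ex.seq_of (T₂ := m.R * 40 + 30) (distProg_spec hw hv hf one_lt_two
        ((f2.regs 0 (by norm_num)).trans hs.reg0) k6 k7 hl hlR kA kF (hkey f2) hkey' hlen.le) ?_
        (by omega)
      rintro s₃ ⟨l1, l6, l7, lA, lF⟩
      have f3 := f2.trans l1
      refine Ex.seq_of (T₂ := 10) (copyProg_spec hw hv hf ((f3.regs 0 (by norm_num)).trans hs.reg0)
        (by rw [List.length_append]; exact hlen) lF) ?_ (by omega)
      rintro s₄ ⟨n1, n6, nA⟩
      have hpow : (2 : ℕ) ^ (b + 1) = 2 ^ b * 2 := pow_succ 2 b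
      refine Ex.of_wp hw (by simp [Prog.time, Expr.cost]) ?_
      simp only [Prog.wp, Expr.ok, Expr.val, Op.ok, Op.apply, n6, l6, true_and]
      refine ⟨by omega, b + 1, ⟨(f3.trans n1).set (by norm_num) _, by simp [hpow], _, nA, gS.pass⟩,
        ?_⟩
      obtain ⟨c, hc'⟩ : ∃ c, Nat.clog 2 (m.k * B) = b + 1 + c := ⟨_, (Nat.add_sub_of_le hlt).symm⟩
      rw [hc', show b + 1 + c - b = c + 1 by omega, show b + 1 + c - (b + 1) = c by omega, add_mul]
      simp only [Expr.cost]; omega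
    · simp [g6, r2] at hc
      obtain ⟨hl, hlR, hp⟩ := gS
      refine ⟨g1, l, gA, hl, hlR, hp.imp_of_mem fun {u v} hu hv' h => ?_⟩
      rwa [Nat.mod_eq_of_lt ((hch u (hlR u hu)).trans_le hc),
        Nat.mod_eq_of_lt ((hch v (hlR v hv')).trans_le hc)] at h
  · rw [List.length_range] at hi
    rw [State.set_mem, hs.perm i hi]
    simp [hi]
  · simpa [Nat.mod_one] using List.pairwise_lt_range
  · rw [Nat.sub_zero]
    exact Nat.add_le_add (Nat.mul_le_mul_right _ hclog) (by simp only [Expr.cost]; omega)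

/-- The prefix sums of the lengths of the sorted runs. -/
def prefixProg (k : ℕ) : Prog :=
  (3 ≔ .lit 0 ⨾ 4 ≔ .lit 0) ⨾
  .loop (.reg 3 <ᵉ .reg 0)
    (.put (.arr k 3 (.reg 3)) (.reg 4) ⨾
      4 ≔ .reg 4 +ᵉ .load (.lit (k + 1) +ᵉ .lit 2 *ᵉ .load (.arr k 2 (.reg 3))) ⨾
      3 ≔ .reg 3 +ᵉ .lit 1)

/-- The prefix sums overwrite the buffer of the radix sort, which is no longer needed. -/
theorem prefixProg_spec {w M : ℕ} (hw : 0 < w) {m : Model} (hv : m.Valid) (hf : m.Fits w M)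
    {s : State} {l : List ℕ} (hi : Input m s) (h0 : s.regs 0 = m.R)
    (hA : m.Sorts fun x => l.getD x 0) (hl : l.length = m.R) (hF : Holds s (m.k + 2 * m.R) l) :
    Ex w M (prefixProg m.k) s (m.R * 50 + 10) fun s' => Frame m s s' ∧
      Holds s' (m.k + 2 * m.R) l ∧
      ∀ x < m.R, s'.mem (m.k + 3 * m.R + x) = m.fst (fun x => l.getD x 0) x := by
  obtain ⟨hf1, hf2, hf3, hf4, hf5⟩ := id hf
  have hk := hv.k_le_R
  have hk0 := hv.k_pos
  refine Ex.seq_of (T₁ := 4) (T₂ := m.R * 50 + 4) (Q₁ := fun s' => s' = (s.set 3 0).set 4 0)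
    ?_ ?_ (by omega)
  · exact Ex.of_wp hw (by simp [Prog.time, Expr.cost]) (by simp)
  rintro _ rfl
  refine (Ex.for_loop hw (fun x s' => Frame m s s' ∧ s'.regs 3 = x ∧
      s'.regs 4 = m.fst (fun x => l.getD x 0) x ∧ Holds s' (m.k + 2 * m.R) l ∧
      ∀ i < x, s'.mem (m.k + 3 * m.R + i) = m.fst (fun x => l.getD x 0) i) m.R 46
    ?_ ?_ 0 ((s.set 3 0).set 4 0) (Nat.zero_le _)
    ⟨((Frame.refl m s).set le_rfl _).set (by norm_num) _, by simp, by simp [Model.fst], hF,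
      by simp⟩).mono
    (by simp only [Expr.cost]; omega) fun s' ⟨g1, _, _, g4, g5⟩ => ⟨g1, g4, g5⟩
  · rintro x s' ⟨g1, g2, g3, g4⟩ hx
    simp [g2, g1.regs 0, h0]
  · rintro x s' ⟨g1, g3, g4, gA, gF⟩ hx
    obtain ⟨v, hv'⟩ : ∃ v, l.getD x 0 = v := ⟨_, rfl⟩
    have hvR : v < m.R := hv' ▸ hA.1 x hx
    have hln : s'.mem (m.k + 1 + 2 * v) = m.ln v := by rw [g1.mem _ (by omega), hi.ln v hvR]
    have hfst : m.fst (fun x => l.getD x 0) (x + 1) = m.fst (fun x => l.getD x 0) x + m.ln v := by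
      rw [← hv']; exact Finset.sum_range_succ _ _
    have hle := hv.fst_le hA (x := x + 1) hx
    refine Ex.of_wp hw (by simp [Prog.time, Expr.cost]) ?_
    have e1 : m.k + 2 * m.R + x ≠ m.k + 3 * m.R + x := by omega
    have e2 : m.k + 1 + 2 * v ≠ m.k + 3 * m.R + x := by omega
    simp only [Prog.wp, Expr.ok, Expr.val, Op.ok, Op.apply, Expr.arr_ok, Expr.arr_val,
      State.set_regs, State.set_mem, State.store_regs, State.store_mem, reduceIte,
      Nat.reduceEqDiff, g3, g4, g1.regs 0 (by norm_num), h0, gA x (by omega), hv', if_neg e1,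
      if_neg e2, hln, true_and]
    refine ⟨by omega, by omega, by omega, by omega, ((g1.store (by omega) (by omega) _).set
      (by norm_num) _).set (by norm_num) _, hfst.symm, fun i hi => ?_, fun i hi => ?_⟩
    · simp only [State.set_mem, State.store_mem]
      rw [if_neg (by omega), gA i hi]
    · split_ifs with h
      · rw [show i = x by omega]
      · exact gF i (by omega)

/-! ### The whole program -/

/-- The merging program for `k` collections. -/
def mainProg (k : ℕ) : Prog :=
  countProg k ⨾ boundProg k ⨾ tableProg k ⨾ radixProg k ⨾ prefixProg k ⨾ mergeProg k

/-- The time for the whole program. -/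
noncomputable def Model.mainTime (m : Model) : ℕ :=
  m.k * 90 + m.R * 170 + 100 + Nat.clog 2 (m.k * m.σ) * (m.R * 200 + 60) + m.mergeTime

theorem mainProg_spec {w M : ℕ} (hw : 0 < w) {m : Model} (hv : m.Valid) (hf : m.Fits w M)
    (hcol : ∀ r < m.R, m.col r < m.k) {s : State} (hs : Input m s) :
    Ex w M (mainProg m.k) s m.mainTime fun s' =>
      s'.out = encodeRuns (rle ((List.range m.n).map m.out)) := by
  have hk := hv.k_le_R
  refine Ex.seq_of (T₂ := m.mainTime - (m.k * 20 + 10)) (countProg_spec hw hv hf hs) ?_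
    (by unfold Model.mainTime; omega)
  rintro s₁ ⟨i1, r0⟩
  refine Ex.seq_of (T₂ := m.mainTime - (m.k * 20 + m.R * 40 + 20)) (boundProg_spec hw hv hf i1 r0)
    ?_ (by unfold Model.mainTime; omega)
  rintro s₂ ⟨i2, r0, hB, hch⟩
  obtain ⟨B, hBd⟩ : ∃ B, s₂.regs 2 = B := ⟨_, rfl⟩
  rw [hBd] at hB hch
  refine Ex.seq_of (T₂ := m.mainTime - (m.k * 90 + m.R * 120 + 60))
    (tableProg_spec hw hv hf i2 r0 hBd hB hch) ?_ (by unfold Model.mainTime; omega)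
  rintro s₃ ⟨hT, r1⟩
  have hkey : ∀ r < m.R, m.key B r < m.k * B := by
    intro r hr
    calc m.key B r = m.col r * B + m.ch r := rfl
      _ < m.col r * B + B := Nat.add_lt_add_left (hch r hr) _
      _ = (m.col r + 1) * B := by ring
      _ ≤ m.k * B := Nat.mul_le_mul_right _ (hcol r hr)
  refine Ex.seq_of (T₂ := m.R * 50 + 20 + m.mergeTime) (radixProg_spec hw hv hf hB hkey hT) ?_
    (by unfold Model.mainTime; omega)
  rintro s₄ ⟨f4, l, hH, hl, hlR, hp⟩
  -- As all characters are below `B`, the key `col * B + ch` orders the runs by collection, then by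
  -- character; ties are already in the order of the run numbers.
  have hA : m.Sorts fun x => l.getD x 0 := by
    refine ⟨fun x hx => ?_, fun x y hxy hy => ?_⟩
    · dsimp only
      rw [List.getD_eq_getElem _ _ (by omega)]
      exact hlR _ (List.getElem_mem _)
    · dsimp only
      rw [List.getD_eq_getElem _ _ (by omega), List.getD_eq_getElem _ _ (by omega)]
      have h := List.pairwise_iff_getElem.1 hp x y (by omega) (by omega) hxy
      have h1 := hch _ (hlR _ (List.getElem_mem (show x < l.length by omega)))
      have h2 := hch _ (hlR _ (List.getElem_mem (show y < l.length by omega)))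
      generalize l[x] = u at *
      generalize l[y] = v at *
      unfold Model.key at h
      unfold Model.RunLt
      rcases lt_trichotomy (m.col u) (m.col v) with h3 | h3 | h3
      · exact Or.inl h3
      · rw [h3] at h
        omega
      · have h4 : (m.col v + 1) * B ≤ m.col u * B := Nat.mul_le_mul_right _ h3
        rw [add_mul, one_mul] at h4
        omega
  have i4 : Input m s₄ := hT.input.congr f4.out fun a ha => f4.mem a (Or.inl ha)
  refine Ex.seq_of (T₂ := m.mergeTime) (prefixProg_spec hw hv hf i4
    ((f4.regs 0 (by norm_num)).trans hT.reg0) hA hl hH) ?_ (by omega)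
  rintro s₅ ⟨f5, hH5, hF5⟩
  have f := f4.trans f5
  have i5 : Input m s₅ := i4.congr f5.out fun a ha => f5.mem a (Or.inl ha)
  refine mergeProg_spec hw hv hf hA ⟨(f.regs 0 (by norm_num)).trans hT.reg0,
    (f.regs 1 (by norm_num)).trans r1, i5.ch, i5.ln, fun x hx => hH5 x (by omega), hF5,
    fun r hr => ?_, fun j hj => ?_⟩ i5.out (fun j hj => ?_) fun j hj => ?_
  · rw [f.mem _ (by omega), hT.start r hr]
  · rw [f.mem _ (by omega), hT.ns j (by omega)]
  · rw [f.mem _ (by omega), hT.pos j (by omega)]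
  · rw [f.mem _ (by omega), hT.run j (by omega)]

/-! ### Lists -/

theorem length_flatMap_range {α : Type*} (F : ℕ → List α) (k : ℕ) :
    ((List.range k).flatMap F).length = ∑ i ∈ Finset.range k, (F i).length := by
  induction k with
  | zero => simp
  | succ k ih => rw [List.range_succ, List.flatMap_append, List.length_append, ih,
      Finset.sum_range_succ]; simp

theorem getD_flatMap_range {α : Type*} (F : ℕ → List α) (z : α) {k j d : ℕ} (hj : j < k)
    (hd : d < (F j).length) :
    ((List.range k).flatMap F).getD (∑ i ∈ Finset.range j, (F i).length + d) z =
      (F j).getD d z := by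
  induction k with
  | zero => omega
  | succ k ih =>
    rw [List.range_succ, List.flatMap_append]
    rcases Nat.lt_succ_iff_lt_or_eq.1 hj with h | rfl
    · rw [List.getD_append _ _ _ _ ?_, ih h]
      rw [length_flatMap_range]
      have := Finset.sum_range_le_of_le (f := fun i => (F i).length) (a := j + 1) (b := k) h
      rw [Finset.sum_range_succ] at this
      omega
    · rw [List.getD_append_right _ _ _ _ (by rw [length_flatMap_range]; omega),
        length_flatMap_range, Nat.add_sub_cancel_left]
      simp

theorem exists_block (f : ℕ → ℕ) {k p : ℕ} (h : p < ∑ i ∈ Finset.range k, f i) :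
    ∃ j < k, ∃ d < f j, p = ∑ i ∈ Finset.range j, f i + d := by
  induction k with
  | zero => simp at h
  | succ k ih =>
    rcases lt_or_ge p (∑ i ∈ Finset.range k, f i) with h' | h'
    · obtain ⟨j, hj, d, hd⟩ := ih h'
      exact ⟨j, by omega, d, hd⟩
    · rw [Finset.sum_range_succ] at h
      exact ⟨k, by omega, p - ∑ i ∈ Finset.range k, f i, by omega, by omega⟩

theorem map_range_getD {α : Type*} (l : List α) (z : α) :
    (List.range l.length).map (fun i => l.getD i z) = l := by
  apply List.ext_getElem (by simp)
  intro i h1 h2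
  simp [h2]

theorem length_filter_range (p : ℕ → Prop) [DecidablePred p] (t : ℕ) :
    ((List.range t).filter fun i => p i).length = ((Finset.range t).filter p).card := by
  induction t with
  | zero => simp
  | succ t ih =>
    rw [List.range_succ, List.filter_append, List.length_append, ih, Finset.range_add_one,
      Finset.filter_insert]
    by_cases h : p t <;> simp [h]

theorem getD_filter_range (p : ℕ → Prop) [DecidablePred p] {n t : ℕ} (ht : t < n) (hp : p t)
    (z : ℕ) :
    ((List.range n).filter fun i => p i).getD ((Finset.range t).filter p).card z = t := by
  obtain ⟨r, rfl⟩ := Nat.exists_eq_add_of_lt ht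
  rw [add_assoc, List.range_add, List.filter_append, ← length_filter_range,
    List.getD_append_right _ _ _ _ le_rfl, Nat.sub_self, add_comm r, Nat.add_comm 1 r,
    List.range_succ_eq_map]
  simp [hp]

theorem expand_rle (l : List ℕ) : (rle l).flatMap (fun r => List.replicate r.2 r.1) = l := by
  induction l with
  | nil => rfl
  | cons a l ih =>
    rw [rle]
    conv_rhs => rw [← ih]
    rcases rle l with _ | ⟨⟨b, m⟩, r⟩
    · rfl
    · dsimp only
      split_ifs with h
      · simp [h, List.replicate_succ]
      · simp

theorem pos_of_mem_rle {l : List ℕ} {r : ℕ × ℕ} (h : r ∈ rle l) : 0 < r.2 := by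
  induction l generalizing r with
  | nil => simp [rle] at h
  | cons a l ih =>
    rw [rle] at h
    rcases hl : rle l with _ | ⟨⟨b, m⟩, t⟩
    · rw [hl] at h
      simp at h; simp [h]
    · rw [hl] at h ih
      dsimp only at h
      split_ifs at h
      · rcases List.mem_cons.1 h with rfl | h
        · simp
        · exact ih (by simp [h])
      · rcases List.mem_cons.1 h with rfl | h
        · simp
        · exact ih h

/-- Insertion sort evaluates the relation only on an earlier and a later element of its input, in
this order. This allows adding a tie-break that the input order already satisfies. -/
theorem insertionSort_congr {α : Type*} {r r' : α → α → Prop} [DecidableRel r] [DecidableRel r']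
    {l : List α} (h : l.Pairwise fun a b => r a b ↔ r' a b) :
    l.insertionSort r = l.insertionSort r' := by
  have key : ∀ (a : α) (l : List α), (∀ b ∈ l, r a b ↔ r' a b) →
      l.orderedInsert r a = l.orderedInsert r' a := by
    intro a l hl
    induction l with
    | nil => rfl
    | cons b l ih =>
      simp only [List.orderedInsert, hl b (by simp), ih fun c hc => hl c (by simp [hc])]
  induction l with
  | nil => rfl
  | cons a l ih =>
    rw [List.pairwise_cons] at h
    rw [List.insertionSort_cons, List.insertionSort_cons, ih h.2, key]
    intro b hb
    exact h.1 b ((List.mem_insertionSort r').1 hb)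

theorem eq_of_perm_of_pairwise_le {α : Type*} [PartialOrder α] {l l' : List α} (hp : l.Perm l')
    (h : l.Pairwise (· ≤ ·)) (h' : l'.Pairwise (· ≤ ·)) : l = l' :=
  hp.eq_of_pairwise' h h'

theorem sum_zip_tail {α M : Type*} [AddCommMonoid M] (f : α → α → M) (l : List α) (z : α) :
    ((l.zip l.tail).map fun p => f p.1 p.2).sum =
      ∑ t ∈ Finset.range (l.length - 1), f (l.getD t z) (l.getD (t + 1) z) := by
  induction l with
  | nil => simp
  | cons a l ih =>
    cases l with
    | nil => simp
    | cons b l =>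
      have h : (a :: b :: l).zip (a :: b :: l).tail = (a, b) :: (b :: l).zip (b :: l).tail := rfl
      rw [h, List.map_cons, List.sum_cons, ih]
      simp only [List.length_cons, Nat.add_sub_cancel]
      rw [Finset.sum_range_succ', add_comm]
      rfl

/-! ### Strings -/

/-- The infinite string with the first character `c` and the remainder `x`. -/
def consStr (c : ℕ) (x : ℕ → ℕ) : ℕ → ℕ
  | 0 => c
  | t + 1 => x t

/-- The character of an occurrence, followed by its context. -/
def Occ.full (o : Occ) : ℕ → ℕ := consStr o.char o.ctx

theorem consStr_le_of_lt {c c' : ℕ} (h : c < c') (x y : ℕ → ℕ) :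
    toLex (consStr c x) ≤ toLex (consStr c' y) :=
  le_of_lt (show LexLt _ _ from ⟨0, by simp, h⟩)

theorem consStr_le_of_le {c : ℕ} {x y : ℕ → ℕ} (h : toLex x ≤ toLex y) :
    toLex (consStr c x) ≤ toLex (consStr c y) := by
  rcases h.lt_or_eq with h | h
  · obtain ⟨m, h1, h2⟩ : LexLt x y := h
    refine le_of_lt (show LexLt _ _ from ⟨m + 1, fun i hi => ?_, h2⟩)
    cases i with
    | zero => rfl
    | succ i => exact h1 i (by omega)
  · rw [toLex_inj.1 h]

theorem full_occAt {u : List ℕ} {i : ℕ} (hi : i < u.length) :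
    (occAt u i).full = fun t => u.getD ((i + t) % u.length) 0 := by
  funext t
  cases t with
  | zero => simp [Occ.full, consStr, occAt, Nat.mod_eq_of_lt hi]
  | succ t => simp only [Occ.full, consStr, occAt]; congr 2; ring

/-- The context of the character `i` is the rotation from `i + 1`, and `full` is the rotation from
`i`: the two lists differ by a cyclic shift. -/
theorem perm_rotations (u : List ℕ) :
    ((List.range u.length).map fun i => (occAt u i).ctx).Perm
      ((List.range u.length).map fun i => (occAt u i).full) := by
  have h1 : (List.range u.length).map (fun i => (occAt u i).full) =
      (List.range u.length).map fun i t => u.getD ((i + t) % u.length) 0 :=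
    List.map_congr_left fun i hi => full_occAt (List.mem_range.1 hi)
  rw [h1]
  obtain ⟨m, hm⟩ : ∃ m, u.length = m := ⟨_, rfl⟩
  rw [hm]
  cases m with
  | zero => simp
  | succ m =>
    conv_rhs => rw [List.range_succ_eq_map]
    rw [List.range_succ, List.map_append]
    refine List.perm_append_comm.trans (List.Perm.of_eq ?_)
    simp only [List.map_cons, List.map_nil, List.singleton_append, occAt, hm, List.map_map]
    congr 1
    funext t
    rw [Nat.add_mod_left, Nat.zero_add]

theorem perm_occs (S : List (List ℕ)) : ((occs S).map Occ.ctx).Perm ((occs S).map Occ.full) := by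
  simp only [occs, List.map_flatMap, List.map_map]
  exact List.Perm.flatMap_left _ fun u _ => perm_rotations u

theorem mem_occs {S : List (List ℕ)} {o : Occ} (h : o ∈ occs S) :
    ∃ u ∈ S, ∃ i < u.length, o = occAt u i := by
  simp only [occs, List.mem_flatMap, List.mem_map, List.mem_range] at h
  obtain ⟨u, hu, i, hi, rfl⟩ := h
  exact ⟨u, hu, i, hi, rfl⟩

theorem length_occs (S : List (List ℕ)) : (occs S).length = (S.map List.length).sum := by
  simp [occs, List.length_flatMap]

theorem ctx_occAt_add_mul (u : List ℕ) (i t a : ℕ) :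
    (occAt u i).ctx (t + u.length * a) = (occAt u i).ctx t := by
  simp only [occAt, ← add_assoc, Nat.add_mul_mod_self_left]

/-- Index `N - 1` of the context lies `N` places after the character itself, and `N` is a multiple
of the period. -/
theorem char_occAt {u : List ℕ} {i N : ℕ} (hi : i < u.length) (hN : u.length ∣ N) (h0 : 0 < N) :
    (occAt u i).char = (occAt u i).ctx (N - 1) := by
  obtain ⟨a, rfl⟩ := hN
  simp only [occAt]
  have : i + 1 + (u.length * a - 1) = i + u.length * a := by omega
  rw [this, Nat.add_mul_mod_self_left, Nat.mod_eq_of_lt hi]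

theorem pairwise_sortedOccs (S : List (List ℕ)) :
    (sortedOccs S).Pairwise fun a b => toLex a.ctx ≤ toLex b.ctx := by
  have h1 : Std.Total fun a b : Occ => toLex a.ctx ≤ toLex b.ctx := ⟨fun _ _ => le_total _ _⟩
  have h2 : IsTrans Occ fun a b => toLex a.ctx ≤ toLex b.ctx := ⟨fun _ _ _ => le_trans⟩
  exact List.pairwise_insertionSort _ _

theorem perm_sortedOccs (S : List (List ℕ)) : (sortedOccs S).Perm (occs S) :=
  List.perm_insertionSort _ _

theorem length_rlbwt (S : List (List ℕ)) :
    ((rlbwt S).map Prod.snd).sum = (sortedOccs S).length := by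
  rw [rlbwt, sum_rle, eBWT, List.length_map]

theorem flatMap_range_add (f : ℕ → ℕ) (k : ℕ) :
    (List.range k).flatMap (fun r => (List.range (f r)).map (∑ i ∈ Finset.range r, f i + ·)) =
      List.range (∑ i ∈ Finset.range k, f i) := by
  induction k with
  | zero => simp
  | succ k ih =>
    rw [List.range_succ, List.flatMap_append, ih, Finset.sum_range_succ, List.range_add]
    simp

theorem Model.Sorts.perm {m : Model} {A : ℕ → ℕ} (hA : m.Sorts A) :
    ((List.range m.R).map A).Perm (List.range m.R) := by
  refine (List.subperm_of_subset ?_ ?_).perm_of_length_le (by simp)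
  · rw [List.nodup_iff_pairwise_ne, List.pairwise_map, List.pairwise_iff_getElem]
    intro i j hi hj hij h
    simp only [List.length_range] at hi hj
    have := hA.2 i j hij hj
    simp only [List.getElem_range] at h
    rw [h] at this
    unfold RunLt at this
    omega
  · intro r hr
    obtain ⟨x, hx, rfl⟩ := List.mem_map.1 hr
    exact List.mem_range.2 (hA.1 x (List.mem_range.1 hx))

/-- The permutation that sorts the positions by their characters turns the sorted contexts into
the sorted extended contexts. -/
theorem Model.first_last (m : Model) (lc lch : ℕ → ℕ) (hR : m.start m.R = m.n)
    (h1 : ∀ p q, p < q → q < m.n → lc p < lc q ∨ lc p = lc q ∧ toLex (m.X p) ≤ toLex (m.X q))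
    (h2 : ((List.range m.n).map fun p => (lc p, m.X p)).Perm
      ((List.range m.n).map fun p => (lc p, consStr (lch p) (m.X p))))
    (h3 : ∀ r < m.R, ∀ d < m.ln r, lc (m.start r + d) = m.col r ∧ lch (m.start r + d) = m.ch r)
    {A : ℕ → ℕ} (hA : m.Sorts A) :
    m.fst A m.R = m.n ∧ ∀ x < m.R, ∀ d < m.ln (A x),
      m.X (m.fst A x + d) = consStr (m.ch (A x)) (m.X (m.start (A x) + d)) := by
  set F : ℕ → List ℕ := fun x => (List.range (m.ln (A x))).map (m.start (A x) + ·) with hF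
  obtain ⟨l, hl⟩ : ∃ l, (List.range m.R).flatMap F = l := ⟨_, rfl⟩
  have hlp : l.Perm (List.range m.n) := by
    rw [← hl, ← hR, Model.start, ← flatMap_range_add]
    have := hA.perm.flatMap_right fun r => (List.range (m.ln r)).map (m.start r + ·)
    rw [List.flatMap_map] at this
    exact this
  have hlen : m.fst A m.R = m.n := by
    have := hlp.length_eq
    rw [← hl, length_flatMap_range] at this
    simp only [hF, List.length_map, List.length_range] at this
    exact this
  have hstart : ∀ r < m.R, m.start r + m.ln r ≤ m.n := by
    intro r hr
    rw [← hR, Model.start, ← Finset.sum_range_succ]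
    exact Finset.sum_range_le_of_le (by omega)
  refine ⟨hlen, fun x hx d hd => ?_⟩
  -- The lists of `f` and `g` are permutations of each other and both sorted, hence equal; comparing
  -- entries gives the claim. The first component keeps the collections apart.
  let f : ℕ → ℕ ×ₗ Lex (ℕ → ℕ) := fun p => toLex (lc p, toLex (m.X p))
  let g : ℕ → ℕ ×ₗ Lex (ℕ → ℕ) := fun p => toLex (lc p, toLex (consStr (lch p) (m.X p)))
  have hfg : (List.range m.n).map f = l.map g := by
    refine eq_of_perm_of_pairwise_le ?_ ?_ ?_
    · have := h2.map fun q => (toLex (q.1, toLex q.2) : ℕ ×ₗ Lex (ℕ → ℕ))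
      rw [List.map_map, List.map_map] at this
      exact this.trans (hlp.map g).symm
    · rw [List.pairwise_map, List.pairwise_iff_getElem]
      intro i j hi hj hij
      rw [List.length_range] at hi hj
      rw [List.getElem_range, List.getElem_range]
      exact Prod.Lex.toLex_le_toLex.2 (h1 i j hij hj)
    -- Prepending characters decides the order if they differ and preserves it if they agree; this
    -- is why the runs are sorted by character, with ties in position order.
    · have hg : ∀ r < m.R, ∀ d < m.ln r, ∀ r' < m.R, ∀ d' < m.ln r', (m.col r < m.col r' ∨
          m.col r = m.col r' ∧ (m.ch r < m.ch r' ∨ m.ch r = m.ch r' ∧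
            m.start r + d < m.start r' + d')) → g (m.start r + d) ≤ g (m.start r' + d') := by
        intro r hr d hd r' hr' d' hd' h
        refine Prod.Lex.toLex_le_toLex.2 ?_
        rw [(h3 r hr d hd).1, (h3 r hr d hd).2, (h3 r' hr' d' hd').1, (h3 r' hr' d' hd').2]
        refine h.imp id fun ⟨h4, h5⟩ => ⟨h4, ?_⟩
        rcases h5 with h5 | ⟨h5, h6⟩
        · exact consStr_le_of_lt h5 _ _
        · rw [h5]
          refine consStr_le_of_le ?_
          rcases h1 _ _ h6 (by have := hstart r' hr'; omega) with h7 | h7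
          · rw [(h3 r hr d hd).1, (h3 r' hr' d' hd').1] at h7; omega
          · exact h7.2
      rw [List.pairwise_map, ← hl, List.pairwise_flatMap]
      constructor
      · intro y hy
        rw [hF, List.pairwise_map, List.pairwise_iff_getElem]
        intro i j hi hj hij
        rw [List.length_range] at hi hj
        rw [List.getElem_range, List.getElem_range]
        have hy' := hA.1 y (List.mem_range.1 hy)
        exact hg _ hy' _ hi _ hy' _ hj (Or.inr ⟨rfl, Or.inr ⟨rfl, by omega⟩⟩)
      · rw [List.pairwise_iff_getElem]
        intro i j hi hj hij p hp q hq
        rw [List.length_range] at hi hj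
        simp only [List.getElem_range, hF, List.mem_map, List.mem_range] at hp hq
        obtain ⟨e, he, rfl⟩ := hp
        obtain ⟨e', he', rfl⟩ := hq
        refine hg _ (hA.1 i hi) _ he _ (hA.1 j hj) _ he' ?_
        have h4 := hA.2 i j hij hj
        unfold RunLt at h4
        refine h4.imp id fun h5 => ⟨h5.1, h5.2.imp id fun h6 => ⟨h6.1, ?_⟩⟩
        have := Finset.sum_range_le_of_le (f := m.ln) (a := A i + 1) (b := A j) h6.2
        rw [Finset.sum_range_succ] at this
        unfold start
        omega
  have hi : m.fst A x + d < m.n := by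
    rw [← hlen]
    have := Finset.sum_range_le_of_le (f := fun i => m.ln (A i)) (a := x + 1) (b := m.R) hx
    rw [Finset.sum_range_succ] at this
    unfold fst
    omega
  have h4 : l.getD (m.fst A x + d) 0 = m.start (A x) + d := by
    rw [← hl]
    have := getD_flatMap_range F 0 hx (d := d) (by simpa [hF] using hd)
    simp only [hF, List.length_map, List.length_range] at this
    rw [show m.fst A x = ∑ i ∈ Finset.range x, m.ln (A i) from rfl, hF, this]
    simp [hd]
  have h5 := congrArg (fun l => l.getD (m.fst A x + d) (g 0)) hfg
  simp only [List.getD_map, h4] at h5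
  rw [List.getD_eq_getElem _ _ (by simpa using hi)] at h5
  simp only [List.getElem_map, List.getElem_range] at h5
  have h6 := congrArg (fun z => ofLex (ofLex z).2) h5
  have h7 : m.X (m.fst A x + d) = consStr (lch (m.start (A x) + d)) (m.X (m.start (A x) + d)) := h6
  rw [h7, (h3 _ (hA.1 x hx) d hd).2]

/-! ### The merging problem of collections of strings -/

/-- The occurrences in each collection, sorted by context, with the numbers of the collections. -/
noncomputable def sortedList (k : ℕ) (T : ℕ → List (List ℕ)) : List (ℕ × Occ) :=
  (List.range k).flatMap fun j => (sortedOccs (T j)).map (Prod.mk j)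

/-- The runs of all the collections, with the numbers of the collections. -/
noncomputable def runList (k : ℕ) (T : ℕ → List (List ℕ)) : List (ℕ × ℕ × ℕ) :=
  (List.range k).flatMap fun j => (rlbwt (T j)).map (Prod.mk j)

open Classical in
/-- The occurrences in all the collections, sorted by context. -/
noncomputable def mergedList (k : ℕ) (T : ℕ → List (List ℕ)) : List (ℕ × Occ) :=
  ((List.range k).flatMap fun j => (occs (T j)).map (Prod.mk j)).insertionSort
    fun a b => toLex a.2.ctx ≤ toLex b.2.ctx

/-- A default value. -/
def noOcc : ℕ × Occ := (0, ⟨0, fun _ => 0⟩)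

/-- The merging problem of the collections `T 0, …, T (k - 1)`. -/
noncomputable def stringModel (k σ : ℕ) (T : ℕ → List (List ℕ)) : Model where
  k := k
  n := ∑ j ∈ Finset.range k, (occs (T j)).length
  R := ∑ j ∈ Finset.range k, (rlbwt (T j)).length
  σ := σ
  cnt := fun j => (rlbwt (T j)).length
  ch := fun r => ((runList k T).getD r 0).2.1
  ln := fun r => ((runList k T).getD r 0).2.2
  col := fun r => ((runList k T).getD r 0).1
  X := fun p => ((sortedList k T).getD p noOcc).2.ctx
  lab := fun t => ((mergedList k T).getD t noOcc).1
  out := fun t => ((mergedList k T).getD t noOcc).2.char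

section

variable {k σ : ℕ} {T : ℕ → List (List ℕ)}

theorem length_sortedOccs (S : List (List ℕ)) : (sortedOccs S).length = (occs S).length :=
  (perm_sortedOccs S).length_eq

theorem length_runList : (runList k T).length = (stringModel k σ T).R := by
  rw [runList, length_flatMap_range]; simp [stringModel]

theorem length_sortedList : (sortedList k T).length = (stringModel k σ T).n := by
  rw [sortedList, length_flatMap_range]; simp [stringModel, length_sortedOccs]

theorem perm_mergedList : (mergedList k T).Perm (sortedList k T) :=
  (List.perm_insertionSort _ _).trans
    (List.Perm.flatMap_left _ fun _ _ => (perm_sortedOccs _).symm.map _)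

theorem length_mergedList : (mergedList k T).length = (stringModel k σ T).n :=
  perm_mergedList.length_eq.trans length_sortedList

theorem getD_runList {j d : ℕ} (hj : j < k) (hd : d < (rlbwt (T j)).length) :
    (runList k T).getD ((stringModel k σ T).off j + d) 0 = (j, (rlbwt (T j))[d]) := by
  have := getD_flatMap_range (fun j => (rlbwt (T j)).map (Prod.mk j)) 0 hj (d := d) (by simpa)
  simp only [List.length_map] at this
  rw [runList, Model.off]
  refine this.trans ?_
  simp [hd]

theorem ns_stringModel {j : ℕ} (hj : j ≤ k) :
    (stringModel k σ T).ns j = ∑ i ∈ Finset.range j, (sortedOccs (T i)).length := by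
  induction j with
  | zero => simp [Model.ns, Model.off, Model.start]
  | succ j ih =>
    have h1 : (stringModel k σ T).off (j + 1) =
        (stringModel k σ T).off j + (rlbwt (T j)).length := Finset.sum_range_succ _ _
    rw [Finset.sum_range_succ, ← ih (by omega), Model.ns, h1, Model.start, Finset.sum_range_add,
      ← length_rlbwt, Model.ns, Model.start]
    congr 1
    conv_rhs => rw [← map_range_getD (rlbwt (T j)) 0, List.map_map]
    change _ = ∑ x ∈ Finset.range (rlbwt (T j)).length, _
    refine Finset.sum_congr rfl fun d hd => ?_
    have hd := Finset.mem_range.1 hd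
    change ((runList k T).getD _ 0).2.2 = _
    rw [getD_runList hj hd]
    simp [hd]

theorem getD_sortedList {j d : ℕ} (hj : j < k) (hd : d < (sortedOccs (T j)).length) :
    (sortedList k T).getD ((stringModel k σ T).ns j + d) noOcc = (j, (sortedOccs (T j))[d]) := by
  have := getD_flatMap_range (fun j => (sortedOccs (T j)).map (Prod.mk j)) noOcc hj (d := d)
    (by simpa)
  simp only [List.length_map] at this
  rw [ns_stringModel hj.le, sortedList]
  refine this.trans ?_
  simp [hd]

theorem map_char_sortedList :
    (sortedList k T).map (fun p => (p.1, p.2.char)) =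
      (List.range (stringModel k σ T).R).flatMap fun r =>
        List.replicate ((stringModel k σ T).ln r)
          ((stringModel k σ T).col r, (stringModel k σ T).ch r) := by
  have h1 : (List.range (stringModel k σ T).R).flatMap (fun r =>
        List.replicate ((stringModel k σ T).ln r)
          ((stringModel k σ T).col r, (stringModel k σ T).ch r)) =
      (runList k T).flatMap fun r => List.replicate r.2.2 (r.1, r.2.1) := by
    conv_rhs => rw [← map_range_getD (runList k T) 0, List.flatMap_map, length_runList (σ := σ)]
    rfl
  rw [h1, runList, sortedList, List.map_flatMap, List.flatMap_assoc]
  congr 1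
  funext j
  rw [List.flatMap_map, List.map_map]
  have h2 := congrArg (List.map (Prod.mk j)) (expand_rle (eBWT (T j)))
  rw [List.map_flatMap] at h2
  simp only [List.map_replicate] at h2
  rw [rlbwt, h2, eBWT, List.map_map]
  rfl

theorem getD_sortedList_start {r d : ℕ} (hr : r < (stringModel k σ T).R)
    (hd : d < (stringModel k σ T).ln r) :
    ((sortedList k T).getD ((stringModel k σ T).start r + d) noOcc).1 =
      (stringModel k σ T).col r ∧
    ((sortedList k T).getD ((stringModel k σ T).start r + d) noOcc).2.char =
      (stringModel k σ T).ch r := by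
  have h := congrArg (fun l => l.getD ((stringModel k σ T).start r + d)
    ((fun p : ℕ × Occ => (p.1, p.2.char)) noOcc)) (map_char_sortedList (k := k) (σ := σ) (T := T))
  dsimp only at h
  have h2 := getD_flatMap_range (fun r => List.replicate ((stringModel k σ T).ln r)
          ((stringModel k σ T).col r, (stringModel k σ T).ch r))
          ((fun p : ℕ × Occ => (p.1, p.2.char)) noOcc) hr (d := d) (by simpa)
  simp only [List.length_replicate] at h2
  rw [List.getD_map (f := fun p : ℕ × Occ => (p.1, p.2.char)), Model.start, h2] at h
  simp only [List.getD_replicate _ hd] at h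
  rw [Model.start]
  exact ⟨congrArg Prod.fst h, congrArg Prod.snd h⟩

theorem mem_sortedList {x : ℕ × Occ} (h : x ∈ sortedList k T) :
    x.1 < k ∧ ∃ u ∈ T x.1, ∃ i < u.length, x.2 = occAt u i ∧
      u.length ≤ (stringModel k σ T).n := by
  simp only [sortedList, List.mem_flatMap, List.mem_range, List.mem_map] at h
  obtain ⟨j, hj, o, ho, rfl⟩ := h
  obtain ⟨u, hu, i, hi, rfl⟩ := mem_occs ((perm_sortedOccs _).mem_iff.1 ho)
  refine ⟨hj, u, hu, i, hi, rfl, ?_⟩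
  calc u.length ≤ ((T j).map List.length).sum :=
        List.le_sum_of_mem (List.mem_map_of_mem hu)
    _ = (occs (T j)).length := (length_occs _).symm
    _ ≤ _ := Finset.single_le_sum (f := fun j => (occs (T j)).length) (fun _ _ => Nat.zero_le _)
        (Finset.mem_range.2 hj)

theorem getD_mem {α : Type*} {l : List α} {i : ℕ} (h : i < l.length) (z : α) : l.getD i z ∈ l := by
  rw [List.getD_eq_getElem _ _ h]; exact List.getElem_mem _

/-- The character of an occurrence is determined by its context. -/
theorem char_eq_of_mem {x : ℕ × Occ} (h : x ∈ sortedList k T) :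
    x.2.char = x.2.ctx ((stringModel k σ T).n.factorial - 1) := by
  obtain ⟨_, u, hu, i, hi, hx, hn⟩ := mem_sortedList (σ := σ) h
  rw [hx]
  exact char_occAt hi (Nat.dvd_factorial (by omega) hn) (Nat.factorial_pos _)

/-- The sort is stable and its input is listed by collection, so ties come out in the order of the
collection numbers, as `Model.Less` demands. -/
theorem pairwise_mergedList : (mergedList k T).Pairwise fun a b =>
    toLex a.2.ctx < toLex b.2.ctx ∨ toLex a.2.ctx = toLex b.2.ctx ∧ a.1 ≤ b.1 := by
  classical
  have h1 : Std.Total fun a b : ℕ × Occ =>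
      toLex a.2.ctx < toLex b.2.ctx ∨ toLex a.2.ctx = toLex b.2.ctx ∧ a.1 ≤ b.1 :=
    ⟨fun a b => by
      rcases lt_trichotomy (toLex a.2.ctx) (toLex b.2.ctx) with h | h | h
      · exact Or.inl (Or.inl h)
      · rcases le_total a.1 b.1 with h' | h'
        · exact Or.inl (Or.inr ⟨h, h'⟩)
        · exact Or.inr (Or.inr ⟨h.symm, h'⟩)
      · exact Or.inr (Or.inl h)⟩
  have h2 : IsTrans (ℕ × Occ) fun a b : ℕ × Occ =>
      toLex a.2.ctx < toLex b.2.ctx ∨ toLex a.2.ctx = toLex b.2.ctx ∧ a.1 ≤ b.1 :=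
    ⟨fun a b c h h' => by
      rcases h with h | ⟨h, g⟩ <;> rcases h' with h' | ⟨h', g'⟩
      · exact Or.inl (h.trans h')
      · exact Or.inl (h' ▸ h)
      · exact Or.inl (h.symm ▸ h')
      · exact Or.inr ⟨h.trans h', g.trans g'⟩⟩
  rw [mergedList, insertionSort_congr (r' := fun a b : ℕ × Occ =>
      toLex a.2.ctx < toLex b.2.ctx ∨ toLex a.2.ctx = toLex b.2.ctx ∧ a.1 ≤ b.1)]
  · exact List.pairwise_insertionSort _ _
  · have key : ∀ a b : ℕ × Occ, a.1 ≤ b.1 → (toLex a.2.ctx ≤ toLex b.2.ctx ↔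
        toLex a.2.ctx < toLex b.2.ctx ∨ toLex a.2.ctx = toLex b.2.ctx ∧ a.1 ≤ b.1) := by
      intro a b h
      rw [le_iff_lt_or_eq]
      tauto
    refine List.Pairwise.imp (fun {a b} h => key a b h) ?_
    rw [List.pairwise_flatMap]
    constructor
    · intro j _
      rw [List.pairwise_map]
      exact List.pairwise_of_forall fun _ _ => le_rfl
    · refine List.pairwise_lt_range.imp fun {i j} hij a ha b hb => ?_
      obtain ⟨_, _, rfl⟩ := List.mem_map.1 ha
      obtain ⟨_, _, rfl⟩ := List.mem_map.1 hb
      exact hij.le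

theorem pairwise_sortedList : (sortedList k T).Pairwise fun a b =>
    a.1 < b.1 ∨ a.1 = b.1 ∧ toLex a.2.ctx ≤ toLex b.2.ctx := by
  rw [sortedList, List.pairwise_flatMap]
  constructor
  · intro j _
    rw [List.pairwise_map]
    exact (pairwise_sortedOccs _).imp fun h => Or.inr ⟨rfl, h⟩
  · refine List.pairwise_lt_range.imp fun {i j} hij a ha b hb => ?_
    obtain ⟨_, _, rfl⟩ := List.mem_map.1 ha
    obtain ⟨_, _, rfl⟩ := List.mem_map.1 hb
    exact Or.inl hij

theorem perm_full_sortedList : ((sortedList k T).map fun p => (p.1, p.2.ctx)).Perm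
    ((sortedList k T).map fun p => (p.1, p.2.full)) := by
  rw [sortedList, List.map_flatMap, List.map_flatMap]
  refine List.Perm.flatMap_left _ fun j _ => ?_
  rw [List.map_map, List.map_map]
  have h : ((sortedOccs (T j)).map Occ.ctx).Perm ((sortedOccs (T j)).map Occ.full) :=
    ((perm_sortedOccs _).map _).trans ((perm_occs _).trans ((perm_sortedOccs _).map _).symm)
  have := h.map (Prod.mk j)
  rw [List.map_map, List.map_map] at this
  exact this

/-- The occurrences from one collection appear in the merged order in their own order. -/
theorem filter_mergedList {a : ℕ} (ha : a < k) :
    ((mergedList k T).filter fun p => p.1 = a).map (fun p => toLex p.2.ctx) =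
      (sortedOccs (T a)).map fun o => toLex o.ctx := by
  -- Only contexts are compared: occurrences with equal contexts may be listed in different orders.
  refine eq_of_perm_of_pairwise_le ?_ ?_ ?_
  · have h : (sortedList k T).filter (fun p => p.1 = a) = (sortedOccs (T a)).map (Prod.mk a) := by
      rw [sortedList, List.filter_flatMap]
      have h2 : ∀ j ∈ List.range k,
          ((sortedOccs (T j)).map (Prod.mk j)).filter (fun p => decide (p.1 = a)) =
            if j = a then (sortedOccs (T a)).map (Prod.mk a) else [] := by
        intro j _
        split_ifs with h
        · subst h
          exact List.filter_eq_self.2 fun p hp => by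
            obtain ⟨_, _, rfl⟩ := List.mem_map.1 hp; simp
        · exact List.filter_eq_nil_iff.2 fun p hp => by
            obtain ⟨_, _, rfl⟩ := List.mem_map.1 hp; simpa using h
      rw [List.flatMap_congr h2]
      clear h2
      induction k with
      | zero => omega
      | succ k ih =>
        rw [List.range_succ, List.flatMap_append]
        rcases Nat.lt_succ_iff_lt_or_eq.1 ha with h | rfl
        · rw [ih h]; simp [h.ne']
        · have : (List.range a).flatMap (fun j =>
              if j = a then (sortedOccs (T a)).map (Prod.mk a) else []) = [] := by
            rw [List.flatMap_eq_nil_iff]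
            intro j hj
            rw [if_neg (List.mem_range.1 hj).ne]
          rw [this]; simp
    have h3 := ((perm_mergedList (k := k) (T := T)).filter fun p => decide (p.1 = a)).map
      fun p => toLex p.2.ctx
    rw [h, List.map_map] at h3
    exact h3
  · rw [List.pairwise_map]
    refine (pairwise_mergedList.sublist List.filter_sublist).imp fun h => ?_
    exact h.elim le_of_lt fun h => h.1.le
  · rw [List.pairwise_map]
    exact pairwise_sortedOccs _

theorem filter_mergedList_eq_map (a : ℕ) : ((mergedList k T).filter fun p => p.1 = a) =
    ((List.range (stringModel k σ T).n).filter fun t => (stringModel k σ T).lab t = a).map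
      fun t => (mergedList k T).getD t noOcc := by
  conv_lhs => rw [← map_range_getD (mergedList k T) noOcc, List.filter_map, length_mergedList (σ := σ)]
  rfl

theorem before_n_stringModel {a : ℕ} (ha : a < k) :
    (stringModel k σ T).before a (stringModel k σ T).n = (sortedOccs (T a)).length := by
  have h := congrArg List.length (filter_mergedList (T := T) ha)
  rw [filter_mergedList_eq_map (σ := σ), List.length_map, List.length_map, List.length_map,
    length_filter_range] at h
  exact h

theorem lab_lt_stringModel {t : ℕ} (ht : t < (stringModel k σ T).n) :
    (stringModel k σ T).lab t < k :=
  (mem_sortedList (σ := σ) (perm_mergedList.mem_iff.1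
    (getD_mem (by rwa [length_mergedList (σ := σ)]) noOcc))).1

/-- The `t`-th merged occurrence is the one with index `before` among those with its label, so
`filter_mergedList` matches its context with the one stored at `pos t`. -/
theorem X_pos_stringModel {t : ℕ} (ht : t < (stringModel k σ T).n) :
    (stringModel k σ T).pos t < (stringModel k σ T).n ∧
    (stringModel k σ T).X ((stringModel k σ T).pos t) =
      ((mergedList k T).getD t noOcc).2.ctx := by
  obtain ⟨a, ha⟩ : ∃ a, (stringModel k σ T).lab t = a := ⟨_, rfl⟩
  have hak : a < k := ha ▸ lab_lt_stringModel ht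
  have h1 : (stringModel k σ T).before a t < (sortedOccs (T a)).length := by
    rw [← before_n_stringModel (σ := σ) hak]
    subst ha
    exact Finset.card_lt_card (Finset.ssubset_iff_of_subset (fun i hi => by
      simp only [Finset.mem_filter, Finset.mem_range] at hi ⊢; omega) |>.2 ⟨t, by simp [ht]⟩)
  have h2 := congrArg (fun l => l.getD ((stringModel k σ T).before a t)
    (toLex ((mergedList k T).getD 0 noOcc).2.ctx)) (filter_mergedList (T := T) hak)
  rw [filter_mergedList_eq_map (σ := σ), List.map_map] at h2
  have h3 := List.getD_map (l := (List.range (stringModel k σ T).n).filter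
    fun t => (stringModel k σ T).lab t = a) (n := (stringModel k σ T).before a t) (d := 0)
    (f := (fun p : ℕ × Occ => toLex p.2.ctx) ∘ fun t => (mergedList k T).getD t noOcc)
  have h4 : ((List.range (stringModel k σ T).n).filter
    fun t => (stringModel k σ T).lab t = a).getD ((stringModel k σ T).before a t) 0 = t :=
    getD_filter_range _ ht ha 0
  rw [h4] at h3
  have h5 := h3.symm.trans h2
  rw [List.getD_eq_getElem _ _ (by simpa using h1), List.getElem_map] at h5
  rw [Model.pos, ha]
  constructor
  · have h6 := before_n_stringModel (σ := σ) (T := T) hak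
    rw [← length_sortedList (σ := σ)]
    have h7 : (sortedList k T).length = ∑ i ∈ Finset.range k, (sortedOccs (T i)).length := by
      rw [sortedList, length_flatMap_range]; simp
    have h8 := Finset.sum_range_le_of_le (f := fun i => (sortedOccs (T i)).length) (a := a + 1) hak
    rw [Finset.sum_range_succ, ← ns_stringModel (σ := σ) hak.le] at h8
    omega
  · change ((sortedList k T).getD _ noOcc).2.ctx = _
    rw [getD_sortedList hak h1]
    exact (toLex_inj.1 h5).symm

theorem ctx_lt {u : List ℕ} (h : ∀ a ∈ u, a < σ) {i : ℕ} (hi : i < u.length) (t : ℕ) :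
    (occAt u i).ctx t < σ := by
  refine h _ (getD_mem ?_ 0)
  exact Nat.mod_lt _ (by omega)

theorem valid_stringModel (hk : 0 < k) (hT : ∀ j < k, T j ≠ [])
    (hu : ∀ j < k, ∀ u ∈ T j, u ≠ [] ∧ ∀ a ∈ u, a < σ) : (stringModel k σ T).Valid := by
  have hns : ∀ j ≤ k, (stringModel k σ T).ns j = _ := fun j hj => ns_stringModel hj
  have hn : (stringModel k σ T).start (stringModel k σ T).R = (stringModel k σ T).n := by
    have := hns k le_rfl
    simp only [length_sortedOccs] at this
    exact this
  have hln : ∀ r < (stringModel k σ T).R, 0 < (stringModel k σ T).ln r := by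
    intro r hr
    have h1 := getD_mem (l := runList k T) (by rwa [length_runList (σ := σ)]) 0
    simp only [runList, List.mem_flatMap, List.mem_map] at h1
    obtain ⟨j, _, q, hq, h2⟩ := h1
    have := pos_of_mem_rle hq
    change 0 < ((runList k T).getD r 0).2.2
    rw [runList, ← h2]
    exact this
  have hmem : ∀ p < (stringModel k σ T).n, (sortedList k T).getD p noOcc ∈ sortedList k T :=
    fun p hp => getD_mem (by rwa [length_sortedList (σ := σ)]) _
  have hFL := fun A => (stringModel k σ T).first_last (A := A)
    (fun p => ((sortedList k T).getD p noOcc).1) (fun p => ((sortedList k T).getD p noOcc).2.char)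
    hn (fun p q hpq hq => by
      have h := List.pairwise_iff_getElem.1 (pairwise_sortedList (k := k) (T := T)) p q
        (by rw [length_sortedList (σ := σ)]; omega) (by rw [length_sortedList (σ := σ)]; omega) hpq
      rw [← List.getD_eq_getElem _ noOcc, ← List.getD_eq_getElem _ noOcc] at h
      exact h)
    (by
      have h := perm_full_sortedList (k := k) (T := T)
      rw [← map_range_getD (sortedList k T) noOcc, List.map_map, List.map_map,
        length_sortedList (σ := σ)] at h
      exact h)
    (fun r hr d hd => getD_sortedList_start hr hd)
  refine ⟨hk, ?_, rfl, hn, hln, ?_, ?_, fun A hA => (hFL A hA).1, ?_, ?_, fun t ht =>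
    lab_lt_stringModel ht, ?_, ?_, ?_, ?_⟩
  · intro j hj
    obtain ⟨u, hu'⟩ := List.exists_mem_of_ne_nil _ (hT j hj)
    by_contra h
    have h0 : rlbwt (T j) = [] := List.length_eq_zero_iff.1 (Nat.eq_zero_of_not_pos h)
    have h1 := length_rlbwt (T j)
    rw [h0, length_sortedOccs, length_occs] at h1
    have h2 := List.le_sum_of_mem (List.mem_map_of_mem (f := List.length) hu')
    have h3 := List.length_pos_of_ne_nil (hu j hj u hu').1
    simp at h1
    omega
  · intro r hr
    have h1 := getD_sortedList_start hr (hln r hr)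
    have h2 : (stringModel k σ T).start r + 0 < (stringModel k σ T).n := by
      have := Finset.sum_range_le_of_le (f := (stringModel k σ T).ln) (a := r + 1)
        (b := (stringModel k σ T).R) hr
      rw [Finset.sum_range_succ] at this
      have := hln r hr
      rw [← hn]; unfold Model.start; omega
    obtain ⟨hj, u, hu', i, hi, hx, _⟩ := mem_sortedList (σ := σ) (hmem _ h2)
    rw [← h1.2, hx]
    exact (hu _ hj u hu').2 _ (getD_mem hi 0)
  · intro j r h1 h2 (hj : j < k)
    have h3 : (stringModel k σ T).off (j + 1) =
        (stringModel k σ T).off j + (rlbwt (T j)).length := Finset.sum_range_succ _ _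
    obtain ⟨d, rfl⟩ := Nat.exists_eq_add_of_le h1
    change ((runList k T).getD _ 0).1 = _
    rw [getD_runList hj (by omega)]
  · intro A hA x hx d hd
    have := (hFL A hA).2 x hx d hd
    exact ⟨congrFun this 0, fun t => congrFun this (t + 1)⟩
  · intro p hp
    obtain ⟨hj, u, hu', i, hi, hx, _⟩ := mem_sortedList (σ := σ) (hmem _ hp)
    change ((sortedList k T).getD p noOcc).2.ctx 0 < σ
    rw [hx]
    exact ctx_lt (hu _ hj u hu').2 hi 0
  · intro j (hj : j < k)
    rw [before_n_stringModel hj, hns j hj.le, hns (j + 1) hj, Finset.sum_range_succ]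
  · intro t t' h ht'
    have h1 := List.pairwise_iff_getElem.1 (pairwise_mergedList (k := k) (T := T)) t t'
        (by rw [length_mergedList (σ := σ)]; omega) (by rw [length_mergedList (σ := σ)]; omega) h
    rw [← List.getD_eq_getElem _ noOcc, ← List.getD_eq_getElem _ noOcc] at h1
    unfold Model.Less
    rw [(X_pos_stringModel ht').2, (X_pos_stringModel (h.trans ht')).2]
    exact h1
  -- The occurrence at `pos t` need not be the `t`-th merged one, but it has the same context, hence
  -- the same character.
  · intro t ht r hr h1 h2
    obtain ⟨hp, hX⟩ := X_pos_stringModel ht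
    obtain ⟨d, hd⟩ := Nat.exists_eq_add_of_le h1
    have h3 : (stringModel k σ T).start (r + 1) =
      (stringModel k σ T).start r + (stringModel k σ T).ln r := Finset.sum_range_succ _ _
    have h4 := (getD_sortedList_start hr (d := d) (by omega)).2
    rw [← hd, char_eq_of_mem (σ := σ) (hmem _ hp)] at h4
    rw [← h4]
    change ((mergedList k T).getD t noOcc).2.char = (stringModel k σ T).X _ _
    rw [hX]
    exact char_eq_of_mem (σ := σ) (perm_mergedList.mem_iff.1
      (getD_mem (by rwa [length_mergedList (σ := σ)]) noOcc))
  · intro p hp q hq h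
    obtain ⟨_, u, _, i, hi, hx, hun⟩ := mem_sortedList (σ := σ) (hmem _ hp)
    obtain ⟨_, v, _, j, hj, hy, hvn⟩ := mem_sortedList (σ := σ) (hmem _ hq)
    change ∀ t < _, ((sortedList k T).getD p noOcc).2.ctx t =
      ((sortedList k T).getD q noOcc).2.ctx t at h
    change ((sortedList k T).getD p noOcc).2.ctx = ((sortedList k T).getD q noOcc).2.ctx
    rw [hx, hy] at h ⊢
    funext t
    -- Both contexts have the period `u.length * v.length`, at most `n * n`, so `t` can be reduced
    -- modulo it.
    have h1 := Nat.mod_add_div t (u.length * v.length)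
    have h2 : t % (u.length * v.length) < (stringModel k σ T).n * (stringModel k σ T).n :=
      (Nat.mod_lt _ (Nat.mul_pos (by omega) (by omega))).trans_le (Nat.mul_le_mul hun hvn)
    have h3 := h _ h2
    generalize t / (u.length * v.length) = b at h1
    rw [← h1]
    conv_lhs => rw [mul_assoc, ctx_occAt_add_mul]
    conv_rhs => rw [mul_comm u.length, mul_assoc, ctx_occAt_add_mul, mul_comm v.length]
    exact h3

/-- The two sorts may break ties differently. Their lists of contexts agree nevertheless, and all
characters are recovered from the contexts at the common index `n.factorial - 1`. -/
theorem eBWT_flatMap : eBWT ((List.range k).flatMap T) =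
    (List.range (stringModel k σ T).n).map (stringModel k σ T).out := by
  have h1 : ((List.range k).flatMap fun j => (occs (T j)).map (Prod.mk j)).map Prod.snd =
      occs ((List.range k).flatMap T) := by
    rw [occs, List.flatMap_assoc, List.map_flatMap]
    congr 1
    funext j
    rw [List.map_map]
    exact List.map_id _
  have h2 : ((mergedList k T).map Prod.snd).Perm (sortedOccs ((List.range k).flatMap T)) :=
    ((List.perm_insertionSort _ _).map _).trans (h1 ▸ (perm_sortedOccs _).symm)
  have h3 : ((mergedList k T).map Prod.snd).map (fun o => toLex o.ctx) =
      (sortedOccs ((List.range k).flatMap T)).map fun o => toLex o.ctx := by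
    refine eq_of_perm_of_pairwise_le (h2.map _) ?_ ?_
    · rw [List.map_map, List.pairwise_map]
      exact pairwise_mergedList.imp fun h => h.elim le_of_lt fun h => h.1.le
    · rw [List.pairwise_map]
      exact pairwise_sortedOccs _
  have h4 := congrArg (List.map fun x : Lex (ℕ → ℕ) =>
    ofLex x ((stringModel k σ T).n.factorial - 1)) h3
  have h5 : ∀ o ∈ (mergedList k T).map Prod.snd,
      o.ctx ((stringModel k σ T).n.factorial - 1) = o.char := by
    intro o ho
    obtain ⟨x, hx, rfl⟩ := List.mem_map.1 ho
    exact (char_eq_of_mem (perm_mergedList.mem_iff.1 hx)).symm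
  rw [List.map_map, List.map_map (l := sortedOccs _)] at h4
  rw [eBWT]
  have h6 : (sortedOccs ((List.range k).flatMap T)).map Occ.char =
      ((mergedList k T).map Prod.snd).map Occ.char := by
    rw [List.map_congr_left fun o ho => (h5 o (h2.mem_iff.2 ho)).symm,
      ← List.map_congr_left h5]
    exact h4.symm
  rw [h6, List.map_map]
  conv_lhs => rw [← map_range_getD (mergedList k T) noOcc, List.map_map,
    length_mergedList (σ := σ)]
  rfl

end

/-! ### The collections as a merging problem -/

section

variable {k : ℕ} (S : Fin k → List (List ℕ))

/-- The collections, indexed by natural numbers. -/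
def coll (j : ℕ) : List (List ℕ) := if h : j < k then S ⟨j, h⟩ else []

theorem coll_val (j : Fin k) : coll S j = S j := by simp [coll]

theorem flatMap_finRange {α : Type*} (F : ℕ → List α) (k : ℕ) :
    (List.finRange k).flatMap (fun j : Fin k => F j) = (List.range k).flatMap F := by
  rw [← List.map_coe_finRange_eq_range, List.flatMap_map]

theorem union_eq : union S = (List.range k).flatMap (coll S) := by
  rw [← flatMap_finRange]
  simp only [union, coll_val]

theorem totalLength_eq (σ : ℕ) : totalLength S = (stringModel k σ (coll S)).n := by
  simp only [totalLength, stringModel, Finset.sum_range, coll_val, length_occs]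

theorem totalRuns_eq (σ : ℕ) : totalRuns S = (stringModel k σ (coll S)).R := by
  simp only [totalRuns, stringModel, Finset.sum_range, coll_val]

theorem map_mergedOccs :
    (mergedOccs S).map (fun p => ((p.1 : ℕ), p.2)) = mergedList k (coll S) := by
  classical
  rw [mergedOccs, List.map_insertionSort (s := fun a b : ℕ × Occ => toLex a.2.ctx ≤ toLex b.2.ctx)
    (hl := fun _ _ _ _ => Iff.rfl), mergedList, List.map_flatMap, ← flatMap_finRange]
  congr 1
  refine List.flatMap_congr fun j _ => ?_
  rw [List.map_map, coll_val]
  rfl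

theorem agree_le_lcp (D : ℕ) (x y : ℕ → ℕ) : (agree D x y : ℕ∞) ≤ lcp x y := by
  refine le_iInf fun t => le_iInf fun ht => ?_
  rw [Nat.cast_le]
  by_contra h
  exact ht (eq_of_lt_agree (not_le.1 h))

/-- The capped prefixes are finite, so the time bound is proved without a case distinction on `L =
⊤`. -/
theorem totalWeight_le (hk : 0 < k) (σ : ℕ) :
    ((stringModel k σ (coll S)).totalWeight : ℕ∞) ≤ boundaryLCPSum S := by
  rw [boundaryLCPSum, sum_zip_tail (fun p q : Fin k × Occ => if p.1 = q.1 then (0 : ℕ∞) else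
    lcp p.2.ctx q.2.ctx) _ ((⟨0, hk⟩, noOcc.2) : Fin k × Occ)]
  have hl : (mergedOccs S).length = (stringModel k σ (coll S)).n := by
    rw [← length_mergedList, ← map_mergedOccs, List.length_map]
  have h1 : ∀ t, (mergedList k (coll S)).getD t noOcc =
      ((((mergedOccs S).getD t (⟨0, hk⟩, noOcc.2)).1 : ℕ),
        ((mergedOccs S).getD t (⟨0, hk⟩, noOcc.2)).2) := by
    intro t
    rw [← map_mergedOccs]
    exact List.getD_map (l := mergedOccs S) (n := t) (f := fun p : Fin k × Occ => ((p.1 : ℕ), p.2))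
      (d := ((⟨0, hk⟩, noOcc.2) : Fin k × Occ))
  rw [hl, Model.totalWeight, Nat.cast_sum]
  refine Finset.sum_le_sum fun t ht => ?_
  have ht := Finset.mem_range.1 ht
  unfold Model.weight Model.common
  rw [(X_pos_stringModel (t := t) (by omega)).2, (X_pos_stringModel (t := t + 1) (by omega)).2]
  change ((if ((mergedList k (coll S)).getD t noOcc).1 =
    ((mergedList k (coll S)).getD (t + 1) noOcc).1 then 0 else _ : ℕ) : ℕ∞) ≤ _
  rw [h1, h1]
  simp only [Fin.val_inj]
  split_ifs
  · simp
  · exact agree_le_lcp _ _ _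

theorem rlbwt_union (σ : ℕ) : rlbwt (union S) =
    rle ((List.range (stringModel k σ (coll S)).n).map (stringModel k σ (coll S)).out) := by
  rw [rlbwt, union_eq, eBWT_flatMap]

theorem valid_coll (hk : 0 < k) {σ : ℕ} (hS : ∀ j, S j ≠ [])
    (hu : ∀ j, ∀ u ∈ S j, u ≠ [] ∧ ∀ a ∈ u, a < σ) : (stringModel k σ (coll S)).Valid := by
  refine valid_stringModel hk (fun j hj => ?_) fun j hj => ?_
  · rw [coll, dif_pos hj]; exact hS _
  · rw [coll, dif_pos hj]; exact hu _

theorem encodeInput_eq (σ : ℕ) : encodeInput S =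
    (List.range k).map (stringModel k σ (coll S)).cnt ++
      (List.range (stringModel k σ (coll S)).R).flatMap fun r =>
        [(stringModel k σ (coll S)).ch r, (stringModel k σ (coll S)).ln r] := by
  rw [encodeInput]
  congr 1
  · rw [← List.map_coe_finRange_eq_range, List.map_map]
    refine List.map_congr_left fun j _ => ?_
    simp [stringModel, coll_val]
  · have h : (List.range (stringModel k σ (coll S)).R).flatMap (fun r =>
        [(stringModel k σ (coll S)).ch r, (stringModel k σ (coll S)).ln r]) =
        (runList k (coll S)).flatMap fun r => [r.2.1, r.2.2] := by
      conv_rhs => rw [← map_range_getD (runList k (coll S)) 0, List.flatMap_map,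
        length_runList (σ := σ)]
      rfl
    rw [h, runList, List.flatMap_assoc, ← flatMap_finRange]
    refine List.flatMap_congr fun j _ => ?_
    rw [List.flatMap_map, coll_val]
    rfl

end

theorem Model.Valid.col_lt {m : Model} (hv : m.Valid) {r : ℕ} (hr : r < m.R) : m.col r < m.k := by
  rw [← hv.off_k] at hr
  obtain ⟨j, hj, d, hd, rfl⟩ := exists_block m.cnt hr
  have h : m.off (j + 1) = m.off j + m.cnt j := Finset.sum_range_succ _ _
  change m.col (m.off j + d) < m.k
  rw [hv.col_eq j _ (Nat.le_add_right _ _) (by omega) hj]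
  exact hj

/-- Counts and lengths are at most `n` and characters are below `σ`, so the reduction in `initState`
leaves the input unchanged. -/
theorem input_initState {k : ℕ} (S : Fin k → List (List ℕ)) {σ w M : ℕ}
    (hv : (stringModel k σ (coll S)).Valid) (hf : (stringModel k σ (coll S)).Fits w M) :
    Input (stringModel k σ (coll S)) (initState w (encodeInput S)) := by
  obtain ⟨m, hm⟩ : ∃ m, stringModel k σ (coll S) = m := ⟨_, rfl⟩
  have he : encodeInput S = (List.range m.k).map m.cnt ++
      (List.range m.R).flatMap fun r => [m.ch r, m.ln r] := by
    rw [encodeInput_eq S σ, hm, ← hm]; rfl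
  rw [hm] at hv hf ⊢
  have hn := hf.n_lt
  have hRn := hv.R_le_n
  have hσ := hv.sigma_le
  have hkey := hf.key_lt
  have hruns : ∀ r < m.R, ∀ d < 2, (encodeInput S).getD (m.k + (2 * r + d)) 0 =
      [m.ch r, m.ln r].getD d 0 := by
    intro r hr d hd
    rw [he, List.getD_append_right _ _ _ _ (by simp)]
    have := getD_flatMap_range (fun r => [m.ch r, m.ln r]) 0 hr (d := d) hd
    simp only [List.length_cons, List.length_nil, Finset.sum_const, Finset.card_range,
      smul_eq_mul] at this
    simp only [List.length_map, List.length_range, Nat.add_sub_cancel_left]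
    rw [← this]
    congr 1
    ring
  refine ⟨fun j hj => ?_, fun r hr => ?_, fun r hr => ?_, rfl⟩
  · have h1 : m.cnt j ≤ m.R := by
      rw [← hv.off_k]
      exact Finset.single_le_sum (f := m.cnt) (fun _ _ => Nat.zero_le _) (Finset.mem_range.2 hj)
    have h2 : (encodeInput S).getD j 0 = m.cnt j := by
      rw [he, List.getD_append _ _ _ _ (by simpa), List.getD_eq_getElem _ _ (by simpa)]
      simp
    change (encodeInput S).getD j 0 % 2 ^ w = _
    rw [h2, Nat.mod_eq_of_lt (by omega)]
  · have h1 := hv.ch_lt r hr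
    have h2 := hruns r hr 0 (by omega)
    change (encodeInput S).getD (m.k + (2 * r + 0)) 0 % 2 ^ w = _
    rw [h2]
    exact Nat.mod_eq_of_lt (by simp; omega)
  · have h1 : m.ln r ≤ m.n := by
      rw [← hv.start_R]
      exact Finset.single_le_sum (f := m.ln) (fun _ _ => Nat.zero_le _) (Finset.mem_range.2 hr)
    have h2 := hruns r hr 1 (by omega)
    change (encodeInput S).getD (m.k + 1 + 2 * r) 0 % 2 ^ w = _
    rw [show m.k + 1 + 2 * r = m.k + (2 * r + 1) by ring, h2]
    exact Nat.mod_eq_of_lt (by simp; omega)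

/-! ### The resources -/

/-- With `B = 2 ^ (log (n + σ) + 1)` all parameters of the problem are below `B`, while `B ^ C ≤ 2 ^
w`. For the memory size, `C ≤ 2 ^ (C - 1)` absorbs the constant. -/
theorem Model.Valid.fits {m : Model} (hv : m.Valid) {w C : ℕ} (hC : 12 ≤ C)
    (hw : C * (Nat.log 2 (m.n + m.σ) + 1) ≤ w) : m.Fits w (C * m.R) := by
  have hk := hv.k_le_R
  have hk0 := hv.k_pos
  have hR := hv.R_le_n
  obtain ⟨B, hB⟩ : ∃ B, 2 ^ (Nat.log 2 (m.n + m.σ) + 1) = B := ⟨_, rfl⟩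
  have hlt : m.n + m.σ < B := hB ▸ Nat.lt_pow_succ_log_self (by norm_num) _
  have hBw : B ^ C ≤ 2 ^ w := by
    rw [← hB, ← pow_mul, mul_comm]
    exact Nat.pow_le_pow_right (by norm_num) hw
  have hB2 : 2 ≤ B := by omega
  have h4 : B * B * (B * B) ≤ 2 ^ w :=
    calc B * B * (B * B) = B ^ 4 := by ring
      _ ≤ B ^ C := Nat.pow_le_pow_right (by omega) (by omega)
      _ ≤ 2 ^ w := hBw
  have hBB : 4 ≤ B * B := Nat.mul_le_mul hB2 hB2
  have key : ∀ a b, a < B → b < B → 4 * (a * b) < 2 ^ w := by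
    intro a b ha hb
    calc 4 * (a * b) < 4 * (B * B) := Nat.mul_lt_mul_of_pos_left (Nat.mul_lt_mul'' ha hb) (by omega)
      _ ≤ B * B * (B * B) := Nat.mul_le_mul_right _ hBB
      _ ≤ _ := h4
  refine ⟨?_, ?_, ?_, ?_, key _ _ (by omega) (by omega)⟩
  · exact le_trans (by omega) (Nat.mul_le_mul_right m.R hC)
  · calc C * m.R ≤ 2 ^ (C - 1) * m.R := by
          have : C - 1 < 2 ^ (C - 1) := Nat.lt_two_pow_self
          exact Nat.mul_le_mul_right _ (by omega)
      _ < 2 ^ (C - 1) * B := Nat.mul_lt_mul_of_pos_left (by omega) (by positivity)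
      _ ≤ B ^ (C - 1) * B := Nat.mul_le_mul_right _ (Nat.pow_le_pow_left hB2 _)
      _ = B ^ C := by rw [← pow_succ]; congr 1; omega
      _ ≤ _ := hBw
  · have := key m.n 1 (by omega) (by omega)
    omega
  · have := key m.n m.n (by omega) (by omega)
    omega

/-- The logarithm of `σ` need not be bounded by that of `n`. But `σ ≤ R * (σ / R + 1)`, and the
logarithm of the second factor is at most the factor itself; after multiplication by `R` it
contributes at most `σ + R`. -/
theorem mul_clog_mul_le {k R σ : ℕ} (hk : k ≤ R) (hR : 0 < R) :
    R * Nat.clog 2 (k * σ) ≤ 2 * (R * Nat.clog 2 R) + σ + R := by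
  have h1 : σ ≤ R * (σ / R + 1) := (Nat.lt_mul_div_succ σ hR).le
  have h2 : Nat.clog 2 (k * σ) ≤ Nat.clog 2 R + (Nat.clog 2 R + (σ / R + 1)) := by
    refine Nat.clog_le_of_le_pow ?_
    have h3 := Nat.le_pow_clog (b := 2) (by norm_num) R
    have h4 : σ / R + 1 < 2 ^ (σ / R + 1) := Nat.lt_two_pow_self
    rw [pow_add, pow_add]
    exact Nat.mul_le_mul (hk.trans h3) (h1.trans (Nat.mul_le_mul h3 h4.le))
  calc R * Nat.clog 2 (k * σ) ≤ R * (Nat.clog 2 R + (Nat.clog 2 R + (σ / R + 1))) :=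
        Nat.mul_le_mul_left _ h2
    _ = 2 * (R * Nat.clog 2 R) + R * (σ / R) + R := by ring
    _ ≤ _ := by have := Nat.mul_div_le σ R; omega

/-! ### The running time in terms of the weight, `σ` and `R`. -/

namespace Model.Valid

variable {m : Model} (hv : m.Valid)
include hv

/-- Since `pos` is injective, at most `R` merged occurrences begin a run; the others that begin a
piece begin a block. -/
theorem pieces_zero_le : m.pieces 0 ≤ m.totalWeight + m.σ + m.R + 1 := by
  classical
  unfold pieces
  have h1 := hv.card_starts_le
  have h2 : ((Finset.range m.n).filter fun t => ∃ r < m.R, m.start r = m.pos t).card ≤ m.R := by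
    refine (Finset.card_le_card_of_injOn m.pos (t := (Finset.range m.R).image m.start) ?_ ?_).trans
      (Finset.card_image_le.trans_eq (Finset.card_range m.R))
    · intro t ht
      obtain ⟨_, r, hr, h⟩ := Finset.mem_filter.1 (Finset.mem_coe.1 ht)
      exact Finset.mem_coe.2 (Finset.mem_image.2 ⟨r, Finset.mem_range.2 hr, h⟩)
    · intro t ht t' ht' h
      have ht := Finset.mem_range.1 (Finset.mem_filter.1 (Finset.mem_coe.1 ht)).1
      have ht' := Finset.mem_range.1 (Finset.mem_filter.1 (Finset.mem_coe.1 ht')).1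
      exact hv.pos_inj ht ht' h
  have h3 : ((Finset.range m.n).filter fun t => 0 < t ∧
      (m.IsStart t ∨ ∃ r < m.R, m.start r = m.pos t)).card ≤
      ((Finset.range m.n).filter m.IsStart).card +
        ((Finset.range m.n).filter fun t => ∃ r < m.R, m.start r = m.pos t).card := by
    refine (Finset.card_le_card fun t ht => ?_).trans (Finset.card_union_le _ _)
    simp only [Finset.mem_union, Finset.mem_filter] at ht ⊢
    tauto
  have h4 : (if 0 < m.n then 1 else 0) ≤ 1 := by split_ifs <;> omega
  unfold totalWeight
  refine (Nat.add_le_add (h3.trans (Nat.add_le_add h1 h2)) h4).trans ?_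
  omega

theorem rankTime_le (G : ℕ) :
    m.rankTime G ≤ 1530 * (m.k * (Nat.log 2 m.n + 1) ^ 2 * (G + 1)) := by
  obtain ⟨l, hl⟩ : ∃ l, Nat.log 2 m.n + 1 = l := ⟨_, rfl⟩
  have hR : Nat.clog 2 m.R ≤ l := by
    have := clog_le_log_add_one m.R
    have := Nat.log_mono_right (b := 2) hv.R_le_n
    omega
  have hn : Nat.clog 2 (m.n + 1) ≤ 2 * l := by
    refine Nat.clog_le_of_le_pow ?_
    have h1 : m.n < 2 ^ l := hl ▸ Nat.lt_pow_succ_log_self (by norm_num) _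
    exact (Nat.succ_le_of_lt h1).trans (Nat.pow_le_pow_right (by norm_num) (by omega))
  have hl1 : 1 ≤ l := by omega
  have hk := hv.k_pos
  have hs : m.stepTime ≤ 320 * l := by unfold stepTime; omega
  have h1 : m.searchTime G ≤ 1380 * (l ^ 2 * (G + 1)) := by
    unfold searchTime
    calc _ ≤ 2 * l * ((G + 2) * (320 * l) + 30) + 40 := by gcongr
      _ ≤ 2 * l * ((G + 2) * (320 * l) + 30 * l) + 40 * (l * l) := by
          gcongr
          · omega
          · have := Nat.mul_le_mul hl1 hl1; omega
      _ = l ^ 2 * (640 * G + 1380) := by ring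
      _ ≤ l ^ 2 * (1380 * (G + 1)) := by gcongr; omega
      _ = _ := by ring
  have h2 : 1 ≤ l ^ 2 * (G + 1) := Nat.mul_pos (by positivity) (by omega)
  have h3 : 1 ≤ m.k * (l ^ 2 * (G + 1)) := Nat.mul_pos hk h2
  rw [hl]
  unfold rankTime
  calc _ ≤ m.k * (1380 * (l ^ 2 * (G + 1)) + 50 * (l ^ 2 * (G + 1))) + 100 := by
        gcongr; omega
    _ = 1430 * (m.k * (l ^ 2 * (G + 1))) + 100 := by ring
    _ ≤ 1530 * (m.k * (l ^ 2 * (G + 1))) := by omega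
    _ = _ := by ring

/-- Each rank costs a multiple of `reach t + 1`. The sum of `reach` is at most twice the weight, and
the number of summands at most the weight plus `σ`. -/
theorem sum_rankCost_le : ∑ t ∈ m.unranked 0, m.rankCost t ≤
    1580 * (m.k * (Nat.log 2 m.n + 1) ^ 2 * (3 * m.totalWeight + m.σ)) := by
  have h0 : ∀ t, m.rankCost t ≤ 1580 * (m.k * (Nat.log 2 m.n + 1) ^ 2) * (m.reach t + 1) := by
    intro t
    have h1 := hv.rankTime_le (m.reach t)
    have h2 : 1 ≤ m.k * (Nat.log 2 m.n + 1) ^ 2 * (m.reach t + 1) :=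
      Nat.mul_pos (Nat.mul_pos hv.k_pos (by positivity)) (by omega)
    unfold rankCost
    rw [mul_assoc]
    omega
  calc _ ≤ ∑ t ∈ (Finset.range m.n).filter m.IsStart, m.rankCost t := by
        refine Finset.sum_le_sum_of_subset fun t ht => ?_
        simp only [unranked, Finset.mem_filter] at ht ⊢
        tauto
    _ ≤ ∑ t ∈ (Finset.range m.n).filter m.IsStart,
          1580 * (m.k * (Nat.log 2 m.n + 1) ^ 2) * (m.reach t + 1) :=
        Finset.sum_le_sum fun t _ => h0 t
    _ = 1580 * (m.k * (Nat.log 2 m.n + 1) ^ 2) *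
          (∑ t ∈ (Finset.range m.n).filter m.IsStart, m.reach t +
            ((Finset.range m.n).filter m.IsStart).card) := by
        rw [← Finset.mul_sum, Finset.sum_add_distrib]; simp
    _ ≤ 1580 * (m.k * (Nat.log 2 m.n + 1) ^ 2) * (3 * m.totalWeight + m.σ) := by
        have h1 := sum_reach_le (m := m)
        have h2 := hv.card_starts_le
        refine Nat.mul_le_mul_left _ ?_
        unfold totalWeight
        omega
    _ = _ := by ring

theorem mainTime_le : m.mainTime ≤
    13000 * m.k ^ 2 * (m.totalWeight + m.σ + m.R) * (Nat.log 2 m.n + 1) ^ 2 := by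
  obtain ⟨V, hV⟩ : ∃ V, m.totalWeight + m.σ + m.R = V := ⟨_, rfl⟩
  have hk := hv.k_pos
  have hk1 : 1 ≤ m.k := hk
  have hkR := hv.k_le_R
  have hclog : Nat.clog 2 m.R ≤ Nat.log 2 m.n + 1 := by
    have := clog_le_log_add_one m.R
    have := Nat.log_mono_right (b := 2) hv.R_le_n
    omega
  have h1 := hv.rankTime_le (2 * m.totalWeight)
  have h2 := hv.sum_rankCost_le
  have h3 := hv.pieces_zero_le
  have h4 := mul_clog_mul_le (σ := m.σ) hkR (by omega)
  obtain ⟨l, hl⟩ : ∃ l, Nat.log 2 m.n + 1 = l := ⟨_, rfl⟩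
  rw [hl] at h1 h2 hclog ⊢
  have hl1 : 1 ≤ l := by omega
  have hll : l ≤ l ^ 2 := Nat.le_self_pow (by norm_num) l
  have hkk : m.k ≤ m.k ^ 2 := Nat.le_self_pow (by norm_num) m.k
  have key : ∀ {a b c : ℕ}, a ≤ m.k ^ 2 → b ≤ l ^ 2 → c ≤ V → a * b * c ≤ m.k ^ 2 * l ^ 2 * V :=
    fun ha hb hc => Nat.mul_le_mul (Nat.mul_le_mul ha hb) hc
  -- Every summand of the running time is at most a constant times `Y`, and these constants add up
  -- to less than `13000`.
  obtain ⟨Y, hY⟩ : ∃ Y, m.k ^ 2 * l ^ 2 * V = Y := ⟨_, rfl⟩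
  rw [hY] at key
  have e0 : V ≤ Y := by simpa using key (hk1.trans hkk) (hl1.trans hll) le_rfl
  have e1 : Nat.clog 2 (m.k * m.σ) * (m.R * 200 + 60) ≤ 780 * Y := by
    have g1 : m.R * Nat.clog 2 m.R ≤ Y := by
      refine (Nat.mul_le_mul_left _ hclog).trans ?_
      have := key (hk1.trans hkk) hll (c := m.R) (by omega)
      rw [one_mul, mul_comm] at this
      exact this
    have g2 : m.R * Nat.clog 2 (m.k * m.σ) ≤ 3 * Y := by omega
    calc _ ≤ Nat.clog 2 (m.k * m.σ) * (260 * m.R) := Nat.mul_le_mul_left _ (by omega)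
      _ = 260 * (m.R * Nat.clog 2 (m.k * m.σ)) := by ring
      _ ≤ _ := by omega
  have e2 : m.k * (m.rankTime (2 * m.totalWeight) + 140) ≤ 4730 * Y := by
    have g1 : m.k ^ 2 * l ^ 2 * (2 * m.totalWeight + 1) ≤ 2 * Y := by
      rw [← hY]
      calc _ ≤ m.k ^ 2 * l ^ 2 * (2 * V) := Nat.mul_le_mul_left _ (by omega)
        _ = _ := by ring
    calc _ ≤ m.k * (1530 * (m.k * l ^ 2 * (2 * m.totalWeight + 1)) + 140) := by gcongr
      _ = 1530 * (m.k ^ 2 * l ^ 2 * (2 * m.totalWeight + 1)) + 140 * m.k := by ring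
      _ ≤ _ := by omega
  have e3 : m.potential 0 ≤ 5840 * Y := by
    have g1 : m.baseTime * m.pieces 0 ≤ 1100 * Y := by
      have := key hkk (hl1.trans hll) le_rfl
      rw [mul_one] at this
      have hb : m.baseTime ≤ 550 * m.k := by unfold baseTime; omega
      calc _ ≤ 550 * m.k * (2 * V) := Nat.mul_le_mul hb (by omega)
        _ = 1100 * (m.k * V) := by ring
        _ ≤ _ := Nat.mul_le_mul_left _ this
    have g2 : m.k * l ^ 2 * (3 * m.totalWeight + m.σ) ≤ 3 * Y := by
      have := key hkk (le_refl (l ^ 2)) le_rfl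
      calc _ ≤ m.k * l ^ 2 * (3 * V) := Nat.mul_le_mul_left _ (by omega)
        _ = 3 * (m.k * l ^ 2 * V) := by ring
        _ ≤ _ := Nat.mul_le_mul_left _ this
    unfold potential
    omega
  have e4 : 13000 * m.k ^ 2 * V * l ^ 2 = 13000 * Y := by rw [← hY]; ring
  rw [hV, e4]
  unfold mainTime mergeTime
  omega

end Model.Valid

end RLBWT

theorem mainTheorem1 (k : ℕ) (hk : 0 < k) :
    ∃ (P : RLBWT.Prog) (C c : ℕ),
      ∀ (σ : ℕ) (S : Fin k → List (List ℕ)),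
        (∀ j, S j ≠ []) →
        (∀ j, ∀ u ∈ S j, u ≠ [] ∧ ∀ a ∈ u, a < σ) →
        ∀ w : ℕ, C * (Nat.log 2 (RLBWT.totalLength S + σ) + 1) ≤ w →
          ∃ (t : ℕ) (s : RLBWT.State),
            RLBWT.Run w (C * RLBWT.totalRuns S) P (RLBWT.initState w (RLBWT.encodeInput S)) t s ∧
            s.out = RLBWT.encodeRuns (RLBWT.rlbwt (RLBWT.union S)) ∧
            (t : ℕ∞) ≤ (C : ℕ∞) * (RLBWT.boundaryLCPSum S + (σ : ℕ∞) + (RLBWT.totalRuns S : ℕ∞)) *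
              ((Nat.log 2 (RLBWT.totalLength S) + 1 : ℕ) : ℕ∞) ^ c := by
  -- One constant serves for the time, the memory and the word size; the last two only need it to be
  -- at least `12`.
  refine ⟨RLBWT.mainProg k, 13000 * k ^ 2, 2, fun σ S hS hu w hw => ?_⟩
  have hC : 13000 ≤ 13000 * k ^ 2 := Nat.le_mul_of_pos_right _ (by positivity)
  have hv := RLBWT.valid_coll S hk hS hu
  rw [RLBWT.totalLength_eq S σ] at hw ⊢
  rw [RLBWT.totalRuns_eq S σ, RLBWT.rlbwt_union S σ]
  have hf := hv.fits (C := 13000 * k ^ 2) (by omega) hw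
  have hw0 : 0 < w := lt_of_lt_of_le (Nat.mul_pos (by omega) (by omega)) hw
  obtain ⟨t, s, hr, ht, ho⟩ := RLBWT.mainProg_spec hw0 hv hf (fun r hr => hv.col_lt hr)
    (RLBWT.input_initState S hv hf)
  refine ⟨t, s, hr, ho, ?_⟩
  have h1 : (t : ℕ∞) ≤ ((13000 * k ^ 2 * ((RLBWT.stringModel k σ (RLBWT.coll S)).totalWeight + σ +
      (RLBWT.stringModel k σ (RLBWT.coll S)).R) *
        (Nat.log 2 (RLBWT.stringModel k σ (RLBWT.coll S)).n + 1) ^ 2 : ℕ) : ℕ∞) :=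
    Nat.cast_le.2 (ht.trans hv.mainTime_le)
  refine h1.trans ?_
  rw [Nat.cast_mul, Nat.cast_mul (13000 * k ^ 2), Nat.cast_add, Nat.cast_add, Nat.cast_pow]
  gcongr
  exact RLBWT.totalWeight_le S hk σ
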